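/- Let $L$ be a $\mathbb Z$-lattice of rank $2k$ with a positive definite symmetric bilinear form $B$ (extended to $V=\mathbb Q L$) and quadratic form $Q(x)=B(x,x)$, and suppose that $L$ is even integral, i.e. $Q(L)\subseteq 2\mathbb Z$. Let $N$ be the level of $L$, i.e. the least positive integer such that $NA^{-1}$ is an integral matrix with even diagonal, $A$ being a Gram matrix of $L$. Let $p$ be a prime with $p\nmid N$, and regard $L/pL$ as a quadratic space over $\mathbb Z/p\mathbb Z$ with the form $Q \bmod p$ if $p\neq 2$, and $\tfrac12 Q \bmod 2$ if $p=2$. Put $\chi(p)=1$ if $L/pL$ is hyperbolic (an orthogonal sum of hyperbolic planes) and $\chi(p)=-1$ otherwise. Let $1\le n\le 2k$ and $j\ge 1$, and assume $j\le k$ if $\chi(p)=1$ and $j<k$ if $\chi(p)=-1$. **Notation.** For $m\in\mathbb Z$ and an integer $r\ge 0$ put $$\delta(m,r)=\prod_{i=0}^{r-1}(p^{m-i}+1),\qquad \beta(m,r)=\prod_{i=0}^{r-1}\frac{p^{m-i}-1}{p^{r-i}-1}$$ (both equal to $1$ if $r=0$). For a subspace $U$ of $L/pL$ let $\varphi_\ell(U)$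 be the number of $\ell$-dimensional subspaces of $U$ on which the quadratic form vanishes. For $\tau$ in the Siegel upper half-space of degree $n$ and a rational symmetric matrix $T$ put $e\{T\tau\}=\exp(\pi i\,\mathrm{Tr}(T\tau))$, and for a lattice $K$ on $V$ put $\theta(K;\tau)=\sum_{(x_1,\dots,x_n)\in K^n}e\{(B(x_i,x_{i'}))\tau\}$. A formally rank $n$ sublattice $\Omega$ of $\frac1pL$ is a formal direct sum $\mathbb Zx_1\oplus\cdots\oplus\mathbb Zx_n$ with $x_i\in\frac1pL$ (possibly dependent), that is, the orbit of $(x_1,\dots,x_n)$ under $(x_1,\dots,x_n)\mapsto(x_1,\dots,x_n)G$ with $G\in GL_n(\mathbb Z)$ if $k$ is even, $G\in SL_n(\mathbb Z)$ if $k$ is odd. The elements of the orbit are the bases of $\Omega$. It is even integral if the matrix $(B(x_i,x_{i'}))$ is integral with even diagonal. Put $e\{\Omega\tau\}=\sum e\{(B(y_i,y_{i'}))\tau\}$, the sum being over the distinct bases $(y_1,\dots,y_n)$ of $\Omega$. Let $K_j$ run over all lattices on $V$ with $pL\subseteq K_j\subseteq\frac1pL$ and $K_j\in\mathrm{gen}\,L$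 (i.e. $\mathbb Z_qK_j\simeq\mathbb Z_qL$ for all primes $q$) such that $\frac1p$ and $p$ each occur exactly $j$ times among the invariant factors of $K_j$ in $L$. **Claim.** There are finitely many such $K_j$, and for every $\tau$ $$\sum_{K_j}\theta(K_j;\tau)=\sum_{\Omega}b_j(\Omega)\,e\{\Omega\tau\},$$ where all the series involved converge absolutely, $\Omega$ runs over all even integral, formally rank $n$ sublattices of $\frac1pL$, and the coefficient $b_j(\Omega)$ is the number of $K_j$ that contain $\Omega$. Every such $\Omega$ has a decomposition $$\Omega=\tfrac1p\Omega_0\oplus\Omega_1\oplus p\,\Omega_2,$$ where $\Omega_0,\Omega_1,\Omega_2$ are formal sublattices of $L$ of ranks $r_0,r_1,r_2$ and the image of $\Omega_0\oplus\Omega_1$ in $L/pL$ has dimension $r_0+r_1$. For every such decomposition, with $\overline\Omega_1$ the image of $\Omega_1$ in $L/pL$: if $\chi(p)=1$, then $$b_j(\Omega)=p^{(j-r_0)(j-r_0-1)/2}\sum_{0\le\ell\le j-r_0}p^{\ell(k-j-r_1+\ell)}\varphi_\ell(\overline\Omega_1)\,\delta(k-r_0-\ell-1,j-r_0-\ell)\,\beta(k-r_0-r_1,j-r_0-\ell),$$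 and if $\chi(p)=-1$, then $$b_j(\Omega)=p^{(j-r_0)(j-r_0-1)/2}\sum_{0\le\ell\le j-r_0}(-1)^\ell p^{\ell(k-j-r_1+\ell)}\varphi_\ell(\overline\Omega_1)\,\beta(k-r_0-\ell-1,j-r_0-\ell)\,\delta(k-r_0-r_1,j-r_0-\ell).$$ (If $j<r_0$ the sum is empty and $b_j(\Omega)=0$.) -/

import Mathlib

open scoped TensorProduct Pointwise

namespace SiegelTheta

noncomputable section

variable {V : Type*} [AddCommGroup V] [Module ℚ V]

/-! ### The functions `δ`, `μ`, `β` (the value at `r = 0` is `1`) -/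

/-- `δ(m,r) = ∏_{i<r} (p^{m-i} + 1)`; here `m` may be any integer. -/
def delta (p : ℕ) (m : ℤ) (r : ℕ) : ℚ :=
  ∏ i ∈ Finset.range r, ((p : ℚ) ^ (m - (i : ℤ)) + 1)

/-- `β(m,r) = ∏_{i<r} (p^{m-i} - 1) / (p^{r-i} - 1)`; here `m` may be any integer. -/
def beta (p : ℕ) (m : ℤ) (r : ℕ) : ℚ :=
  ∏ i ∈ Finset.range r,
    ((p : ℚ) ^ (m - (i : ℤ)) - 1) / ((p : ℚ) ^ ((r : ℤ) - (i : ℤ)) - 1)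

/-! ### Even integral lattices, Gram matrices, the level

`B` is the symmetric bilinear form and `Q(x) = B(x,x)` the quadratic form. -/

/-- `Q(K) ⊆ 2ℤ`. -/
def IsEvenIntegral (B : LinearMap.BilinForm ℚ V) (K : Submodule ℤ V) : Prop :=
  ∀ x ∈ K, ∃ m : ℤ, B x x = 2 * (m : ℚ)

/-- The matrix `(B(x_i, x_j))`. -/
def gram {ι : Type*} (B : LinearMap.BilinForm ℚ V) (x : ι → V) : Matrix ι ι ℚ :=
  Matrix.of fun i i' => B (x i) (x i')

/-- An integral matrix with even diagonal. -/
def IsEvenMatrix {ι : Type*} (T : Matrix ι ι ℚ) : Prop :=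
  (∀ i i', ∃ m : ℤ, T i i' = (m : ℚ)) ∧ ∀ i, ∃ m : ℤ, T i i = 2 * (m : ℚ)

/-- The level of `L`: the smallest positive integer `N` such that `N A⁻¹` is even integral,
`A` being the Gram matrix of a `ℤ`-basis of `L` (the condition does not depend on the basis). -/
def level (B : LinearMap.BilinForm ℚ V) (L : Submodule ℤ V) : ℕ :=
  sInf {N : ℕ | 0 < N ∧ ∃ v : Module.Basis (Fin (Module.finrank ℚ V)) ℤ L,
    IsEvenMatrix ((N : ℚ) • (gram B (fun i => ((v i : L) : V)))⁻¹)}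

/-! ### The quadratic space `L / pL` over `ℤ / pℤ` -/

/-- `L / pL`. -/
def ModP (p : ℕ) (L : Submodule ℤ V) : Type _ :=
  L ⧸ ((p : ℤ) • (⊤ : Submodule ℤ L))

instance (p : ℕ) (L : Submodule ℤ V) : AddCommGroup (ModP p L) :=
  inferInstanceAs (AddCommGroup (L ⧸ ((p : ℤ) • (⊤ : Submodule ℤ L))))

/-- The reduction map `L → L / pL`. -/
def red (p : ℕ) (L : Submodule ℤ V) : L →+ ModP p L :=
  (Submodule.mkQ ((p : ℤ) • (⊤ : Submodule ℤ L))).toAddMonoidHom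

theorem red_surjective (p : ℕ) (L : Submodule ℤ V) : Function.Surjective (red p L) :=
  Submodule.mkQ_surjective _

theorem red_eq_iff (p : ℕ) (L : Submodule ℤ V) (x y : L) :
    red p L x = red p L y ↔ ∃ z : L, x - y = (p : ℤ) • z := by
  refine (Submodule.Quotient.eq _).trans ?_
  rw [Submodule.mem_smul_pointwise_iff_exists]
  constructor
  · rintro ⟨z, -, hz⟩
    exact ⟨z, hz.symm⟩
  · rintro ⟨z, hz⟩
    exact ⟨z, trivial, hz.symm⟩

theorem nsmul_modP (p : ℕ) (L : Submodule ℤ V) (x : ModP p L) : p • x = 0 := by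
  obtain ⟨y, rfl⟩ := red_surjective p L x
  rw [← map_nsmul, ← map_zero (red p L), red_eq_iff]
  exact ⟨y, by simp⟩

instance (p : ℕ) (L : Submodule ℤ V) : Module (ZMod p) (ModP p L) :=
  AddCommGroup.zmodModule (nsmul_modP p L)

/-- For `x` in an even integral lattice: the integer `Q(x)` if `p ≠ 2`, and the integer
`½ Q(x)` if `p = 2`. -/
def intForm (p : ℕ) (B : LinearMap.BilinForm ℚ V) (x : V) : ℤ :=
  if p = 2 then ⌊B x x / 2⌋ else ⌊B x x⌋

/-- The induced quadratic form on `L / pL`: `Q` modulo `p` if `p ≠ 2`, and `½ Q` modulo `2` if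
`p = 2`.  It is computed on a representative, and does not depend on it (`redForm_red`). -/
def redForm (p : ℕ) (B : LinearMap.BilinForm ℚ V) (L : Submodule ℤ V) (x : ModP p L) : ZMod p :=
  (intForm p B ((Function.surjInv (red_surjective p L) x : L) : V) : ZMod p)

theorem redForm_red (p : ℕ) (B : LinearMap.BilinForm ℚ V) (L : Submodule ℤ V)
    (hB : B.IsSymm) (hL : IsEvenIntegral B L) (x : L) :
    redForm p B L (red p L x) = (intForm p B (x : V) : ZMod p) := by
  set y : L := Function.surjInv (red_surjective p L) (red p L x) with hy
  have h1 : red p L y = red p L x := Function.surjInv_eq _ _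
  obtain ⟨z, hz⟩ := (red_eq_iff p L y x).1 h1
  have hyx : (y : V) = (x : V) + (p : ℚ) • (z : V) := by
    have h2 : y = x + (p : ℤ) • z := by rw [← hz]; abel
    rw [h2]
    push_cast
    congr 1
    simp [Nat.cast_smul_eq_nsmul]
  obtain ⟨a, ha⟩ := hL x x.2
  obtain ⟨c, hc⟩ := hL z z.2
  obtain ⟨d, hd⟩ := hL (x + z : V) (L.add_mem x.2 z.2)
  have hs : B (z : V) (x : V) = B (x : V) (z : V) := hB.eq _ _
  have hm : B (x : V) (z : V) = ((d - a - c : ℤ) : ℚ) := by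
    simp only [map_add, LinearMap.add_apply, hs, ha, hc] at hd
    push_cast
    linarith
  have hyy : B (y : V) (y : V) = 2 * ((a + p * (d - a - c) + p * p * c : ℤ) : ℚ) := by
    rw [hyx]
    simp only [map_add, LinearMap.add_apply, map_smul, LinearMap.smul_apply, smul_eq_mul,
      hs, ha, hc, hm]
    push_cast
    ring
  change ((intForm p B (y : V) : ℤ) : ZMod p) = _
  have hfl : ∀ t : ℤ, ⌊(2 : ℚ) * (t : ℚ)⌋ = 2 * t := by
    intro t
    exact_mod_cast Int.floor_intCast (R := ℚ) (2 * t)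
  unfold intForm
  split_ifs with hp
  · rw [hyy, ha, mul_div_cancel_left₀ _ (two_ne_zero), mul_div_cancel_left₀ _ (two_ne_zero),
      Int.floor_intCast, Int.floor_intCast]
    push_cast
    simp
  · rw [hyy, ha, hfl, hfl]
    push_cast
    simp

/-- `L / pL` is hyperbolic, i.e. an orthogonal sum of planes spanned by `e, f` with
`B(e,e) = B(f,f) = 0`, `B(e,f) = 1`.  The quadratic form takes the value `2 ∑ a_i c_i`
(`p ≠ 2`, where `Q(x) = B(x,x)`), resp. `∑ a_i c_i` (`p = 2`, where `Q(x) = ½ B(x,x)`) at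
`∑ a_i e_i + ∑ c_i f_i`. -/
def IsHyperbolic (p : ℕ) (B : LinearMap.BilinForm ℚ V) (L : Submodule ℤ V) : Prop :=
  ∃ (m : ℕ) (e : Module.Basis (Fin m ⊕ Fin m) (ZMod p) (ModP p L)),
    ∀ a c : Fin m → ZMod p,
      redForm p B L (∑ i, a i • e (Sum.inl i) + ∑ i, c i • e (Sum.inr i)) =
        (if p = 2 then 1 else 2) * ∑ i, a i * c i

open Classical in
/-- The value `χ(p)` at a prime `p` not dividing the level: `1` if `L / pL` is hyperbolic and
`-1` otherwise. -/
def chi (p : ℕ) (B : LinearMap.BilinForm ℚ V) (L : Submodule ℤ V) : ℤ :=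
  if IsHyperbolic p B L then 1 else -1

/-- `φ_ℓ(U)`: the number of `ℓ`-dimensional totally isotropic subspaces of the subspace `U` of
`L / pL`. -/
def phi (p : ℕ) (B : LinearMap.BilinForm ℚ V) (L : Submodule ℤ V)
    (U : Submodule (ZMod p) (ModP p L)) (l : ℕ) : ℕ :=
  Nat.card {W : Submodule (ZMod p) (ModP p L) //
    W ≤ U ∧ Module.finrank (ZMod p) W = l ∧ ∀ w ∈ W, redForm p B L w = 0}

/-! ### The lattices `K_j` -/

/-- `a_1, …, a_r` are the invariant factors `{L : K}` of `K` in `L`. -/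
def IsInvariantFactors {r : ℕ} (L K : Submodule ℤ V) (a : Fin r → ℚ) : Prop :=
  (∀ i, 0 < a i) ∧ (∀ i i', i ≤ i' → ∃ m : ℤ, a i' = m * a i) ∧
    ∃ v : Module.Basis (Fin r) ℤ L,
      K = Submodule.span ℤ (Set.range fun i => a i • ((v i : L) : V))

/-- `ℤ_q K`, as a `ℤ_q`-submodule of `ℚ_q ⊗ V`. -/
def localization (q : ℕ) [Fact q.Prime] (K : Submodule ℤ V) :
    Submodule ℤ_[q] (ℚ_[q] ⊗[ℚ] V) :=
  Submodule.span ℤ_[q] ((fun x : V => (1 : ℚ_[q]) ⊗ₜ[ℚ] x) '' (K : Set V))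

/-- `K ∈ gen L` for lattices `K`, `L` on the same quadratic space: for every prime `q`, an
isometry of `ℚ_q ⊗ V` carries `ℤ_q K` onto `ℤ_q L`. -/
def InGenus (B : LinearMap.BilinForm ℚ V) (L K : Submodule ℤ V) : Prop :=
  ∀ (q : ℕ) [Fact q.Prime],
    ∃ σ : (ℚ_[q] ⊗[ℚ] V) ≃ₗ[ℚ_[q]] (ℚ_[q] ⊗[ℚ] V),
      (∀ x y, LinearMap.BilinForm.baseChange ℚ_[q] B (σ x) (σ y) =
        LinearMap.BilinForm.baseChange ℚ_[q] B x y) ∧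
      σ '' (localization q K : Set (ℚ_[q] ⊗[ℚ] V)) = localization q L

/-- The set of all lattices `K_j`: `pL ⊆ K_j ⊆ (1/p)L`, both `1/p` and `p` have multiplicity `j`
as invariant factors of `K_j` in `L`, and `K_j ∈ gen L`. -/
def neighbours (p : ℕ) (B : LinearMap.BilinForm ℚ V) (L : Submodule ℤ V) (j : ℕ) :
    Set (Submodule ℤ V) :=
  {K | (∀ x ∈ L, (p : ℚ) • x ∈ K) ∧ (∀ x ∈ K, (p : ℚ) • x ∈ L) ∧
    (∃ a : Fin (Module.finrank ℚ V) → ℚ, IsInvariantFactors L K a ∧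
      Nat.card {i // a i = 1 / (p : ℚ)} = j ∧ Nat.card {i // a i = (p : ℚ)} = j) ∧
    InGenus B L K}

/-! ### Theta series -/

/-- The Siegel upper half-space of degree `n`. -/
def siegelUpperHalfSpace (n : ℕ) : Set (Matrix (Fin n) (Fin n) ℂ) :=
  {τ | τ.IsSymm ∧ (τ.map Complex.im).PosDef}

/-- `e{Tτ} = exp(π i Tr(Tτ))`. -/
def expTr {n : ℕ} (T : Matrix (Fin n) (Fin n) ℚ) (τ : Matrix (Fin n) (Fin n) ℂ) : ℂ :=
  Complex.exp ((Real.pi : ℂ) * Complex.I * Matrix.trace (T.map (fun t : ℚ => (t : ℂ)) * τ))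

/-- The degree `n` theta series of `K`: the sum of `e{(B(x_i,x_j))τ}` over all
`(x_1, …, x_n) ∈ K^n`. -/
def theta {n : ℕ} (B : LinearMap.BilinForm ℚ V) (K : Submodule ℤ V)
    (τ : Matrix (Fin n) (Fin n) ℂ) : ℂ :=
  ∑' x : Fin n → K, expTr (gram B fun i => ((x i : K) : V)) τ

/-- `GL_n(ℤ)` if `k` is even, `SL_n(ℤ)` if `k` is odd. -/
def frameGroup (n k : ℕ) : Subgroup (Matrix.GeneralLinearGroup (Fin n) ℤ) :=
  if Even k then ⊤ else (Matrix.GeneralLinearGroup.det (n := Fin n) (R := ℤ)).ker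

/-- The (oriented, if `k` is odd) formal lattice `ℤ x_1 ⊕ ⋯ ⊕ ℤ x_n`, given as the set of its
(oriented) bases `(x_1, …, x_n) G`.  The `x_i` may be linearly dependent in `V`. -/
def frames {n : ℕ} (k : ℕ) (x : Fin n → V) : Set (Fin n → V) :=
  {y | ∃ G ∈ frameGroup n k,
    ∀ i, y i = ∑ i', (G : Matrix (Fin n) (Fin n) ℤ) i' i • x i'}

/-- The even integral, formally rank `n` sublattices `Ω` of `(1/p)L`. -/
def formalLattices (p : ℕ) (B : LinearMap.BilinForm ℚ V) (L : Submodule ℤ V) (n k : ℕ) :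
    Set (Set (Fin n → V)) :=
  {Ω | ∃ x : Fin n → V, (∀ i, (p : ℚ) • x i ∈ L) ∧ IsEvenMatrix (gram B x) ∧ Ω = frames k x}

/-- `e{Ωτ}`: the sum of `e{(B(x_i,x_j))τ}` over the bases `(x_1, …, x_n)` of `Ω`. -/
def expLattice {n : ℕ} (B : LinearMap.BilinForm ℚ V) (Ω : Set (Fin n → V))
    (τ : Matrix (Fin n) (Fin n) ℂ) : ℂ :=
  ∑' y : Ω, expTr (gram B (y : Fin n → V)) τ

/-- The coefficient of `e{Ωτ}` in `∑_{K ∈ S} θ(K;τ)`, where `θ(K;τ) = ∑_{Ω ⊆ K} e{Ωτ}`: the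
number of `K ∈ S` that contain `Ω`. -/
def thetaCoeff {n : ℕ} (S : Set (Submodule ℤ V)) (Ω : Set (Fin n → V)) : ℕ :=
  Set.ncard {K ∈ S | ∀ y ∈ Ω, ∀ i, y i ∈ K}

/-! ### The decomposition `Ω = (1/p) Ω₀ ⊕ Ω₁ ⊕ p Ω₂` -/

/-- A decomposition `(1/p) Ω₀ ⊕ Ω₁ ⊕ p Ω₂` along the basis `x` of a formal lattice, where
`Ω₀, Ω₁, Ω₂` are formal sublattices of `L` and `Ω₀ ⊕ Ω₁` is primitive in `L` modulo `p`, i.e. its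
image in `L / pL` has dimension `rank Ω₀ + rank Ω₁`.  The basis of `Ω_s` consists of the `gen i`
with `part i = s`, so that `x i = p^{s-1} gen i`. -/
structure Decomposition (p : ℕ) (L : Submodule ℤ V) {n : ℕ} (x : Fin n → V) where
  part : Fin n → Fin 3
  gen : Fin n → L
  eq_smul : ∀ i, x i = (p : ℚ) ^ (((part i : ℕ) : ℤ) - 1) • ((gen i : L) : V)
  primitive : LinearIndependent (ZMod p) fun i : {i // part i ≠ 2} => red p L (gen i.1)

/-- `r_s`, the rank of `Ω_s`. -/
def Decomposition.rank {p : ℕ} {L : Submodule ℤ V} {n : ℕ} {x : Fin n → V}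
    (D : Decomposition p L x) (s : Fin 3) : ℕ :=
  Fintype.card {i // D.part i = s}

/-- The subspace `Ω̄₁` of `L / pL`. -/
def Decomposition.omegaOneBar {p : ℕ} {L : Submodule ℤ V} {n : ℕ} {x : Fin n → V}
    (D : Decomposition p L x) : Submodule (ZMod p) (ModP p L) :=
  Submodule.span (ZMod p) (Set.range fun i : {i // D.part i = 1} => red p L (D.gen i.1))

/-- The right-hand side for `χ(p) = 1`; the summation is over `0 ≤ ℓ ≤ j - r₀`
(so the sum is empty if `j < r₀`). -/
def formulaPlus (p : ℕ) (B : LinearMap.BilinForm ℚ V) {L : Submodule ℤ V} (k j : ℕ) {n : ℕ}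
    {x : Fin n → V} (D : Decomposition p L x) : ℚ :=
  (p : ℚ) ^ ((j - D.rank 0) * (j - D.rank 0 - 1) / 2) *
    ∑ l ∈ (Finset.range (j + 1)).filter (fun l => l + D.rank 0 ≤ j),
      (p : ℚ) ^ ((l : ℤ) * ((k : ℤ) - j - D.rank 1 + l)) * (phi p B L D.omegaOneBar l : ℚ) *
        delta p ((k : ℤ) - D.rank 0 - l - 1) (j - D.rank 0 - l) *
        beta p ((k : ℤ) - D.rank 0 - D.rank 1) (j - D.rank 0 - l)

/-- The right-hand side for `χ(p) = -1`; the summation is over `0 ≤ ℓ ≤ j - r₀`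
(so the sum is empty if `j < r₀`). -/
def formulaMinus (p : ℕ) (B : LinearMap.BilinForm ℚ V) {L : Submodule ℤ V} (k j : ℕ) {n : ℕ}
    {x : Fin n → V} (D : Decomposition p L x) : ℚ :=
  (p : ℚ) ^ ((j - D.rank 0) * (j - D.rank 0 - 1) / 2) *
    ∑ l ∈ (Finset.range (j + 1)).filter (fun l => l + D.rank 0 ≤ j),
      (-1 : ℚ) ^ l *
        (p : ℚ) ^ ((l : ℤ) * ((k : ℤ) - j - D.rank 1 + l)) * (phi p B L D.omegaOneBar l : ℚ) *
        beta p ((k : ℤ) - D.rank 0 - l - 1) (j - D.rank 0 - l) *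
        delta p ((k : ℤ) - D.rank 0 - D.rank 1) (j - D.rank 0 - l)

end

end SiegelTheta

/-! Everything happens in the reduction W = L/pL. As p does not divide the level, B is nondegenerate
modulo p, so q = ½Q mod p makes W a nondegenerate quadratic space of dimension 2k, for p = 2 as
well. Its sign ε (`wittSign`), which records whether a totally isotropic subspace of dimension k
exists, is χ(p).

To a lattice K between pL and p⁻¹L attach the images C of pK and D of K ∩ L in W. The multiplicities
of 1/p and p are dim C and 2k − dim D. If K is even, C is totally isotropic and D ⊆ C^⊥, hence D =
C^⊥ when both multiplicities are j. The genus condition then amounts to evenness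
(`mem_neighbours_iff`). Evenness is local, so it passes through the genus. Conversely D = C^⊥ makes
an even K unimodular at p, and K is joined to L by a chain of neighbours, consecutive ones being
exchanged over ℤ_p by a reflection (`adjoin_inGenus`, `inGenus_of_commensurable`).

Fix C. The lattices K over C lie between `coreLattice` of C^⊥ and `hatLattice` of C. With the form
induced by p·½B the quotient is nondegenerate of dimension 2j, the image Λ of L is a Lagrangian, and
the K are the Lagrangians complementary to Λ. Those containing a given r₀-dimensional totally
isotropic subspace that meets Λ trivially number p^((j−r₀)(j−r₀−1)/2) (`count_complements`). Now pΩ₂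
lies in every K, and Ω₁ lies in K exactly when Ω̄₁ ⊆ C^⊥. So b_j(Ω) is this power of p times the
number of j-dimensional totally isotropic C with Ω̄₀ ⊆ C ⊆ U^⊥, where U = Ω̄₀ ⊕ Ω̄₁
(`count_neighbours`).

Neither U nor U^⊥ need be nondegenerate. A double count expresses the number of isotropic vectors of
U^⊥ by that of U (`isoVec_perp`), and `isoSub_recurrence` builds totally isotropic subspaces one
dimension at a time from the number of isotropic vectors and the subspaces through isotropic vectors
of the radical. Since U and U^⊥ have the same radical U ∩ U^⊥, comparing the two recurrences yields
by induction `isoSub_perp`: the count for U^⊥ is a combination of the counts for U. The coefficients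
`coef` are products which for ε = 1 and ε = −1 become δ·β and β·δ. Finally, subspaces of U
containing Ω̄₀ correspond to subspaces of Ω̄₁ (`isoSub_sup`), which produces φ_ℓ.

The identity of theta series is a rearrangement (`hasSum_theta`): every n-tuple in K is a basis of
exactly one formal lattice. All series are subseries of one over p⁻¹L, dominated by a Gaussian sum.
The decomposition of Ω comes from eliminating linear relations modulo p by integral column
operations of determinant one. -/

set_option linter.unusedSectionVars false

/-! ### Counting isotropic vectors and subspaces of a quadratic space over a finite field -/

namespace IsotropicCount

open Module Submodule

noncomputable section

/-- The number of elements satisfying a predicate, as a rational number. -/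
def count {α : Type*} (s : α → Prop) : ℚ := (Nat.card {y // s y} : ℚ)

theorem count_eq_sum {α : Type*} [Fintype α] (s : α → Prop) [DecidablePred s] :
    count s = ∑ y, if s y then (1 : ℚ) else 0 := by
  rw [count, Nat.card_eq_fintype_card, Fintype.card_subtype, Finset.sum_boole]

theorem count_congr {α : Type*} {s t : α → Prop} (h : ∀ y, s y ↔ t y) : count s = count t := by
  rw [show s = t from funext fun y => propext (h y)]

theorem count_split {α : Type*} [Finite α] (s t : α → Prop) :
    count s = count (fun y => s y ∧ t y) + count (fun y => s y ∧ ¬ t y) := by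
  classical
  cases nonempty_fintype α
  simp only [count_eq_sum, ← Finset.sum_add_distrib]
  refine Finset.sum_congr rfl fun y _ => ?_
  by_cases hs : s y <;> by_cases ht : t y <;> simp [hs, ht]

theorem count_equiv {α β : Type*} {s : α → Prop} {t : β → Prop} (e : α ≃ β)
    (h : ∀ y, s y ↔ t (e y)) : count s = count t := by
  unfold count
  rw [Nat.card_congr (e.subtypeEquiv h)]

theorem count_sigma {α β : Type*} [Fintype α] [Finite β] (s : α → β → Prop) :
    count (fun x : α × β => s x.1 x.2) = ∑ a, count (s a) := by
  classical
  cases nonempty_fintype β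
  simp only [count_eq_sum, Fintype.sum_prod_type]

theorem count_sigma' {α β : Type*} [Finite α] [Fintype β] (s : α → β → Prop) :
    count (fun x : α × β => s x.1 x.2) = ∑ b, count (fun a => s a b) := by
  classical
  cases nonempty_fintype α
  simp only [count_eq_sum, Fintype.sum_prod_type_right]

variable {F W : Type*} [Field F] [Fintype F] [AddCommGroup W] [Module F W] [Finite W]

theorem one_lt_P : (1 : ℚ) < Fintype.card F := by
  exact_mod_cast Fintype.one_lt_card

theorem P_ne_zero : (Fintype.card F : ℚ) ≠ 0 := by
  have := one_lt_P (F := F); positivity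

theorem count_mem (X : Submodule F W) :
    count (· ∈ X) = (Fintype.card F : ℚ) ^ finrank F X := by
  have := Module.natCard_eq_pow_finrank (K := F) (V := X)
  unfold count
  rw [← Nat.card_eq_fintype_card]
  exact_mod_cast this

theorem count_univ : count (fun _ : W => True) = (Fintype.card F : ℚ) ^ finrank F W := by
  rw [← finrank_top F W, ← count_mem]
  exact count_congr fun y => by simp

/-- All fibres of a nonzero functional have the same number of elements. -/
theorem count_fibre (f : W →ₗ[F] F) (hf : f ≠ 0) (c : F) :
    count (fun w => f w = c) * (Fintype.card F : ℚ) = (Fintype.card F : ℚ) ^ finrank F W := by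
  have hs : Function.Surjective f := LinearMap.surjective hf
  have key : ∀ c, count (fun w => f w = c) = count (fun w => f w = 0) := by
    intro c
    obtain ⟨w0, rfl⟩ := hs c
    exact count_equiv (Equiv.subRight w0) fun y => by simp [sub_eq_zero]
  have h2 : count (fun x : W × F => f x.1 = x.2) = (Fintype.card F : ℚ) ^ finrank F W := by
    rw [← count_univ (F := F) (W := W)]
    have : ∀ w : W, count (fun c => f w = c) = 1 := by
      intro w
      simp [count]
    cases nonempty_fintype W
    rw [count_sigma (fun w c => f w = c)]
    classical
    simp only [this, count_eq_sum, if_true]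
  rw [← h2, count_sigma' (fun w c => f w = c), key c]
  simp only [key]
  simp [mul_comm]

variable (q : QuadraticForm F W)

/-- The orthogonal complement for the polar form. -/
def perp (X : Submodule F W) : Submodule F W :=
  LinearMap.BilinForm.orthogonal (q.polarBilin : LinearMap.BilinForm F W) X

variable {q}

theorem mem_perp {X : Submodule F W} {y : W} :
    y ∈ perp q X ↔ ∀ x ∈ X, QuadraticMap.polar q y x = 0 := by
  simp only [perp, LinearMap.BilinForm.mem_orthogonal_iff]
  refine forall₂_congr fun x _ => ?_
  rw [QuadraticMap.polar_comm]
  rfl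

theorem isRefl : LinearMap.IsRefl q.polarBilin := fun x y h => by
  rw [QuadraticMap.polarBilin_apply_apply] at *
  rwa [QuadraticMap.polar_comm]

theorem q_add (x y : W) : q (x + y) = q x + q y + QuadraticMap.polar q x y := by
  simp [QuadraticMap.polar]

variable (q) in
/-- The number of isotropic vectors of a subspace. -/
def isoVec (X : Submodule F W) : ℚ := count (fun y => y ∈ X ∧ q y = 0)

variable (q) in
/-- Totally isotropic (totally singular) subspaces. -/
def TotIso (E : Submodule F W) : Prop := ∀ x ∈ E, q x = 0

theorem TotIso.polar {E : Submodule F W} (hE : TotIso q E) {x y : W} (hx : x ∈ E) (hy : y ∈ E) :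
    QuadraticMap.polar q x y = 0 := by
  rw [QuadraticMap.polar, hE x hx, hE y hy, hE _ (E.add_mem hx hy)]; simp

theorem TotIso.le_perp {E : Submodule F W} (hE : TotIso q E) : E ≤ perp q E :=
  fun _ hx => mem_perp.2 fun _ hy => hE.polar hx hy

theorem TotIso.mono {E E' : Submodule F W} (hE : TotIso q E) (h : E' ≤ E) : TotIso q E' :=
  fun x hx => hE x (h hx)

theorem TotIso.sup_span {E : Submodule F W} (hE : TotIso q E) {y : W} (hy : y ∈ perp q E)
    (hq : q y = 0) : TotIso q (E ⊔ span F {y}) := by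
  intro x hx
  obtain ⟨e, he, z, hz, rfl⟩ := mem_sup.1 hx
  obtain ⟨c, rfl⟩ := mem_span_singleton.1 hz
  have := mem_perp.1 hy e he
  rw [QuadraticMap.polar_comm] at this
  rw [q_add, hE e he, QuadraticMap.map_smul, hq, QuadraticMap.polar_smul_right, this]
  simp

theorem perp_anti {X Y : Submodule F W} (h : X ≤ Y) : perp q Y ≤ perp q X :=
  LinearMap.BilinForm.orthogonal_le h

theorem le_perp_comm {X Y : Submodule F W} : X ≤ perp q Y ↔ Y ≤ perp q X := by
  constructor <;>
  · intro h y hy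
    rw [mem_perp]
    intro x hx
    rw [QuadraticMap.polar_comm]
    exact mem_perp.1 (h hx) y hy

theorem perp_sup (X Y : Submodule F W) : perp q (X ⊔ Y) = perp q X ⊓ perp q Y := by
  apply le_antisymm
  · exact le_inf (perp_anti le_sup_left) (perp_anti le_sup_right)
  · rw [le_perp_comm]
    exact sup_le (le_perp_comm.1 inf_le_left) (le_perp_comm.1 inf_le_right)

theorem finrank_perp (nd : LinearMap.Nondegenerate q.polarBilin) (X : Submodule F W) :
    (finrank F (perp q X) : ℤ) = finrank F W - finrank F X := by
  have := LinearMap.BilinForm.finrank_orthogonal nd X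
  have h2 := finrank_le X
  rw [perp, this]
  omega

theorem perp_perp (nd : LinearMap.Nondegenerate q.polarBilin) (X : Submodule F W) :
    perp q (perp q X) = X :=
  LinearMap.BilinForm.orthogonal_orthogonal nd isRefl X

theorem finrank_inf_perp (nd : LinearMap.Nondegenerate q.polarBilin) (X E : Submodule F W) :
    (finrank F (X ⊓ perp q E : Submodule F W) : ℤ) =
      finrank F X - finrank F E + finrank F (E ⊓ perp q X : Submodule F W) := by
  have h1 := finrank_perp nd (perp q X ⊔ E)
  rw [perp_sup, perp_perp nd] at h1
  have h2 := finrank_sup_add_finrank_inf_eq (perp q X) E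
  have h3 := finrank_perp nd X
  rw [inf_comm E]
  omega

/-- Translation by a totally isotropic `E`: exactly one in `|F|` of the vectors not orthogonal
to `E` is isotropic. -/
theorem count_iso_not_perp {X E : Submodule F W} (hE : TotIso q E) (hEX : E ≤ X) :
    count (fun y => (y ∈ X ∧ q y = 0) ∧ y ∉ perp q E) * (Fintype.card F : ℚ) =
      count (fun y => y ∈ X ∧ y ∉ perp q E) := by
  classical
  cases nonempty_fintype W
  have hcE : (0 : ℚ) < (Fintype.card F : ℚ) ^ finrank F E :=
    pow_pos (lt_trans one_pos one_lt_P) _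
  -- Pairs (y, e) with y + e isotropic are counted twice. For fixed e, translation by e preserves X
  -- and the complement of E^⊥. For fixed y, q(y + e) = q(y) + polar(y, e) is affine in e with
  -- nonzero linear part, so one e in |F| works.
  have h1 : count (fun x : W × E => (x.1 ∈ X ∧ x.1 ∉ perp q E) ∧ q (x.1 + x.2) = 0) =
      count (fun y => (y ∈ X ∧ q y = 0) ∧ y ∉ perp q E) * (Fintype.card F : ℚ) ^ finrank F E := by
    rw [count_sigma' (fun (y : W) (e : E) => (y ∈ X ∧ y ∉ perp q E) ∧ q (y + e) = 0)]
    have : ∀ e : E, count (fun y : W => (y ∈ X ∧ y ∉ perp q E) ∧ q (y + e) = 0) =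
        count (fun y => (y ∈ X ∧ q y = 0) ∧ y ∉ perp q E) := by
      intro e
      refine count_equiv (Equiv.addRight (e : W)) fun y => ?_
      simp only [Equiv.coe_addRight]
      rw [X.add_mem_iff_left (hEX e.2), (perp q E).add_mem_iff_left (hE.le_perp e.2)]
      tauto
    simp only [this, Finset.sum_const, Finset.card_univ, nsmul_eq_mul]
    rw [mul_comm, Module.card_eq_pow_finrank (K := F)]
    push_cast; rfl
  have h2 : count (fun x : W × E => (x.1 ∈ X ∧ x.1 ∉ perp q E) ∧ q (x.1 + x.2) = 0) *
      (Fintype.card F : ℚ) =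
      count (fun y => y ∈ X ∧ y ∉ perp q E) * (Fintype.card F : ℚ) ^ finrank F E := by
    rw [count_sigma (fun (y : W) (e : E) => (y ∈ X ∧ y ∉ perp q E) ∧ q (y + e) = 0),
      Finset.sum_mul, count_eq_sum, Finset.sum_mul]
    refine Finset.sum_congr rfl fun y _ => ?_
    by_cases hy : y ∈ X ∧ y ∉ perp q E
    · simp only [hy, true_and, if_true, one_mul, not_false_eq_true]
      have hne : (q.polarBilin y).domRestrict E ≠ 0 := by
        intro h0
        apply hy.2
        rw [mem_perp]
        intro x hx
        exact LinearMap.congr_fun h0 ⟨x, hx⟩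
      rw [← count_fibre _ hne (- q y)]
      congr 1
      refine count_congr fun e => ?_
      rw [q_add, hE e e.2, LinearMap.domRestrict_apply, QuadraticMap.polarBilin_apply_apply]
      constructor
      · intro h; linear_combination h
      · intro h; linear_combination h
    · simp [hy, count]
  rw [h1] at h2
  have := hcE.ne'
  apply mul_right_cancel₀ this
  linear_combination h2

theorem count_inf {X Y : Submodule F W} :
    count (fun y => y ∈ X ∧ y ∈ Y) = (Fintype.card F : ℚ) ^ finrank F (X ⊓ Y : Submodule F W) := by
  rw [← count_mem]; exact count_congr fun y => by simp

/-- Remove from X the vectors not orthogonal to E: exactly one in |F| of them is isotropic, and |X ∩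
E^⊥| is governed by E ∩ X^⊥. The last term is thus the only trace of the radical of X. -/
theorem isoVec_inf_perp (nd : LinearMap.Nondegenerate q.polarBilin) {X E : Submodule F W}
    (hE : TotIso q E) (hEX : E ≤ X) :
    isoVec q (X ⊓ perp q E) = isoVec q X - (Fintype.card F : ℚ) ^ ((finrank F X : ℤ) - 1) +
      (Fintype.card F : ℚ) ^ ((finrank F X : ℤ) - finrank F E - 1) *
        count (fun y => y ∈ E ∧ y ∈ perp q X) := by
  have h1 := count_iso_not_perp hE hEX
  have h2 := count_split (fun y => y ∈ X ∧ q y = 0) (· ∈ perp q E)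
  have h3 := count_split (· ∈ X) (· ∈ perp q E)
  have h4 : isoVec q (X ⊓ perp q E) = count (fun y => (y ∈ X ∧ q y = 0) ∧ y ∈ perp q E) :=
    count_congr fun y => by rw [mem_inf]; tauto
  rw [h4, isoVec, h2]
  rw [count_mem, count_inf, ← zpow_natCast, ← zpow_natCast, finrank_inf_perp nd X E] at h3
  rw [count_inf, ← zpow_natCast]
  have hP := P_ne_zero (F := F)
  rw [← zpow_add₀ hP, zpow_sub_one₀ hP]
  rw [show ((finrank F X : ℤ) - finrank F E - 1 + finrank F (E ⊓ perp q X : Submodule F W)) =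
    (finrank F X : ℤ) - finrank F E + finrank F (E ⊓ perp q X : Submodule F W) - 1 by ring,
    zpow_sub_one₀ hP]
  rw [h3, ← h1]
  field_simp
  ring

end

end IsotropicCount

/-! ### Totally isotropic subspaces, one dimension at a time -/

namespace IsotropicCount

open Module Submodule

noncomputable section

variable {F W : Type*} [Field F] [Fintype F] [AddCommGroup W] [Module F W] [Finite W]
variable {q : QuadraticForm F W}

/-- Every nonzero f in the annihilator of A takes the value 1 at |F|^d vectors, and f = 0 at none.
-/
theorem count_functional (A : Submodule F W) (d : ℕ) (hd : finrank F W = d + 1) :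
    count (fun x : Dual F W × W => A ≤ LinearMap.ker x.1 ∧ x.1 x.2 = 1) =
      (Fintype.card F : ℚ) ^ d * ((Fintype.card F : ℚ) ^ ((d : ℤ) + 1 - finrank F A) - 1) := by
  classical
  have : Finite (Dual F W) := Module.finite_of_finite F
  cases nonempty_fintype (Dual F W)
  cases nonempty_fintype W
  rw [count_sigma (fun (f : Dual F W) (y : W) => A ≤ LinearMap.ker f ∧ f y = 1)]
  have h1 : ∀ f : Dual F W, count (fun y => A ≤ LinearMap.ker f ∧ f y = 1) =
      (Fintype.card F : ℚ) ^ d *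
        ((if f ∈ A.dualAnnihilator then 1 else 0) - (if f = 0 then 1 else 0)) := by
    intro f
    have hA : A ≤ LinearMap.ker f ↔ f ∈ A.dualAnnihilator := by
      rw [Submodule.mem_dualAnnihilator]; rfl
    by_cases hf : f = 0
    · subst hf
      simp [count]
    · by_cases hA' : f ∈ A.dualAnnihilator
      · have := count_fibre f hf 1
        simp only [hA, hA', true_and, if_true, hf, if_false, sub_zero, mul_one]
        rw [hd, pow_succ] at this
        exact mul_right_cancel₀ P_ne_zero this
      · simp [hA, hA', hf, count]
  simp only [h1]
  rw [← Finset.mul_sum, Finset.sum_sub_distrib]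
  congr 2
  · rw [← count_eq_sum (fun f => f ∈ A.dualAnnihilator), count_mem, ← zpow_natCast]
    have := Subspace.finrank_add_finrank_dualAnnihilator_eq A
    congr 1
    omega
  · simp

/-- A hyperplane E together with y ∉ E is the same as a functional with kernel E, normalised by the
value 1 at y. -/
theorem count_hyperplane (A : Submodule F W) (d : ℕ) (hd : finrank F W = d + 1) :
    count (fun x : Submodule F W × W => A ≤ x.1 ∧ finrank F x.1 = d ∧ x.2 ∉ x.1) =
      (Fintype.card F : ℚ) ^ d * ((Fintype.card F : ℚ) ^ ((d : ℤ) + 1 - finrank F A) - 1) := by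
  rw [← count_functional A d hd, count, count]
  congr 1
  symm
  have hker : ∀ f : Dual F W, ∀ y, f y = 1 → finrank F (LinearMap.ker f) = d := by
    intro f y hy
    have hf : f ≠ 0 := by rintro rfl; simp at hy
    have := LinearMap.finrank_range_add_finrank_ker f
    rw [LinearMap.range_eq_top.2 (LinearMap.surjective hf), finrank_top, finrank_self] at this
    omega
  let Φ : {x : Dual F W × W // A ≤ LinearMap.ker x.1 ∧ x.1 x.2 = 1} →
      {x : Submodule F W × W // A ≤ x.1 ∧ finrank F x.1 = d ∧ x.2 ∉ x.1} := fun x =>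
    ⟨(LinearMap.ker x.1.1, x.1.2), x.2.1, hker _ _ x.2.2, by simp [x.2.2]⟩
  refine Nat.card_congr (Equiv.ofBijective Φ ⟨?_, ?_⟩)
  · rintro ⟨⟨f, y⟩, hf, hfy⟩ ⟨⟨g, z⟩, hg, hgz⟩ h
    simp only [Φ, Subtype.mk.injEq, Prod.mk.injEq] at h ⊢
    obtain ⟨h1, rfl⟩ := h
    refine ⟨LinearMap.ext fun x => ?_, rfl⟩
    simp only at hfy hgz
    have : x - f x • y ∈ LinearMap.ker f := by simp [hfy]
    rw [h1, LinearMap.mem_ker, map_sub, map_smul, hgz] at this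
    rw [smul_eq_mul, mul_one] at this
    exact (sub_eq_zero.1 this).symm
  · rintro ⟨⟨E, y⟩, hA, hE, hy⟩
    obtain ⟨f, hf, hfE⟩ := Submodule.exists_le_ker_of_notMem (p := E) hy
    have hg : ((f y)⁻¹ • f) y = 1 := by simp [hf]
    have hle : E ≤ LinearMap.ker ((f y)⁻¹ • f) := by
      intro x hx
      have := hfE hx
      simp only [LinearMap.mem_ker] at this
      simp [this]
    refine ⟨⟨((f y)⁻¹ • f, y), hA.trans hle, hg⟩, ?_⟩
    simp only [Φ, Subtype.mk.injEq, Prod.mk.injEq, and_true]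
    exact (Submodule.eq_of_le_of_finrank_eq hle (by rw [hE, hker _ _ hg])).symm

theorem count_hyperplane_of (A E' : Submodule F W) (hA : A ≤ E') (d : ℕ)
    (hd : finrank F E' = d + 1) :
    count (fun x : Submodule F W × W =>
      (A ≤ x.1 ∧ x.1 ≤ E' ∧ finrank F x.1 = d) ∧ x.2 ∈ E' ∧ x.2 ∉ x.1) =
      (Fintype.card F : ℚ) ^ d * ((Fintype.card F : ℚ) ^ ((d : ℤ) + 1 - finrank F A) - 1) := by
  have h := count_hyperplane (A.comap E'.subtype) d hd
  have hf : ∀ E : Submodule F W, E ≤ E' → finrank F (E.comap E'.subtype) = finrank F E :=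
    fun E hE => (Submodule.comapSubtypeEquivOfLe hE).finrank_eq
  rw [hf A hA] at h
  rw [← h, count, count]
  congr 1
  refine Nat.card_congr ⟨fun x => ⟨(x.1.1.comap E'.subtype, ⟨x.1.2, x.2.2.1⟩), ?_, ?_, ?_⟩,
    fun x => ⟨(x.1.1.map E'.subtype, x.1.2), ⟨?_, ?_, ?_⟩, x.1.2.2, ?_⟩, ?_, ?_⟩
  · exact Submodule.comap_mono x.2.1.1
  · rw [hf _ x.2.1.2.1, x.2.1.2.2]
  · simpa using x.2.2.2
  · intro a ha
    exact ⟨⟨a, hA ha⟩, x.2.1 (by simpa using ha), rfl⟩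
  · exact Submodule.map_subtype_le _ _
  · refine Eq.trans ?_ x.2.2.1
    exact Submodule.finrank_map_subtype_eq E' x.1.1
  · simpa using x.2.2.2
  · rintro ⟨⟨E, y⟩, ⟨h1, h2, h3⟩, h4, h5⟩
    simp only [Subtype.mk.injEq, Prod.mk.injEq, and_true]
    rw [Submodule.map_comap_subtype, inf_eq_right.2 h2]
  · rintro ⟨⟨E, y⟩, h1, h2, h3⟩
    simp only [Subtype.mk.injEq, Prod.mk.injEq, and_true]
    exact Submodule.comap_map_eq_of_injective E'.injective_subtype E

variable (q) in
/-- `E` is a `d`-dimensional totally isotropic subspace between `A` and `X`. -/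
def IsoBetween (A X : Submodule F W) (d : ℕ) (E : Submodule F W) : Prop :=
  A ≤ E ∧ E ≤ X ∧ finrank F E = d ∧ TotIso q E

variable (q) in
/-- The number of `d`-dimensional totally isotropic subspaces between `A` and `X`. -/
def isoSub (A X : Submodule F W) (d : ℕ) : ℚ := count (IsoBetween q A X d)

theorem finrank_sup_span {E : Submodule F W} {y : W} (hy : y ∉ E) :
    finrank F (E ⊔ span F {y} : Submodule F W) = finrank F E + 1 := by
  have h := finrank_sup_add_finrank_inf_eq E (span F {y})
  have h0 : y ≠ 0 := by rintro rfl; exact hy E.zero_mem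
  have h1 : E ⊓ span F {y} = ⊥ := by
    rw [eq_bot_iff]
    rintro x ⟨hx, hx'⟩
    obtain ⟨c, rfl⟩ := mem_span_singleton.1 hx'
    by_cases hc : c = 0
    · simp [hc]
    · exact absurd ((E.smul_mem_iff hc).1 hx) hy
  rw [h1, finrank_bot, finrank_span_singleton h0] at h
  omega

/-- Insert E' = E + F y, which is again totally isotropic and is determined by (E, y). In the other
direction, a given E' arises from its hyperplanes E ⊇ A and the vectors of E' outside E. -/
theorem count_extensions (A X : Submodule F W) (d : ℕ) :
    count (fun x : Submodule F W × W => IsoBetween q A X d x.1 ∧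
      ((x.2 ∈ X ∧ q x.2 = 0) ∧ x.2 ∈ perp q x.1) ∧ x.2 ∉ x.1) =
    isoSub q A X (d + 1) * ((Fintype.card F : ℚ) ^ d *
      ((Fintype.card F : ℚ) ^ ((d : ℤ) + 1 - finrank F A) - 1)) := by
  classical
  cases nonempty_fintype W
  cases nonempty_fintype (Submodule F W)
  let R : Submodule F W → Submodule F W × W → Prop := fun E' x =>
    IsoBetween q A X (d + 1) E' ∧ (A ≤ x.1 ∧ x.1 ≤ E' ∧ finrank F x.1 = d) ∧ x.2 ∈ E' ∧ x.2 ∉ x.1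
  have h1 : count (fun z : Submodule F W × (Submodule F W × W) => R z.1 z.2) =
      isoSub q A X (d + 1) * ((Fintype.card F : ℚ) ^ d *
      ((Fintype.card F : ℚ) ^ ((d : ℤ) + 1 - finrank F A) - 1)) := by
    rw [count_sigma R, isoSub, count_eq_sum, Finset.sum_mul]
    refine Finset.sum_congr rfl fun E' _ => ?_
    by_cases hE' : IsoBetween q A X (d + 1) E'
    · simp only [R, hE', true_and, if_true, one_mul]
      exact count_hyperplane_of A E' hE'.1 d hE'.2.2.1
    · simp [R, hE', count]
  rw [← h1, count_sigma' R, count_eq_sum]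
  refine Finset.sum_congr rfl fun x _ => ?_
  obtain ⟨E, y⟩ := x
  split_ifs with h
  · obtain ⟨⟨hA, hX, hd, hE⟩, ⟨⟨hyX, hy0⟩, hyp⟩, hyE⟩ := h
    have : ∀ E' : Submodule F W, R E' (E, y) ↔ E' = E ⊔ span F {y} := by
      intro E'
      have hf := finrank_sup_span hyE
      constructor
      · rintro ⟨h1, h2, h3, h4⟩
        symm
        refine Submodule.eq_of_le_of_finrank_eq (sup_le h2.2.1 ?_) ?_
        · simpa using h3
        · rw [hf, hd, h1.2.2.1]
      · rintro rfl
        refine ⟨⟨hA.trans le_sup_left, sup_le hX (by simpa using hyX), by rw [hf, hd],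
          hE.sup_span hyp hy0⟩, ⟨hA, le_sup_left, hd⟩, ?_, hyE⟩
        exact mem_sup_right (mem_span_singleton_self y)
    rw [count_congr this]
    simp [count]
  · have : ∀ E' : Submodule F W, R E' (E, y) ↔ False := by
      intro E'
      refine iff_false_intro ?_
      rintro ⟨⟨h1, h2, h3, h4⟩, ⟨h5, h6, h7⟩, h8, h9⟩
      simp only at h5 h6 h7 h8 h9
      refine h ⟨⟨h5, h6.trans h2, h7, h4.mono h6⟩, ⟨⟨h2 h8, h4 y h8⟩, ?_⟩, h9⟩
      exact mem_perp.2 fun x hx => h4.polar h8 (h6 hx)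
    rw [count_congr this]
    simp [count]

variable (q) in
open Classical in
/-- The sum of the numbers of `d`-dimensional totally isotropic subspaces of `X` containing
`A + F x`, over the isotropic `x` outside `A` in the radical of `X`. -/
def isoSubExt [Fintype W] (A X : Submodule F W) (d : ℕ) : ℚ :=
  ∑ x : W, if (x ∈ X ∧ x ∈ perp q X ∧ q x = 0) ∧ x ∉ A then isoSub q (A ⊔ span F {x}) X d else 0

/-- The pairs (E, y) of `count_extensions` are also counted by E, through `isoVec_inf_perp`, which
leaves the sum over E of |E ∩ X^⊥|. Exchanging that summation, a vector x of A contributes every E,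
and an x outside A contributes the E containing A + F x; this is `isoSubExt`. -/
theorem isoSub_recurrence (nd : LinearMap.Nondegenerate q.polarBilin) {A X : Submodule F W}
    (hAX' : A ≤ perp q X) (d : ℕ) [Fintype W] :
    (Fintype.card F : ℚ) ^ d * ((Fintype.card F : ℚ) ^ ((d : ℤ) + 1 - finrank F A) - 1) *
      isoSub q A X (d + 1) =
    isoSub q A X d * (isoVec q X - (Fintype.card F : ℚ) ^ ((finrank F X : ℤ) - 1) -
      (Fintype.card F : ℚ) ^ d + (Fintype.card F : ℚ) ^ ((finrank F X : ℤ) - d - 1) *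
        (Fintype.card F : ℚ) ^ (finrank F A)) +
    (Fintype.card F : ℚ) ^ ((finrank F X : ℤ) - d - 1) *
      isoSubExt q A X d := by
  classical
  cases nonempty_fintype (Submodule F W)
  have h1 := count_extensions (q := q) A X d
  rw [count_sigma (fun (E : Submodule F W) (y : W) => IsoBetween q A X d E ∧
      ((y ∈ X ∧ q y = 0) ∧ y ∈ perp q E) ∧ y ∉ E)] at h1
  have h2 : ∀ E : Submodule F W, count (fun y : W => IsoBetween q A X d E ∧
      ((y ∈ X ∧ q y = 0) ∧ y ∈ perp q E) ∧ y ∉ E) =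
      (if IsoBetween q A X d E then (1 : ℚ) else 0) *
      (isoVec q X - (Fintype.card F : ℚ) ^ ((finrank F X : ℤ) - 1) - (Fintype.card F : ℚ) ^ d) +
      (Fintype.card F : ℚ) ^ ((finrank F X : ℤ) - d - 1) *
      ∑ x : W, if IsoBetween q A X d E ∧ x ∈ E ∧ x ∈ perp q X then (1 : ℚ) else 0 := by
    intro E
    by_cases hE : IsoBetween q A X d E
    · have h3 := isoVec_inf_perp nd hE.2.2.2 hE.2.1
      have h4 : isoVec q (X ⊓ perp q E) = _ := count_split _ (· ∈ E)
      have h5 : count (fun y => (y ∈ X ⊓ perp q E ∧ q y = 0) ∧ y ∈ E) =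
          (Fintype.card F : ℚ) ^ d := by
        rw [← hE.2.2.1, ← count_mem]
        refine count_congr fun y => ⟨fun h => h.2, fun h => ⟨⟨⟨hE.2.1 h, ?_⟩, ?_⟩, h⟩⟩
        · exact hE.2.2.2.le_perp h
        · exact hE.2.2.2 y h
      have h6 : count (fun y : W => IsoBetween q A X d E ∧
          ((y ∈ X ∧ q y = 0) ∧ y ∈ perp q E) ∧ y ∉ E) =
          count (fun y => (y ∈ X ⊓ perp q E ∧ q y = 0) ∧ y ∉ E) :=
        count_congr fun y => by rw [mem_inf]; tauto
      rw [h6]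
      rw [h5] at h4
      simp only [hE, true_and, if_true, one_mul]
      rw [← count_eq_sum (fun x => x ∈ E ∧ x ∈ perp q X)]
      rw [hE.2.2.1] at h3
      linear_combination h3 - h4
    · simp [hE, count]
  simp only [h2] at h1
  rw [Finset.sum_add_distrib, ← Finset.sum_mul, ← count_eq_sum (IsoBetween q A X d),
    ← Finset.mul_sum, Finset.sum_comm] at h1
  have h7 : ∑ x : W, ∑ E : Submodule F W,
      (if IsoBetween q A X d E ∧ x ∈ E ∧ x ∈ perp q X then (1 : ℚ) else 0) =
      (Fintype.card F : ℚ) ^ (finrank F A) * isoSub q A X d +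
      isoSubExt q A X d := by
    unfold isoSubExt
    rw [← count_mem, count_eq_sum, Finset.sum_mul, ← Finset.sum_add_distrib]
    refine Finset.sum_congr rfl fun x _ => ?_
    rw [← count_eq_sum (fun E => IsoBetween q A X d E ∧ x ∈ E ∧ x ∈ perp q X)]
    by_cases hx : x ∈ A
    · simp only [hx, not_true_eq_false, and_false, if_false, add_zero, if_true, one_mul]
      exact count_congr fun E => ⟨fun h => h.1, fun h => ⟨h, h.1 hx, hAX' hx⟩⟩
    · by_cases hx' : x ∈ X ∧ x ∈ perp q X ∧ q x = 0
      · simp only [hx, hx', not_false_eq_true, and_self, if_true, if_false, zero_mul, zero_add,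
          and_true]
        refine count_congr fun E => ?_
        simp only [IsoBetween, sup_le_iff, span_singleton_le_iff_mem]
        tauto
      · rw [count_congr (t := fun _ => False)]
        · simp [hx, hx', count]
        · intro E
          refine iff_false_intro ?_
          rintro ⟨h1, h2, h3⟩
          exact hx' ⟨h1.2.1 h2, h3, h1.2.2.2 x h2⟩
  rw [h7] at h1
  rw [← isoSub] at h1
  linear_combination -h1

theorem isoSub_self {A X : Submodule F W} (hAX : A ≤ X) (hA : TotIso q A) :
    isoSub q A X (finrank F A) = 1 := by
  have : ∀ E, IsoBetween q A X (finrank F A) E ↔ E = A := by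
    intro E
    constructor
    · rintro ⟨h1, h2, h3, h4⟩
      exact (Submodule.eq_of_le_of_finrank_eq h1 h3.symm).symm
    · rintro rfl
      exact ⟨le_rfl, hAX, rfl, hA⟩
  rw [isoSub, count_congr this]
  simp [count]

theorem isoSub_eq_zero_of_lt {A X : Submodule F W} {d : ℕ} (hd : d < finrank F A) :
    isoSub q A X d = 0 := by
  have : ∀ E, IsoBetween q A X d E ↔ False := by
    intro E
    refine iff_false_intro ?_
    rintro ⟨h1, h2, h3, h4⟩
    have := Submodule.finrank_mono h1
    omega
  rw [isoSub, count_congr this]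
  simp [count]

end

end IsotropicCount

/-! ### Isotropic vectors, Chevalley–Warning and the sign of a quadratic space -/

namespace IsotropicCount

open Module Submodule

noncomputable section

variable {F W : Type*} [Field F] [Fintype F] [AddCommGroup W] [Module F W] [Finite W]
variable {q : QuadraticForm F W}

/-- A quadratic form in at least three variables over a finite field has a nontrivial zero. -/
theorem exists_isotropic (C : Submodule F W) (hC : 3 ≤ finrank F C) :
    ∃ y ∈ C, y ≠ 0 ∧ q y = 0 := by
  classical
  obtain ⟨p, hp⟩ := CharP.exists F
  have hprime : p.Prime := (CharP.char_is_prime_or_zero F p).resolve_right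
    (CharP.char_ne_zero_of_finite F p)
  -- A bilinear form that need not be symmetric represents q in characteristic 2 as well. By
  -- Chevalley–Warning the characteristic divides the number of zeros of the resulting polynomial of
  -- degree at most two, so 0 cannot be the only zero.
  obtain ⟨B, hB⟩ := LinearMap.BilinMap.toQuadraticMap_surjective q
  let b := Module.finBasis F C
  let f : MvPolynomial (Fin (finrank F C)) F :=
    ∑ i, ∑ j, MvPolynomial.C (B (b i) (b j)) * (MvPolynomial.X i * MvPolynomial.X j)
  have hev : ∀ x, MvPolynomial.eval x f = q (∑ i, x i • (b i : W)) := by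
    intro x
    rw [← hB]
    simp only [f, map_sum, map_mul, MvPolynomial.eval_C, MvPolynomial.eval_X,
      LinearMap.BilinMap.toQuadraticMap_apply, LinearMap.sum_apply, map_smul, LinearMap.smul_apply,
      smul_eq_mul]
    rw [Finset.sum_comm]
    refine Finset.sum_congr rfl fun i _ => ?_
    rw [Finset.mul_sum]
    refine Finset.sum_congr rfl fun j _ => ?_
    ring
  have hdeg : f.totalDegree < Fintype.card (Fin (finrank F C)) := by
    rw [Fintype.card_fin]
    refine lt_of_le_of_lt ?_ (show 2 < finrank F C by omega)
    refine MvPolynomial.totalDegree_finsetSum_le fun i _ =>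
      MvPolynomial.totalDegree_finsetSum_le fun j _ => ?_
    refine (MvPolynomial.totalDegree_mul _ _).trans ?_
    rw [MvPolynomial.totalDegree_C, zero_add]
    refine (MvPolynomial.totalDegree_mul _ _).trans ?_
    simp
  have hdvd := char_dvd_card_solutions p hdeg
  by_contra hcon
  push Not at hcon
  have h1 : Fintype.card {x // MvPolynomial.eval x f = 0} = 1 := by
    rw [Fintype.card_eq_one_iff]
    refine ⟨⟨0, by rw [hev]; simp⟩, ?_⟩
    rintro ⟨x, hx⟩
    rw [hev] at hx
    have hmem : ∑ i, x i • (b i : W) ∈ C := C.sum_mem fun i _ => C.smul_mem _ (b i).2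
    have h0 : ∑ i, x i • (b i : W) = 0 := by
      by_contra h0
      exact hcon _ hmem h0 hx
    have h2 : ∑ i, x i • b i = 0 := by
      apply Subtype.ext
      simpa using h0
    ext i
    exact Fintype.linearIndependent_iff.1 b.linearIndependent x h2 i
  rw [h1] at hdvd
  exact hprime.one_lt.ne' (Nat.dvd_one.1 hdvd)

/-- A maximal totally isotropic subspace of `X`. -/
theorem exists_maximal {X A₀ : Submodule F W} (h₀ : A₀ ≤ X) (hi₀ : TotIso q A₀) :
    ∃ A, A₀ ≤ A ∧ A ≤ X ∧ TotIso q A ∧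
      isoVec q (X ⊓ perp q A) = (Fintype.card F : ℚ) ^ finrank F A ∧
      finrank F (X ⊓ perp q A : Submodule F W) ≤ finrank F A + 2 := by
  obtain ⟨A, hA₀, hA⟩ := (Set.toFinite {A : Submodule F W | A ≤ X ∧ TotIso q A}).exists_le_maximal
    (show A₀ ∈ _ from ⟨h₀, hi₀⟩)
  have hAi : TotIso q A := hA.prop.2
  have hAX : A ≤ X := hA.prop.1
  have key : ∀ y ∈ X ⊓ perp q A, q y = 0 → y ∈ A := by
    intro y hy hq
    have h1 : A ⊔ span F {y} ∈ {A : Submodule F W | A ≤ X ∧ TotIso q A} :=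
      ⟨sup_le hAX (by simpa using hy.1), hAi.sup_span hy.2 hq⟩
    have h2 := hA.le_of_ge h1 le_sup_left
    exact h2 (mem_sup_right (mem_span_singleton_self y))
  have hAZ : A ≤ X ⊓ perp q A := le_inf hAX hAi.le_perp
  refine ⟨A, hA₀, hAX, hAi, ?_, ?_⟩
  · rw [← count_mem]
    exact count_congr fun y => ⟨fun h => key y h.1 h.2, fun h => ⟨hAZ h, hAi y h⟩⟩
  -- By maximality a complement of A in X ∩ A^⊥ contains no nonzero isotropic vector, so its
  -- dimension is at most two.
  · obtain ⟨C', hC'⟩ := Submodule.exists_isCompl A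
    by_contra hcon
    have h1 : A ⊔ C' ⊓ (X ⊓ perp q A) = X ⊓ perp q A := by
      rw [← sup_inf_assoc_of_le C' hAZ, hC'.sup_eq_top, top_inf_eq]
    have h2 : A ⊓ (C' ⊓ (X ⊓ perp q A)) = ⊥ := by
      rw [← inf_assoc, hC'.inf_eq_bot, bot_inf_eq]
    have h3 := finrank_sup_add_finrank_inf_eq A (C' ⊓ (X ⊓ perp q A))
    rw [h1, h2, finrank_bot] at h3
    obtain ⟨y, hy, hy0, hyq⟩ := exists_isotropic (q := q) (C' ⊓ (X ⊓ perp q A)) (by omega)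
    have h4 := key y hy.2 hyq
    exact hy0 ((mem_bot F).1 (h2 ▸ ⟨h4, hy⟩))

variable (q) in
open Classical in
/-- `1` if there is a totally isotropic subspace of dimension `m`, and `-1` otherwise. -/
def wittSign (m : ℕ) : ℚ := if ∃ A, TotIso q A ∧ finrank F A = m then 1 else -1

theorem perp_top (nd : LinearMap.Nondegenerate q.polarBilin) : perp q ⊤ = ⊥ := by
  rw [← finrank_eq_zero (R := F)]
  have := finrank_perp nd ⊤
  rw [finrank_top] at this
  omega

theorem perp_bot : perp q ⊥ = ⊤ := by
  rw [eq_top_iff]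
  intro y _
  rw [mem_perp]
  intro x hx
  rw [(mem_bot F).1 hx, QuadraticMap.polar_zero_right]

/-- For a maximal totally isotropic A, dim A^⊥ = 2m − dim A is at most dim A + 2, so dim A is m or m
− 1. All isotropic vectors of A^⊥ lie in A, and `isoVec_inf_perp` then determines the total.
Starting from a subspace of dimension m, if there is one, ties the two cases to the sign. -/
theorem isoVec_top (nd : LinearMap.Nondegenerate q.polarBilin) {m : ℕ} (hm : finrank F W = 2 * m) :
    isoVec q ⊤ = (Fintype.card F : ℚ) ^ (2 * (m : ℤ) - 1) +
      wittSign q m * ((Fintype.card F : ℚ) ^ (m : ℤ) - (Fintype.card F : ℚ) ^ ((m : ℤ) - 1)) := by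
  have main : ∀ A₀, TotIso q A₀ → ∃ A, A₀ ≤ A ∧ TotIso q A ∧
      isoVec q ⊤ = (Fintype.card F : ℚ) ^ (2 * (m : ℤ) - 1) + (Fintype.card F : ℚ) ^ finrank F A
        - (Fintype.card F : ℚ) ^ (2 * (m : ℤ) - finrank F A - 1) ∧
      (finrank F A = m ∨ finrank F A + 1 = m) := by
    intro A₀ h₀
    obtain ⟨A, h1, h2, h3, h4, h5⟩ := exists_maximal le_top h₀
    refine ⟨A, h1, h3, ?_, ?_⟩
    · have h6 := isoVec_inf_perp nd h3 h2
      have h7 : count (fun y => y ∈ A ∧ y ∈ perp q ⊤) = 1 := by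
        rw [count_inf (F := F), perp_top nd, inf_bot_eq, finrank_bot, pow_zero]
      rw [h4, h7, finrank_top, hm] at h6
      push_cast at h6
      linear_combination -h6
    · have h6 := finrank_perp nd A
      have h7 := finrank_mono h3.le_perp
      rw [top_inf_eq] at h5
      omega
  unfold wittSign
  split_ifs with h
  · obtain ⟨A₀, h1, h2⟩ := h
    obtain ⟨A, h3, h4, h5, h6⟩ := main A₀ h1
    have := finrank_mono h3
    have h7 : finrank F A = m := by omega
    rw [h5, h7, zpow_natCast, show 2 * (m : ℤ) - m - 1 = m - 1 by ring]
    ring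
  · obtain ⟨A, h3, h4, h5, h6⟩ := main ⊥ (fun x hx => by rw [(mem_bot F).1 hx]; simp)
    have h7 : finrank F A + 1 = m := h6.resolve_left fun hh => h ⟨A, h4, hh⟩
    have h8 : (m : ℤ) - 1 = finrank F A := by omega
    rw [h5, h8, show 2 * (m : ℤ) - finrank F A - 1 = m by omega, zpow_natCast, zpow_natCast]
    ring

/-- A maximal totally isotropic A in u^⊥ does not meet F u, so u^⊥ ∩ A^⊥ has dimension 2m − 1 − dim
A. This lies between dim A and dim A + 2, and parity forces dim A = m − 1 whatever the sign of the
space. -/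
theorem isoVec_perp_anisotropic (nd : LinearMap.Nondegenerate q.polarBilin) {m : ℕ}
    (hm : finrank F W = 2 * m) {u : W} (hu : q u ≠ 0) :
    isoVec q (perp q (span F {u})) = (Fintype.card F : ℚ) ^ (2 * (m : ℤ) - 2) := by
  obtain ⟨A, h1, h2, h3, h4, h5⟩ := exists_maximal (q := q) (X := perp q (span F {u})) bot_le
    (fun x hx => by rw [(mem_bot F).1 hx]; simp)
  have hu0 : u ≠ 0 := by rintro rfl; simp at hu
  have h6 := isoVec_inf_perp nd h3 h2
  have hAu : A ⊓ span F {u} = ⊥ := by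
    rw [eq_bot_iff]
    rintro x ⟨hx, hx'⟩
    obtain ⟨c, rfl⟩ := mem_span_singleton.1 hx'
    have := h3 _ hx
    rw [QuadraticMap.map_smul, smul_eq_mul] at this
    have : c = 0 := by simpa [hu] using this
    simp [this]
  have h7 : count (fun y => y ∈ A ∧ y ∈ perp q (perp q (span F {u}))) = 1 := by
    rw [count_inf, perp_perp nd, hAu]; simp
  have h8 := finrank_perp nd (span F {u})
  rw [finrank_span_singleton hu0, hm] at h8
  have h9 := finrank_inf_perp nd (perp q (span F {u})) A
  rw [perp_perp nd, hAu, finrank_bot] at h9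
  have h10 := finrank_mono (le_inf h2 h3.le_perp)
  have ha : (finrank F A : ℤ) = m - 1 := by omega
  rw [h4, h7, h8, ha, ← zpow_natCast, ha] at h6
  push_cast at h6
  rw [show 2 * (m : ℤ) - 1 - (m - 1) - 1 = m - 1 by ring,
    show 2 * (m : ℤ) - 1 - 1 = 2 * m - 2 by ring] at h6
  linear_combination -h6

theorem isoVec_perp_isotropic (nd : LinearMap.Nondegenerate q.polarBilin) {m : ℕ}
    (hm : finrank F W = 2 * m) {u : W} (hu : q u = 0) (hu0 : u ≠ 0) :
    isoVec q (perp q (span F {u})) = (Fintype.card F : ℚ) ^ (2 * (m : ℤ) - 2) +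
      wittSign q m * ((Fintype.card F : ℚ) ^ (m : ℤ) - (Fintype.card F : ℚ) ^ ((m : ℤ) - 1)) := by
  have hE : TotIso q (span F {u}) := by
    intro x hx
    obtain ⟨c, rfl⟩ := mem_span_singleton.1 hx
    simp [QuadraticMap.map_smul, hu]
  have h6 := isoVec_inf_perp nd hE le_top
  have h7 : count (fun y => y ∈ span F {u} ∧ y ∈ perp q ⊤) = 1 := by
    rw [count_inf (F := F), perp_top nd, inf_bot_eq, finrank_bot, pow_zero]
  rw [h7, top_inf_eq, isoVec_top nd hm, finrank_top, finrank_span_singleton hu0, hm] at h6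
  push_cast at h6
  rw [h6, show 2 * (m : ℤ) - 1 - 1 = 2 * m - 2 by ring]
  ring

theorem mem_perp_span_singleton {u y : W} :
    y ∈ perp q (span F {u}) ↔ QuadraticMap.polar q y u = 0 := by
  rw [mem_perp]
  constructor
  · exact fun h => h u (mem_span_singleton_self u)
  · rintro h x hx
    obtain ⟨c, rfl⟩ := mem_span_singleton.1 hx
    rw [QuadraticMap.polar_smul_right, h, smul_zero]

/-- Sum |F|·[x ⊥ u] − 1 over isotropic x and over u ∈ U. For fixed x the sum over u vanishes unless
x ∈ U^⊥. For fixed u the sum over x depends only on whether u is zero, nonzero isotropic or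
anisotropic, and those three values are known. -/
theorem isoVec_perp (nd : LinearMap.Nondegenerate q.polarBilin) {m : ℕ}
    (hm : finrank F W = 2 * m) (U : Submodule F W) :
    isoVec q (perp q U) = (Fintype.card F : ℚ) ^ (2 * (m : ℤ) - finrank F U - 1) -
      wittSign q m * (Fintype.card F : ℚ) ^ ((m : ℤ) - 1) +
      wittSign q m * (Fintype.card F : ℚ) ^ ((m : ℤ) - finrank F U) * isoVec q U := by
  classical
  cases nonempty_fintype W
  have hP := P_ne_zero (F := F)
  set P : ℚ := (Fintype.card F : ℚ) with hPdef
  set ε := wittSign q m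
  -- sum over `x` isotropic and `u ∈ U` of `P [x ⊥ u] - 1`
  have h1 : ∀ x : W, ∑ u : U, (P * (if QuadraticMap.polar q x u = 0 then (1 : ℚ) else 0) - 1) =
      (if x ∈ perp q U then 1 else 0) * ((P - 1) * P ^ finrank F U) := by
    intro x
    have hc : ∑ u : U, (1 : ℚ) = P ^ finrank F U := by
      rw [← count_univ, count_eq_sum]; simp
    rw [Finset.sum_sub_distrib, ← Finset.mul_sum, hc,
      ← count_eq_sum (fun u : U => QuadraticMap.polar q x u = 0)]
    split_ifs with hx
    · have : count (fun u : U => QuadraticMap.polar q x u = 0) = P ^ finrank F U := by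
        rw [← count_univ (F := F) (W := U)]
        exact count_congr fun u => by simp [mem_perp.1 hx u u.2]
      rw [this]; ring
    · have hne : (q.polarBilin x).domRestrict U ≠ 0 := by
        intro h0
        apply hx
        rw [mem_perp]
        intro y hy
        exact LinearMap.congr_fun h0 ⟨y, hy⟩
      have := count_fibre _ hne 0
      rw [mul_comm P, ← this]
      rw [zero_mul, sub_eq_zero]
      rfl
  have h2 : isoVec q (perp q U) * ((P - 1) * P ^ finrank F U) =
      ∑ u : U, (P * isoVec q (perp q (span F {(u : W)})) - isoVec q ⊤) := by
    have e1 : isoVec q (perp q U) = ∑ x : W, (if q x = 0 then (1 : ℚ) else 0) *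
        (if x ∈ perp q U then 1 else 0) := by
      rw [isoVec, count_eq_sum]
      refine Finset.sum_congr rfl fun x _ => ?_
      by_cases h : q x = 0 <;> by_cases h' : x ∈ perp q U <;> simp [h, h']
    rw [e1, Finset.sum_mul]
    simp only [mul_assoc, ← h1, Finset.mul_sum]
    rw [Finset.sum_comm]
    refine Finset.sum_congr rfl fun u _ => ?_
    have e2 : isoVec q (perp q (span F {(u : W)})) = ∑ x : W, (if q x = 0 then (1 : ℚ) else 0) *
        (if QuadraticMap.polar q x u = 0 then 1 else 0) := by
      rw [isoVec, count_eq_sum]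
      refine Finset.sum_congr rfl fun x _ => ?_
      simp only [mem_perp_span_singleton]
      by_cases h : q x = 0 <;> by_cases h' : QuadraticMap.polar q x u = 0 <;> simp [h, h']
    have e3 : isoVec q ⊤ = ∑ x : W, (if q x = 0 then (1 : ℚ) else 0) := by
      rw [isoVec, count_eq_sum]
      simp
    rw [e2, e3, Finset.mul_sum, ← Finset.sum_sub_distrib]
    refine Finset.sum_congr rfl fun x _ => ?_
    ring
  have h3 : ∀ u : U, P * isoVec q (perp q (span F {(u : W)})) - isoVec q ⊤ =
      (if u = 0 then (P - 1) * P ^ (2 * (m : ℤ) - 1) else 0) +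
      (if q u = 0 then 1 else 0) * (ε * P * (P ^ (m : ℤ) - P ^ ((m : ℤ) - 1))) -
      ε * (P ^ (m : ℤ) - P ^ ((m : ℤ) - 1)) := by
    intro u
    have ht := isoVec_top nd hm
    have e0 : P ^ (2 * (m : ℤ) - 1) = P * P ^ (2 * (m : ℤ) - 2) := by
      rw [← zpow_one_add₀ hP]; congr 1; ring
    by_cases hu : u = 0
    · subst hu
      simp only [ZeroMemClass.coe_zero, span_zero_singleton, perp_bot, if_true,
        QuadraticMap.map_zero]
      rw [ht]
      ring
    · have hu0 : (u : W) ≠ 0 := by simpa using hu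
      by_cases hq : q u = 0
      · rw [isoVec_perp_isotropic nd hm hq hu0, ht]
        simp only [hu, hq, if_true, if_false]
        rw [← hPdef, e0]
        ring
      · rw [isoVec_perp_anisotropic nd hm hq, ht]
        simp only [hu, hq, if_false]
        rw [← hPdef, e0]
        ring
  simp only [h3] at h2
  rw [Finset.sum_sub_distrib, Finset.sum_add_distrib, ← Finset.sum_mul] at h2
  have h4 : ∑ u : U, (if q u = 0 then (1 : ℚ) else 0) = isoVec q U := by
    rw [← count_eq_sum (fun u : U => q u = 0), isoVec]
    unfold count
    congr 1
    refine Nat.card_congr ⟨fun u => ⟨u.1, u.1.2, u.2⟩, fun u => ⟨⟨u.1, u.2.1⟩, u.2.2⟩, ?_, ?_⟩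
    · intro _; rfl
    · intro _; rfl
  have h5 : ∑ u : U, ε * (P ^ (m : ℤ) - P ^ ((m : ℤ) - 1)) =
      P ^ finrank F U * (ε * (P ^ (m : ℤ) - P ^ ((m : ℤ) - 1))) := by
    have hc : ∑ u : U, (1 : ℚ) = P ^ finrank F U := by
      rw [← count_univ, count_eq_sum]; simp
    rw [← hc, Finset.sum_mul]; simp
  rw [h4, h5] at h2
  simp only [Finset.sum_ite_eq', Finset.mem_univ, if_true] at h2
  have hP1 : P - 1 ≠ 0 := by have := one_lt_P (F := F); rw [← hPdef] at this; linarith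
  have hPr : P ^ finrank F U ≠ 0 := pow_ne_zero _ hP
  have e1 : P ^ (m : ℤ) = P * P ^ ((m : ℤ) - 1) := by
    rw [← zpow_one_add₀ hP]; congr 1; ring
  have e2 : P ^ (2 * (m : ℤ) - finrank F U - 1) * P ^ finrank F U = P ^ (2 * (m : ℤ) - 1) := by
    rw [← zpow_natCast, ← zpow_add₀ hP]; congr 1; ring
  have e3 : P ^ ((m : ℤ) - finrank F U) * P ^ finrank F U = P ^ (m : ℤ) := by
    rw [← zpow_natCast, ← zpow_add₀ hP]; congr 1; ring
  apply mul_right_cancel₀ (mul_ne_zero hP1 hPr)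
  rw [h2]
  rw [show ((P ^ (2 * (m : ℤ) - finrank F U - 1) - ε * P ^ ((m : ℤ) - 1) +
    ε * P ^ ((m : ℤ) - finrank F U) * isoVec q U) * ((P - 1) * P ^ finrank F U)) =
    (P - 1) * (P ^ (2 * (m : ℤ) - finrank F U - 1) * P ^ finrank F U) -
    (P - 1) * P ^ finrank F U * (ε * P ^ ((m : ℤ) - 1)) +
    (P - 1) * ε * (P ^ ((m : ℤ) - finrank F U) * P ^ finrank F U) * isoVec q U by ring, e2, e3, e1]
  ring

end

end IsotropicCount

/-! ### Duality between the totally isotropic subspaces of U and of U^⊥ -/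

namespace IsotropicCount

open Module Submodule

noncomputable section

/-- The coefficients of the duality between isotropic subspaces of `U` and of `U^⊥`. -/
def coef (P ε : ℚ) (M s : ℤ) (n i : ℕ) : ℚ :=
  if i ≤ n then
    ε ^ i * P ^ ((i : ℤ) * (s - n + i)) * ((∏ t ∈ Finset.range (n - i), (P ^ (M - i - 1 - t) + ε)) *
      ∏ t ∈ Finset.range (n - i), (P ^ (s - t) - ε) / (P ^ ((t : ℤ) + 1) - 1))
  else 0

section coef

variable {P ε : ℚ} (hP : 1 < P) (hε : ε = 1 ∨ ε = -1) (M s : ℤ)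

include hP in
theorem pow_sub_one_ne (n : ℕ) : P ^ (n + 1) - 1 ≠ 0 := by
  exact sub_ne_zero.2 (one_lt_pow₀ hP (Nat.succ_ne_zero n)).ne'

include hP hε in
-- Replacing A by A + F x lowers M = m − dim A by one while the dimensions sought stay the same.
-- This rewrites the coefficients of the induction hypothesis for A + F x in terms of those for A.
theorem coef_shift (n i : ℕ) (hi : i ≤ n) :
    coef P ε (M - 1) s n i = ε * P ^ (-(s - n + i)) * coef P ε M s (n + 1) (i + 1) := by
  have hP0 : P ≠ 0 := by linarith
  unfold coef
  rw [if_pos hi, if_pos (by omega)]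
  have e1 : n + 1 - (i + 1) = n - i := by omega
  have e2 : P ^ (((i + 1 : ℕ) : ℤ) * (s - (n + 1 : ℕ) + (i + 1 : ℕ))) =
      P ^ ((i : ℤ) * (s - n + i)) * P ^ (s - n + i) := by
    rw [← zpow_add₀ hP0]; congr 1; push_cast; ring
  have e3 : ∀ t : ℕ, M - ((i + 1 : ℕ) : ℤ) - 1 - t = M - 1 - i - 1 - t := by
    intro t; push_cast; ring
  rw [e1, e2, zpow_neg]
  simp only [e3]
  have : P ^ (s - n + i) ≠ 0 := zpow_ne_zero _ hP0
  have hε2 : ε * ε ^ (i + 1) = ε ^ i := by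
    rcases hε with rfl | rfl
    · simp
    · rw [pow_succ]; ring
  rw [← hε2]
  field_simp

include hP hε in
-- This is what the comparison of the recurrences for U^⊥ and U requires of the coefficient of the
-- lowest term E = A; `coef_succ_succ` is the requirement for the other terms.
theorem coef_succ_zero (n : ℕ) :
    P ^ n * (P ^ (n + 1) - 1) * coef P ε M s (n + 1) 0 =
      coef P ε M s n 0 * (-P ^ n + P ^ (M + s - n - 1) + ε * (P ^ s - P ^ (M - 1))) := by
  have hP0 : P ≠ 0 := by linarith
  have hn := pow_sub_one_ne hP n
  unfold coef
  rw [if_pos (by omega), if_pos (by omega)]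
  simp only [Nat.sub_zero, Finset.prod_range_succ]
  have e1 : P ^ (s - n) = P ^ s / P ^ n := by rw [zpow_sub₀ hP0, zpow_natCast]
  have e2 : P ^ (M - (0 : ℕ) - 1 - n) = P ^ M / (P * P ^ n) := by
    rw [zpow_sub₀ hP0, zpow_sub₀ hP0, zpow_natCast]; simp; field_simp
  have e3 : P ^ (M + s - n - 1) = P ^ M * P ^ s / (P * P ^ n) := by
    rw [zpow_sub₀ hP0, zpow_sub₀ hP0, zpow_natCast, zpow_add₀ hP0]; simp; field_simp
  have e4 : P ^ (M - 1) = P ^ M / P := by rw [zpow_sub₀ hP0]; simp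
  have e5 : P ^ ((n : ℤ) + 1) = P ^ (n + 1) := by exact_mod_cast zpow_natCast P (n + 1)
  rw [e1, e2, e3, e4, e5]
  have : P ^ M ≠ 0 := zpow_ne_zero _ hP0
  have : P ^ s ≠ 0 := zpow_ne_zero _ hP0
  generalize (∏ t ∈ Finset.range n, (P ^ (M - (0 : ℕ) - 1 - t) + ε)) = a
  generalize (∏ t ∈ Finset.range n, (P ^ (s - t) - ε) / (P ^ ((t : ℤ) + 1) - 1)) = b
  generalize P ^ M = X at *
  generalize P ^ s = Y at *
  simp only [pow_zero, Nat.cast_zero, zero_mul, zpow_zero, one_mul]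
  rcases hε with rfl | rfl <;> field_simp <;> ring

include hP hε in
theorem coef_succ_succ (n i : ℕ) (hi : i ≤ n) :
    P ^ n * (P ^ (n + 1) - 1) * coef P ε M s (n + 1) (i + 1) =
      coef P ε M s n (i + 1) *
        (-P ^ n + P ^ (M + s - n - 1) + ε * (P ^ (s + i + 1) - P ^ (M - i - 2))) +
      coef P ε M s n i * (ε * P ^ (s + i) * (P ^ (i + 1) - 1)) := by
  have hP0 : P ≠ 0 := by linarith
  have hs0 : P ^ s ≠ 0 := zpow_ne_zero _ hP0
  have hM0 : P ^ M ≠ 0 := zpow_ne_zero _ hP0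
  have e4 : P ^ (s + i) = P ^ s * P ^ i := by rw [zpow_add₀ hP0, zpow_natCast]
  -- For i = n the coefficient with index n + 1 is zero by the `if` in `coef`, so only the second
  -- summand remains.
  rcases hi.eq_or_lt with rfl | hlt
  · unfold coef
    rw [if_pos le_rfl, if_neg (by omega), if_pos le_rfl, e4]
    have e1 : P ^ (((i + 1 : ℕ) : ℤ) * (s - (i + 1 : ℕ) + (i + 1 : ℕ))) =
        P ^ ((i : ℤ) * s) * P ^ s := by
      rw [← zpow_add₀ hP0]; congr 1; push_cast; ring
    have e2 : (i : ℤ) * (s - i + i) = i * s := by ring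
    rw [e1, e2]
    simp only [Nat.sub_self, Finset.prod_range_zero]
    ring
  · obtain ⟨d, rfl⟩ := Nat.exists_eq_add_of_lt hlt
    have hn := pow_sub_one_ne hP d
    unfold coef
    rw [if_pos (by omega), if_pos (by omega), if_pos (by omega)]
    rw [show i + d + 1 + 1 - (i + 1) = d + 1 by omega, show i + d + 1 - (i + 1) = d by omega,
      show i + d + 1 - i = d + 1 by omega]
    rw [Finset.prod_range_succ (fun t : ℕ => P ^ (M - (i + 1 : ℕ) - 1 - t) + ε),
      Finset.prod_range_succ' (fun t : ℕ => P ^ (M - i - 1 - t) + ε),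
      Finset.prod_range_succ (fun t : ℕ => (P ^ (s - t) - ε) / (P ^ ((t : ℤ) + 1) - 1))]
    have a1 : ∀ t : ℕ, M - (i : ℤ) - 1 - ((t + 1 : ℕ) : ℤ) = M - ((i + 1 : ℕ) : ℤ) - 1 - t := by
      intro t; push_cast; ring
    simp only [a1]
    generalize (∏ t ∈ Finset.range d, (P ^ (M - (i + 1 : ℕ) - 1 - t) + ε)) = a
    generalize (∏ t ∈ Finset.range d, (P ^ (s - t) - ε) / (P ^ ((t : ℤ) + 1) - 1)) = b
    have x1 : P ^ (((i + 1 : ℕ) : ℤ) * (s - (i + d + 1 + 1 : ℕ) + (i + 1 : ℕ))) =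
        P ^ ((i : ℤ) * (s - (i + d + 1 : ℕ) + i)) * (P ^ s / (P ^ d * P)) := by
      rw [← pow_succ, ← zpow_natCast P (d + 1), ← zpow_sub₀ hP0, ← zpow_add₀ hP0]
      congr 1; push_cast; ring
    have x2 : P ^ (((i + 1 : ℕ) : ℤ) * (s - (i + d + 1 : ℕ) + (i + 1 : ℕ))) =
        P ^ ((i : ℤ) * (s - (i + d + 1 : ℕ) + i)) * (P ^ s / (P ^ d * P)) * (P ^ i * P) := by
      rw [← pow_succ, ← pow_succ, ← zpow_natCast P (d + 1), ← zpow_natCast P (i + 1),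
        ← zpow_sub₀ hP0, ← zpow_add₀ hP0, ← zpow_add₀ hP0]
      congr 1; push_cast; ring
    have x3 : P ^ (M - ((i + 1 : ℕ) : ℤ) - 1 - (d : ℤ)) = P ^ M / (P ^ i * P ^ d * P ^ 2) := by
      rw [← pow_add, ← pow_add, ← zpow_natCast P (i + d + 2), ← zpow_sub₀ hP0]
      congr 1; push_cast; ring
    have x4 : P ^ (M - (i : ℤ) - 1 - ((0 : ℕ) : ℤ)) = P ^ M / (P ^ i * P) := by
      rw [← pow_succ, ← zpow_natCast P (i + 1), ← zpow_sub₀ hP0]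
      congr 1; push_cast; ring
    have x5 : P ^ (s - (d : ℤ)) = P ^ s / P ^ d := by rw [zpow_sub₀ hP0, zpow_natCast]
    have x6 : P ^ ((d : ℤ) + 1) = P ^ (d + 1) := by exact_mod_cast zpow_natCast P (d + 1)
    have x7 : P ^ (M + s - (i + d + 1 : ℕ) - 1) = P ^ M * P ^ s / (P ^ i * P ^ d * P ^ 2) := by
      rw [← pow_add, ← pow_add, ← zpow_natCast P (i + d + 2), ← zpow_add₀ hP0, ← zpow_sub₀ hP0]
      congr 1; push_cast; ring
    have x8 : P ^ (s + i + 1) = P ^ s * P ^ i * P := by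
      rw [zpow_add₀ hP0, zpow_add₀ hP0, zpow_natCast, zpow_one]
    have x9 : P ^ (M - i - 2) = P ^ M / (P ^ i * P ^ 2) := by
      rw [← pow_add, ← zpow_natCast P (i + 2), ← zpow_sub₀ hP0]
      congr 1; push_cast; ring
    rw [x1, x2, x3, x4, x5, x6, x7, x8, x9, e4]
    have hI : P ^ i ≠ 0 := pow_ne_zero _ hP0
    have hD : P ^ d ≠ 0 := pow_ne_zero _ hP0
    have y1 : P ^ (i + d + 1) = P ^ i * P ^ d * P := by ring
    have y2 : P ^ (i + d + 1 + 1) = P ^ i * P ^ d * P ^ 2 := by ring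
    have y3 : ε ^ (i + 1) = ε ^ i * ε := by ring
    have y4 : P ^ (i + 1) = P ^ i * P := by ring
    have y5 : P ^ (d + 1) = P ^ d * P := by ring
    rw [y5] at hn
    rw [y1, y2, y3, y4, y5]
    generalize P ^ ((i : ℤ) * (s - (i + d + 1 : ℕ) + i)) = z
    generalize ε ^ i = w
    generalize P ^ M = X at *
    generalize P ^ s = Y at *
    generalize P ^ i = I at *
    generalize P ^ d = D at *
    rcases hε with rfl | rfl <;> field_simp <;> ring

end coef

variable {F W : Type*} [Field F] [Fintype F] [AddCommGroup W] [Module F W] [Finite W]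
variable {q : QuadraticForm F W}

theorem wittSign_cases (m : ℕ) : wittSign q m = 1 ∨ wittSign q m = -1 := by
  unfold wittSign; split_ifs <;> simp

/-- The number of isotropic subspaces of `U^⊥` containing `A` in terms of those of `U`. -/
theorem isoSub_perp (nd : LinearMap.Nondegenerate q.polarBilin) {m : ℕ}
    (hm : finrank F W = 2 * m) (U : Submodule F W) (n : ℕ) :
    ∀ A : Submodule F W, TotIso q A → A ≤ U → A ≤ perp q U →
      isoSub q A (perp q U) (finrank F A + n) = ∑ i ∈ Finset.range (n + 1),
        coef (Fintype.card F) (wittSign q m) ((m : ℤ) - finrank F A) ((m : ℤ) - finrank F U) n i *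
          isoSub q A U (finrank F A + i) := by
  classical
  cases nonempty_fintype W
  have hP1 := one_lt_P (F := F)
  have hP := P_ne_zero (F := F)
  have hε := wittSign_cases (q := q) m
  induction n using Nat.strong_induction_on with
  | _ n ih =>
  intro A hA hAU hAU'
  rcases n with _ | n
  · simp [isoSub_self hAU' hA, isoSub_self hAU hA, coef]
  have hgn := ih n (by omega) A hA hAU hAU'
  have hUU : perp q (perp q U) = U := perp_perp nd U
  have r1 := isoSub_recurrence nd (A := A) (X := perp q U) (by rwa [hUU]) (finrank F A + n)
  have r2 := fun i => isoSub_recurrence nd hAU' (finrank F A + i)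
  have hdim := finrank_perp nd U
  rw [hm] at hdim
  rw [isoVec_perp nd hm U, hdim] at r1
  set P : ℚ := (Fintype.card F : ℚ) with hPdef
  set ε := wittSign q m
  set a := finrank F A
  set M : ℤ := (m : ℤ) - a with hM
  set s : ℤ := (m : ℤ) - finrank F U with hs
  have hr : (finrank F U : ℤ) = m - s := by rw [hs]; ring
  have hma : (m : ℤ) = M + a := by rw [hM]; ring
  let T : ℕ → ℚ := fun i => isoSubExt q A U (a + i)
  -- For x ∉ A no subspace of dimension a contains A + F x.
  have hT0 : T 0 = 0 := by
    refine Finset.sum_eq_zero fun x _ => ?_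
    split_ifs with h
    · apply isoSub_eq_zero_of_lt
      rw [finrank_sup_span h.2]
      omega
    · rfl
  -- The sums for U^⊥ and for U run over the same vectors x, those of U ∩ U^⊥. So the induction
  -- hypothesis applies for each x with A + F x in place of A.
  have hT : isoSubExt q A (perp q U) (a + n) =
      ∑ i ∈ Finset.range (n + 1), ε * P ^ (-(s - n + i)) * coef P ε M s n i * T i := by
    rw [Finset.sum_range_succ', hT0, mul_zero, add_zero]
    simp only [T, isoSubExt, Finset.mul_sum, hUU]
    rw [Finset.sum_comm]
    refine Finset.sum_congr rfl fun x _ => ?_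
    by_cases h : (x ∈ perp q U ∧ x ∈ U ∧ q x = 0) ∧ x ∉ A
    · have h' : (x ∈ U ∧ x ∈ perp q U ∧ q x = 0) ∧ x ∉ A := by tauto
      simp only [if_pos h, if_pos h']
      have hf := finrank_sup_span h.2
      rcases n with _ | n
      · rw [Finset.range_zero, Finset.sum_empty]
        apply isoSub_eq_zero_of_lt
        omega
      · have h1 := ih n (by omega) (A ⊔ span F {x})
          (hA.sup_span (perp_anti hAU h.1.1) h.1.2.2)
          (sup_le hAU (by simpa using h.1.2.1)) (sup_le hAU' (by simpa using h.1.1))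
        rw [hf, show finrank F A + 1 + n = a + (n + 1) by omega] at h1
        rw [h1]
        refine Finset.sum_congr rfl fun i hi => ?_
        rw [Finset.mem_range] at hi
        rw [show ((m : ℤ) - ((finrank F A + 1 : ℕ) : ℤ)) = M - 1 by push_cast; omega,
          coef_shift hP1 hε M s n i (by omega)]
        rw [show finrank F A + 1 + i = a + (i + 1) by omega]
        congr 4
        push_cast; ring
    · have h' : ¬ ((x ∈ U ∧ x ∈ perp q U ∧ q x = 0) ∧ x ∉ A) := by tauto
      simp [if_neg h, if_neg h']
  rw [hT] at r1
  -- The recurrence for U, solved for T i, so that the radical terms can be eliminated from the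
  -- recurrence for U^⊥.
  have r2' : ∀ i : ℕ, P ^ ((m : ℤ) - s - a - i - 1) * T i =
      P ^ a * P ^ i * (P ^ (i + 1) - 1) * isoSub q A U (a + (i + 1)) -
      isoSub q A U (a + i) * (isoVec q U - P ^ ((m : ℤ) - s - 1) - P ^ a * P ^ i +
        P ^ ((m : ℤ) - s - i - 1)) := by
    intro i
    have h := r2 i
    rw [hr] at h
    have z1 : P ^ (((a + i : ℕ) : ℤ) + 1 - a) = P ^ (i + 1) := by
      rw [← zpow_natCast]; congr 1; push_cast; ring
    have z2 : P ^ ((m : ℤ) - s - (a + i : ℕ) - 1) = P ^ ((m : ℤ) - s - a - i - 1) := by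
      congr 1; push_cast; ring
    have z3 : P ^ ((m : ℤ) - s - a - i - 1) * P ^ a = P ^ ((m : ℤ) - s - i - 1) := by
      rw [← zpow_natCast, ← zpow_add₀ hP]; congr 1; ring
    rw [z1, z2, z3, pow_add, add_assoc a i 1] at h
    change _ = _ + _ * T i at h
    linear_combination -h
  have z1 : P ^ (((a + n : ℕ) : ℤ) + 1 - a) = P ^ (n + 1) := by
    rw [← zpow_natCast]; congr 1; push_cast; ring
  rw [z1, hgn, Finset.sum_mul, Finset.mul_sum, ← Finset.sum_add_distrib] at r1
  -- the coefficient comparison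
  have hne : P ^ a * (P ^ n * (P ^ (n + 1) - 1)) ≠ 0 :=
    mul_ne_zero (pow_ne_zero _ hP) (mul_ne_zero (pow_ne_zero _ hP) (pow_sub_one_ne hP1 n))
  apply mul_left_cancel₀ hne
  rw [pow_add, add_assoc a n 1] at r1
  rw [← mul_assoc, r1]
  -- After this substitution the number of isotropic vectors of U cancels. Only the counts in the
  -- consecutive dimensions a + i and a + i + 1 are left.
  have hterm : ∀ i ∈ Finset.range (n + 1),
      coef P ε M s n i * isoSub q A U (a + i) *
          (P ^ (2 * (m : ℤ) - ↑(finrank F U) - 1) - ε * P ^ ((m : ℤ) - 1) + ε * P ^ s * isoVec q U -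
            P ^ (((2 * m : ℕ) : ℤ) - ↑(finrank F U) - 1) - P ^ a * P ^ n +
            P ^ (((2 * m : ℕ) : ℤ) - ↑(finrank F U) - (a + n : ℕ) - 1) * P ^ a) +
        P ^ (((2 * m : ℕ) : ℤ) - ↑(finrank F U) - (a + n : ℕ) - 1) *
          (ε * P ^ (-(s - n + i)) * coef P ε M s n i * T i) =
      P ^ a * (coef P ε M s n i * (-P ^ n + P ^ (M + s - n - 1) +
        ε * (P ^ (s + i) - P ^ (M - i - 1))) * isoSub q A U (a + i)) +
      P ^ a * (coef P ε M s n i * (ε * P ^ (s + i) * (P ^ (i + 1) - 1)) *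
        isoSub q A U (a + (i + 1))) := by
    intro i _
    have w1 : P ^ (((2 * m : ℕ) : ℤ) - ↑(finrank F U) - (a + n : ℕ) - 1) * P ^ (-(s - n + i)) =
        P ^ s * P ^ ((m : ℤ) - s - a - i - 1) := by
      rw [← zpow_add₀ hP, ← zpow_add₀ hP, hr]; congr 1; push_cast; ring
    have w2 : P ^ (((2 * m : ℕ) : ℤ) - ↑(finrank F U) - (a + n : ℕ) - 1) =
        P ^ (M + s - n - 1) := by
      rw [hr, hM]; congr 1; push_cast; ring
    have w3 : P ^ s * P ^ ((m : ℤ) - s - 1) = P ^ ((m : ℤ) - 1) := by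
      rw [← zpow_add₀ hP]; congr 1; ring
    have w4 : P ^ s * P ^ ((m : ℤ) - s - i - 1) = P ^ a * P ^ (M - i - 1) := by
      rw [← zpow_natCast P a, ← zpow_add₀ hP, ← zpow_add₀ hP, hM]; congr 1; ring
    have w5 : P ^ (s + i) = P ^ s * P ^ i := by rw [zpow_add₀ hP, zpow_natCast]
    have w6 : P ^ (2 * (m : ℤ) - ↑(finrank F U) - 1) =
      P ^ (((2 * m : ℕ) : ℤ) - ↑(finrank F U) - 1) := by push_cast; rfl
    rw [show P ^ (((2 * m : ℕ) : ℤ) - ↑(finrank F U) - (a + n : ℕ) - 1) *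
          (ε * P ^ (-(s - n + i)) * coef P ε M s n i * T i) =
        ε * coef P ε M s n i * (P ^ (((2 * m : ℕ) : ℤ) - ↑(finrank F U) - (a + n : ℕ) - 1) *
          P ^ (-(s - n + i))) * T i by ring, w1,
      show ε * coef P ε M s n i * (P ^ s * P ^ ((m : ℤ) - s - a - i - 1)) * T i =
        ε * coef P ε M s n i * P ^ s * (P ^ ((m : ℤ) - s - a - i - 1) * T i) by ring, r2' i, w2, w5,
      w6]
    linear_combination ε * coef P ε M s n i * isoSub q A U (a + i) * w3 -
      ε * coef P ε M s n i * isoSub q A U (a + i) * w4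
  rw [Finset.sum_congr rfl hterm, Finset.sum_add_distrib, ← Finset.mul_sum, ← Finset.mul_sum,
    ← mul_add, mul_assoc (P ^ a) (P ^ n), mul_assoc (P ^ a) (P ^ n * _)]
  refine congrArg (P ^ a * ·) ?_
  rw [Finset.mul_sum, Finset.sum_range_succ' _ (n + 1), Finset.sum_range_succ' _ n]
  have hlast : ∑ i ∈ Finset.range n, coef P ε M s n (i + 1) * (-P ^ n + P ^ (M + s - n - 1) +
        ε * (P ^ (s + (i + 1 : ℕ)) - P ^ (M - (i + 1 : ℕ) - 1))) * isoSub q A U (a + (i + 1)) =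
      ∑ i ∈ Finset.range (n + 1), coef P ε M s n (i + 1) * (-P ^ n + P ^ (M + s - n - 1) +
        ε * (P ^ (s + (i + 1 : ℕ)) - P ^ (M - (i + 1 : ℕ) - 1))) * isoSub q A U (a + (i + 1)) := by
    rw [Finset.sum_range_succ _ n]
    simp [coef]
  rw [hlast, add_right_comm, ← Finset.sum_add_distrib]
  congr 1
  · refine Finset.sum_congr rfl fun i hi => ?_
    rw [Finset.mem_range] at hi
    have := coef_succ_succ hP1 hε M s n i (by omega)
    rw [show s + ((i + 1 : ℕ) : ℤ) = s + i + 1 by push_cast; ring,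
      show M - ((i + 1 : ℕ) : ℤ) - 1 = M - i - 2 by push_cast; ring]
    linear_combination -(isoSub q A U (a + (i + 1))) * this
  · have := coef_succ_zero hP1 hε M s n
    simp only [Nat.cast_zero, add_zero, sub_zero]
    linear_combination -(isoSub q A U a) * this

end

end IsotropicCount

/-! ### Lagrangians, their complements, and hyperbolic bases -/

namespace IsotropicCount

open Module Submodule

noncomputable section

variable {F W : Type*} [Field F] [Fintype F] [AddCommGroup W] [Module F W] [Finite W]
variable {q : QuadraticForm F W}

theorem wittSign_eq_one {m : ℕ} : wittSign q m = 1 ↔ ∃ A, TotIso q A ∧ finrank F A = m := by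
  unfold wittSign
  split_ifs with h
  · simp [h]
  · simp only [h, iff_false]; norm_num

theorem perp_lagrangian (nd : LinearMap.Nondegenerate q.polarBilin) {j : ℕ}
    (hm : finrank F W = 2 * j) {Λ : Submodule F W} (hΛ : TotIso q Λ) (hj : finrank F Λ = j) :
    perp q Λ = Λ := by
  refine (Submodule.eq_of_le_of_finrank_eq hΛ.le_perp ?_).symm
  have := finrank_perp nd Λ
  omega

/-- The number of Lagrangians complementary to a given one and containing a given subspace. -/
theorem count_complements (nd : LinearMap.Nondegenerate q.polarBilin) {j : ℕ}
    (hm : finrank F W = 2 * j) {Λ : Submodule F W} (hΛ : TotIso q Λ) (hj : finrank F Λ = j)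
    (n : ℕ) : ∀ A : Submodule F W, TotIso q A → A ⊓ Λ = ⊥ → finrank F A + n = j →
      count (fun D : Submodule F W => (A ≤ D ∧ TotIso q D ∧ finrank F D = j) ∧ D ⊓ Λ = ⊥) =
        (Fintype.card F : ℚ) ^ (n * (n - 1) / 2) := by
  classical
  cases nonempty_fintype W
  cases nonempty_fintype (Submodule F W)
  have hP := P_ne_zero (F := F)
  have hP1 := one_lt_P (F := F)
  have hΛΛ := perp_lagrangian nd hm hΛ hj
  induction n with
  | zero =>
    intro A hA hAΛ ha
    have : ∀ D : Submodule F W, ((A ≤ D ∧ TotIso q D ∧ finrank F D = j) ∧ D ⊓ Λ = ⊥) ↔ D = A := by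
      intro D
      constructor
      · rintro ⟨⟨h1, h2, h3⟩, h4⟩
        exact (Submodule.eq_of_le_of_finrank_eq h1 (by omega)).symm
      · rintro rfl
        exact ⟨⟨le_rfl, hA, by omega⟩, hAΛ⟩
    rw [count_congr this]
    simp [count]
  | succ n ih =>
    intro A hA hAΛ ha
    set P : ℚ := (Fintype.card F : ℚ) with hPdef
    set a := finrank F A
    -- Double count of pairs (D, x) with x ∈ D outside A. Each D has P^j − P^a such x. A vector x
    -- contributes only if it is isotropic, orthogonal to A and outside A + Λ, and then the
    -- induction hypothesis for A + F x counts the D.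
    let R : Submodule F W → W → Prop := fun D x =>
      ((A ≤ D ∧ TotIso q D ∧ finrank F D = j) ∧ D ⊓ Λ = ⊥) ∧ x ∈ D ∧ x ∉ A
    have h1 : count (fun z : Submodule F W × W => R z.1 z.2) =
        count (fun D : Submodule F W => (A ≤ D ∧ TotIso q D ∧ finrank F D = j) ∧ D ⊓ Λ = ⊥) *
          (P ^ j - P ^ a) := by
      rw [count_sigma R, count_eq_sum, Finset.sum_mul]
      refine Finset.sum_congr rfl fun D _ => ?_
      by_cases hD : (A ≤ D ∧ TotIso q D ∧ finrank F D = j) ∧ D ⊓ Λ = ⊥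
      · simp only [R, hD, and_self, true_and, if_true, one_mul]
        have h2 := count_split (· ∈ D) (· ∈ A)
        have h3 : count (fun y => y ∈ D ∧ y ∈ A) = P ^ a := by
          rw [hPdef, ← count_mem]
          exact count_congr fun y => ⟨fun h => h.2, fun h => ⟨hD.1.1 h, h⟩⟩
        rw [h3, count_mem, hD.1.2.2] at h2
        linear_combination -h2
      · simp [R, hD, count]
    have h2 : count (fun z : Submodule F W × W => R z.1 z.2) =
        count (fun x => (x ∈ perp q A ∧ q x = 0) ∧ x ∉ A ⊔ Λ) * P ^ (n * (n - 1) / 2) := by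
      rw [count_sigma' R, count_eq_sum, Finset.sum_mul]
      refine Finset.sum_congr rfl fun x _ => ?_
      split_ifs with hx
      · obtain ⟨⟨hx1, hx2⟩, hx3⟩ := hx
        have hxA : x ∉ A := fun h => hx3 (mem_sup_left h)
        rw [one_mul, ← ih (A ⊔ span F {x}) (hA.sup_span hx1 hx2) ?_ ?_]
        · refine count_congr fun D => ?_
          simp only [R, sup_le_iff, span_singleton_le_iff_mem]
          tauto
        · rw [eq_bot_iff]
          rintro y ⟨hy, hyΛ⟩
          obtain ⟨e, he, z, hz, rfl⟩ := mem_sup.1 hy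
          obtain ⟨c, rfl⟩ := mem_span_singleton.1 hz
          by_cases hc : c = 0
          · rw [← hAΛ]
            refine ⟨?_, hyΛ⟩
            simpa [hc] using he
          · exfalso
            apply hx3
            rw [← (A ⊔ Λ).smul_mem_iff hc]
            have : c • x = -e + (e + c • x) := by abel
            rw [this]
            exact add_mem (mem_sup_left (A.neg_mem he)) (mem_sup_right hyΛ)
        · rw [finrank_sup_span hxA]; omega
      · rw [zero_mul, count_congr (t := fun _ => False)]
        · simp [count]
        · rintro D
          refine iff_false_intro ?_
          rintro ⟨⟨⟨h1, h2, h3⟩, h4⟩, h5, h6⟩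
          refine hx ⟨⟨?_, h2 x h5⟩, ?_⟩
          · exact mem_perp.2 fun y hy => h2.polar h5 (h1 hy)
          · intro hxs
            obtain ⟨e, he, l, hl, rfl⟩ := mem_sup.1 hxs
            have : l ∈ D ⊓ Λ := ⟨by simpa using D.sub_mem h5 (h1 he), hl⟩
            rw [h4, mem_bot] at this
            apply h6
            simpa [this] using he
    have h3 : count (fun x => (x ∈ perp q A ∧ q x = 0) ∧ x ∉ A ⊔ Λ) =
        P ^ (j + n) - P ^ ((j : ℤ) - 1) := by
      have h4 : isoVec q (perp q A) = _ := count_split _ (· ∈ A ⊔ Λ)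
      have h5 := isoVec_inf_perp nd hA le_top
      have h6 : count (fun y => y ∈ A ∧ y ∈ perp q ⊤) = 1 := by
        rw [count_inf (F := F), perp_top nd, inf_bot_eq, finrank_bot, pow_zero]
      rw [h6, top_inf_eq, isoVec_top nd hm, wittSign_eq_one.2 ⟨Λ, hΛ, hj⟩, finrank_top, hm] at h5
      -- Every vector e + l of (A + Λ) ∩ A^⊥ is isotropic, because orthogonality to e gives polar(e,
      -- l) = 0. The dimension of this intersection is j, since A ∩ (A + Λ)^⊥ lies in A ∩ Λ = 0.
      have h7 : count (fun y => (y ∈ perp q A ∧ q y = 0) ∧ y ∈ A ⊔ Λ) = P ^ j := by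
        have e1 : count (fun y => (y ∈ perp q A ∧ q y = 0) ∧ y ∈ A ⊔ Λ) =
            count (fun y => y ∈ A ⊔ Λ ∧ y ∈ perp q A) := by
          refine count_congr fun y => ⟨fun h => ⟨h.2, h.1.1⟩, fun h => ⟨⟨h.2, ?_⟩, h.1⟩⟩
          obtain ⟨h1, h2⟩ := h
          obtain ⟨e, he, l, hl, rfl⟩ := mem_sup.1 h1
          have h3 := mem_perp.1 h2 e he
          rw [QuadraticMap.polar_add_left, hA.polar he he, zero_add, QuadraticMap.polar_comm] at h3
          rw [q_add, hA e he, hΛ l hl, h3]; simp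
        rw [e1, count_inf]
        congr 1
        have e2 := finrank_inf_perp nd (A ⊔ Λ) A
        rw [perp_sup, hΛΛ, ← inf_assoc, inf_right_comm, hAΛ, bot_inf_eq, finrank_bot] at e2
        have e3 := finrank_sup_add_finrank_inf_eq A Λ
        rw [hAΛ, finrank_bot] at e3
        omega
      rw [h7] at h4
      have e4 : P ^ (((2 * j : ℕ) : ℤ) - a - 1) = P ^ (j + n) := by
        rw [← zpow_natCast]; congr 1; push_cast; omega
      rw [e4] at h5
      push_cast at h5
      rw [zpow_natCast] at h5
      linear_combination h5 - h4
    rw [h2, h3] at h1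
    have e5 : P ^ j = P ^ a * P ^ n * P := by
      rw [← ha]; ring
    have e6 : P ^ ((j : ℤ) - 1) = P ^ a * P ^ n := by
      rw [← pow_add, ← zpow_natCast]; congr 1; push_cast; omega
    have e7 : P ^ ((n + 1) * (n + 1 - 1) / 2) = P ^ n * P ^ (n * (n - 1) / 2) := by
      rw [← pow_add]
      congr 1
      rcases n with _ | n
      · simp
      · have : (n + 1 + 1) * (n + 1 + 1 - 1) = (n + 1) * (n + 1 - 1) + 2 * (n + 1) := by
          simp only [Nat.add_sub_cancel]; ring
        rw [this, Nat.add_mul_div_left _ _ (by norm_num)]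
        ring
    rw [e7]
    have hne : P ^ j - P ^ a ≠ 0 := by
      rw [sub_ne_zero]
      exact (pow_lt_pow_right₀ hP1 (by omega)).ne'
    apply mul_right_cancel₀ hne
    rw [← h1, pow_add, e6, e5]
    ring

/-- A quadratic space with a Lagrangian is an orthogonal sum of hyperbolic planes. -/
theorem exists_hyperbolic_basis (nd : LinearMap.Nondegenerate q.polarBilin) {m : ℕ}
    (hm : finrank F W = 2 * m) {A : Submodule F W} (hA : TotIso q A) (hAm : finrank F A = m) :
    ∃ e : Basis (Fin m ⊕ Fin m) F W, ∀ a c : Fin m → F,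
      q (∑ i, a i • e (Sum.inl i) + ∑ i, c i • e (Sum.inr i)) = ∑ i, a i * c i := by
  classical
  let b : Basis (Fin m) F A := Module.finBasisOfFinrankEq F A hAm
  have hf : ∀ i : Fin m, ∃ f : W, ∀ k, QuadraticMap.polar q f (b k) = if i = k then 1 else 0 := by
    intro i
    obtain ⟨g, hg⟩ := (b.coord i).exists_extend
    refine ⟨(LinearMap.BilinForm.toDual (q.polarBilin : LinearMap.BilinForm F W) nd).symm g, ?_⟩
    intro k
    have h1 := LinearMap.BilinForm.apply_toDual_symm_apply
      (B := (q.polarBilin : LinearMap.BilinForm F W)) (hB := nd) (f := g) (v := (b k : W))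
    have h2 := LinearMap.congr_fun hg (b k)
    rw [LinearMap.comp_apply, Submodule.subtype_apply, Basis.coord_apply, Basis.repr_self,
      Finsupp.single_apply] at h2
    rw [← QuadraticMap.polarBilin_apply_apply, h1, h2]
    simp [eq_comm]
  choose f hfb using hf
  -- The dual vectors f i are corrected by u i ∈ A to become isotropic and mutually orthogonal. The
  -- triangular choice assigns the pairing of f i and f k to the larger index only, so nothing is
  -- halved and characteristic 2 is included.
  let t : Fin m → Fin m → F := fun i k =>
    if k = i then q (f i) else if k < i then QuadraticMap.polar q (f i) (f k) else 0
  let u : Fin m → W := fun i => ∑ k, t i k • (b k : W)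
  have huA : ∀ i, u i ∈ A := fun i => A.sum_mem fun k _ => A.smul_mem _ (b k).2
  have hfu : ∀ i l, QuadraticMap.polar q (f i) (u l) = t l i := by
    intro i l
    rw [← QuadraticMap.polarBilin_apply_apply, map_sum]
    simp [hfb]
  let g : Fin m → W := fun i => f i - u i
  have hgb : ∀ i k, QuadraticMap.polar q (g i) (b k) = if i = k then 1 else 0 := by
    intro i k
    rw [QuadraticMap.polar_sub_left, hfb, hA.polar (huA i) (b k).2, sub_zero]
  have hgg : ∀ i, q (g i) = 0 := by
    intro i
    have : q (g i) = q (f i) + q (u i) - QuadraticMap.polar q (f i) (u i) := by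
      simp only [g, sub_eq_add_neg]
      rw [q_add, QuadraticMap.polar_neg_right, QuadraticMap.map_neg]
    rw [this, hA _ (huA i), hfu]
    simp [t]
  have hgg' : ∀ i k, i ≠ k → QuadraticMap.polar q (g i) (g k) = 0 := by
    intro i k hik
    simp only [g]
    rw [QuadraticMap.polar_sub_left, QuadraticMap.polar_sub_right, QuadraticMap.polar_sub_right,
      hA.polar (huA i) (huA k), hfu, QuadraticMap.polar_comm _ (u i), hfu]
    rcases lt_or_gt_of_ne hik with h | h
    · simp [t, hik, hik.symm, h, h.not_gt, QuadraticMap.polar_comm _ (f k)]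
    · simp [t, hik, hik.symm, h, h.not_gt]
  have hq : ∀ a c : Fin m → F, q (∑ i, a i • (b i : W) + ∑ i, c i • g i) = ∑ i, a i * c i := by
    intro a c
    have h1 : q (∑ i, a i • (b i : W)) = 0 :=
      hA _ (A.sum_mem fun k _ => A.smul_mem _ (b k).2)
    have h2 : q (∑ i, c i • g i) = 0 := by
      rw [QuadraticMap.map_sum]
      rw [Finset.sum_eq_zero, Finset.sum_eq_zero, add_zero]
      · intro x hx
        rw [Finset.mem_filter] at hx
        obtain ⟨-, hx⟩ := hx
        induction x with
        | h x y =>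
          rw [Sym2.mk_isDiag_iff] at hx
          simp [QuadraticMap.polarSym2_sym2Mk, QuadraticMap.polar_smul_left,
            QuadraticMap.polar_smul_right, hgg' x y hx]
      · intro i _
        rw [QuadraticMap.map_smul, hgg, smul_zero]
    rw [q_add, h1, h2, zero_add, zero_add, QuadraticMap.polar_comm,
      ← QuadraticMap.polarBilin_apply_apply]
    simp only [map_sum, LinearMap.sum_apply, map_smul, LinearMap.smul_apply,
      QuadraticMap.polarBilin_apply_apply, hgb, smul_eq_mul]
    refine Finset.sum_congr rfl fun i _ => ?_
    rw [Finset.sum_eq_single i]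
    · simp
    · intro k _ hk; simp [hk]
    · simp
  have hli : LinearIndependent F (Sum.elim (fun i => (b i : W)) g) := by
    rw [Fintype.linearIndependent_iff]
    intro x hx
    rw [Fintype.sum_sum_type] at hx
    simp only [Sum.elim_inl, Sum.elim_inr] at hx
    have h1 : ∀ k, x (Sum.inr k) = 0 := by
      intro k
      have h := congrArg (fun w => q.polarBilin w (b k : W)) hx
      simp only [map_add, map_sum, LinearMap.add_apply, LinearMap.sum_apply, map_smul,
        LinearMap.smul_apply, QuadraticMap.polarBilin_apply_apply, hgb,
        hA.polar (b _).2 (b _).2, smul_eq_mul, map_zero, LinearMap.zero_apply] at h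
      simpa using h
    simp only [h1, zero_smul, Finset.sum_const_zero, add_zero] at hx
    have h2 : ∑ i, x (Sum.inl i) • b i = 0 := Subtype.ext (by simpa using hx)
    have h3 := Fintype.linearIndependent_iff.1 b.linearIndependent _ h2
    rintro (i | i)
    · exact h3 i
    · exact h1 i
  rcases isEmpty_or_nonempty (Fin m ⊕ Fin m) with hemp | hne
  · have hm0 : m = 0 := by
      by_contra h
      exact hemp.elim (Sum.inl ⟨0, by omega⟩)
    subst hm0
    have hsub : Subsingleton W := Module.finrank_zero_iff.1 (by omega : finrank F W = 0)
    refine ⟨Basis.empty W, fun a c => ?_⟩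
    simp
  · refine ⟨basisOfLinearIndependentOfCardEqFinrank hli (by simp [hm]; omega), fun a c => ?_⟩
    rw [coe_basisOfLinearIndependentOfCardEqFinrank]
    exact hq a c

theorem wittSign_eq_one_iff (nd : LinearMap.Nondegenerate q.polarBilin) {k : ℕ}
    (hk : finrank F W = 2 * k) :
    wittSign q k = 1 ↔ ∃ (m : ℕ) (e : Basis (Fin m ⊕ Fin m) F W), ∀ a c : Fin m → F,
      q (∑ i, a i • e (Sum.inl i) + ∑ i, c i • e (Sum.inr i)) = ∑ i, a i * c i := by
  classical
  rw [wittSign_eq_one]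
  constructor
  · rintro ⟨A, hA, hAk⟩
    exact ⟨k, exists_hyperbolic_basis nd hk hA hAk⟩
  · rintro ⟨m, e, he⟩
    have hmk : m = k := by
      have := Module.finrank_eq_card_basis e
      rw [hk, Fintype.card_sum, Fintype.card_fin] at this
      omega
    subst hmk
    refine ⟨span F (Set.range fun i => e (Sum.inl i)), ?_, ?_⟩
    · intro x hx
      obtain ⟨a, rfl⟩ := (Submodule.mem_span_range_iff_exists_fun F).1 hx
      have := he a 0
      simpa using this
    · refine (finrank_span_eq_card (e.linearIndependent.comp _ Sum.inl_injective)).trans ?_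
      simp

end

end IsotropicCount

/-! ### Reduction of an even lattice modulo p, and unimodularity at p -/

namespace SiegelTheta

open Module IsotropicCount

noncomputable section

variable {V : Type*} [AddCommGroup V] [Module ℚ V]

theorem bilin_zsmul_left (B : LinearMap.BilinForm ℚ V) (n : ℤ) (x y : V) :
    B (n • x) y = n * B x y := by
  rw [← Int.cast_smul_eq_zsmul ℚ, map_smul, LinearMap.smul_apply, smul_eq_mul]

theorem bilin_zsmul_right (B : LinearMap.BilinForm ℚ V) (n : ℤ) (x y : V) :
    B x (n • y) = n * B x y := by
  rw [← Int.cast_smul_eq_zsmul ℚ, map_smul, smul_eq_mul]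

/-- The quadratic form `½ B(x,x)` modulo `p` on a quotient of an even lattice. -/
theorem exists_quotient_form {p : ℕ} {G W : Type*} [AddCommGroup G] [AddCommGroup W]
    [Module (ZMod p) W] (π : G →+ W) (hπ : Function.Surjective π) (ι : G →+ V)
    (B : LinearMap.BilinForm ℚ V) (hB : B.IsSymm)
    (heven : ∀ x, ∃ m : ℤ, B (ι x) (ι x) = 2 * m)
    (hker : ∀ x, π x = 0 → (∃ m : ℤ, B (ι x) (ι x) = 2 * (p * m)) ∧
      ∀ y, ∃ m : ℤ, B (ι y) (ι x) = p * m) :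
    ∃ q : QuadraticForm (ZMod p) W,
      (∀ x, ∀ m : ℤ, B (ι x) (ι x) = 2 * m → q (π x) = m) ∧
      ∀ x y, ∀ m : ℤ, B (ι x) (ι y) = m → QuadraticMap.polar q (π x) (π y) = m := by
  choose N hN using heven
  have hs : ∀ x y, B x y = B y x := fun x y => (hB.eq y x).symm
  have hadd : ∀ x y, B (ι x) (ι y) = (N (x + y) - N x - N y : ℤ) := by
    intro x y
    have h := hN (x + y)
    simp only [map_add, LinearMap.add_apply] at h
    rw [hN x, hN y, hs (ι y)] at h
    push_cast
    linarith
  let Q : W → ZMod p := fun w => (N (Function.surjInv hπ w) : ZMod p)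
  -- Independence of the representative: N x − N x' is the half-norm of x − x' plus B(x', x − x'),
  -- and both are divisible by p because x − x' lies in the kernel.
  have hQ : ∀ x, Q (π x) = N x := by
    intro x
    set x' := Function.surjInv hπ (π x)
    have hx' : π x' = π x := Function.surjInv_eq hπ _
    obtain ⟨⟨m, hm⟩, h2⟩ := hker (x - x') (by rw [map_sub, hx', sub_self])
    obtain ⟨m', hm'⟩ := h2 x'
    rw [hN] at hm
    rw [hadd] at hm'
    have e1 : N (x - x') = p * m := by exact_mod_cast mul_left_cancel₀ two_ne_zero hm
    have e2 : N (x' + (x - x')) - N x' - N (x - x') = p * m' := by exact_mod_cast hm'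
    rw [add_sub_cancel] at e2
    have e3 : N x = N x' + p * (m + m') := by linarith
    change ((N x' : ℤ) : ZMod p) = _
    rw [e3]; simp
  have hpol : ∀ x y, ∀ m : ℤ, B (ι x) (ι y) = m → QuadraticMap.polar Q (π x) (π y) = m := by
    intro x y m hm
    rw [hadd] at hm
    have : m = N (x + y) - N x - N y := by exact_mod_cast hm.symm
    rw [QuadraticMap.polar, ← map_add, hQ, hQ, hQ, this]
    push_cast; rfl
  have hsm : ∀ (n : ℤ) (x : G), ((n : ZMod p) • π x) = π (n • x) := by
    intro n x; rw [map_zsmul, Int.cast_smul_eq_zsmul]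
  have hint : ∀ a : ZMod p, ∃ n : ℤ, (n : ZMod p) = a := ZMod.intCast_surjective
  refine ⟨QuadraticMap.ofPolar Q ?_ ?_ ?_, ?_, ?_⟩
  · intro a w
    obtain ⟨x, rfl⟩ := hπ w
    obtain ⟨n, rfl⟩ := hint a
    rw [hsm, hQ, hQ]
    have h := hN (n • x)
    rw [map_zsmul, bilin_zsmul_left, bilin_zsmul_right, hN] at h
    have : N (n • x) = n * n * N x := by
      have h2 : (2 : ℚ) * (N (n • x) : ℚ) = 2 * ((n * n * N x : ℤ) : ℚ) := by
        rw [← h]; push_cast; ring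
      exact_mod_cast mul_left_cancel₀ two_ne_zero h2
    rw [this]; push_cast; rfl
  · intro w w' z
    obtain ⟨x, rfl⟩ := hπ w
    obtain ⟨x', rfl⟩ := hπ w'
    obtain ⟨y, rfl⟩ := hπ z
    rw [← map_add, hpol x y _ (hadd x y), hpol x' y _ (hadd x' y),
      hpol (x + x') y ((N (x + y) - N x - N y) + (N (x' + y) - N x' - N y))]
    · push_cast; rfl
    · push_cast
      rw [map_add, map_add, LinearMap.add_apply, hadd, hadd]; push_cast; rfl
  · intro a w z
    obtain ⟨x, rfl⟩ := hπ w
    obtain ⟨y, rfl⟩ := hπ z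
    obtain ⟨n, rfl⟩ := hint a
    rw [hsm, hpol x y _ (hadd x y), hpol (n • x) y (n * (N (x + y) - N x - N y))]
    · push_cast; rfl
    · rw [map_zsmul, bilin_zsmul_left, hadd]; push_cast; rfl
  · intro x m hm
    rw [hN] at hm
    have : N x = m := by exact_mod_cast mul_left_cancel₀ two_ne_zero hm
    rw [← this]; exact hQ x
  · exact hpol

theorem IsEvenIntegral.integral {B : LinearMap.BilinForm ℚ V} {L : Submodule ℤ V} (hB : B.IsSymm)
    (hL : IsEvenIntegral B L) {x y : V} (hx : x ∈ L) (hy : y ∈ L) : ∃ m : ℤ, B x y = m := by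
  obtain ⟨a, ha⟩ := hL x hx
  obtain ⟨b, hb⟩ := hL y hy
  obtain ⟨c, hc⟩ := hL (x + y) (L.add_mem hx hy)
  have hs : B y x = B x y := hB.eq _ _
  refine ⟨c - a - b, ?_⟩
  simp only [map_add, LinearMap.add_apply, hs, ha, hb] at hc
  push_cast
  linarith

theorem intCast_smul_mem (L : Submodule ℤ V) (n : ℤ) {x : V} (hx : x ∈ L) : (n : ℚ) • x ∈ L := by
  rw [Int.cast_smul_eq_zsmul]; exact L.smul_mem n hx

theorem natCast_smul_mem (L : Submodule ℤ V) (n : ℕ) {x : V} (hx : x ∈ L) : (n : ℚ) • x ∈ L := by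
  exact_mod_cast intCast_smul_mem L n hx

theorem red_eq_zero_iff (p : ℕ) (L : Submodule ℤ V) (x : L) :
    red p L x = 0 ↔ ∃ z ∈ L, (x : V) = (p : ℚ) • z := by
  rw [← map_zero (red p L), red_eq_iff]
  constructor
  · rintro ⟨z, hz⟩
    refine ⟨z, z.2, ?_⟩
    rw [sub_zero] at hz
    rw [hz, Submodule.coe_smul, ← Int.cast_smul_eq_zsmul ℚ]; simp
  · rintro ⟨z, hz, h⟩
    refine ⟨⟨z, hz⟩, Subtype.ext ?_⟩
    rw [sub_zero, h, Submodule.coe_smul, ← Int.cast_smul_eq_zsmul ℚ]; simp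

/-- Nondegeneracy of `B` on `L` modulo `p`. -/
def PUnimodular (p : ℕ) (B : LinearMap.BilinForm ℚ V) (L : Submodule ℤ V) : Prop :=
  ∀ y ∈ L, (∀ w ∈ L, ∃ m : ℤ, B y w = p * m) → ∃ z ∈ L, y = (p : ℚ) • z

theorem exists_modP_form {p : ℕ} {B : LinearMap.BilinForm ℚ V} {L : Submodule ℤ V} (hB : B.IsSymm)
    (hL : IsEvenIntegral B L) : ∃ q : QuadraticForm (ZMod p) (ModP p L),
      (∀ x : L, ∀ m : ℤ, B x x = 2 * m → q (red p L x) = m) ∧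
      ∀ x y : L, ∀ m : ℤ, B x y = m → QuadraticMap.polar q (red p L x) (red p L y) = m := by
  refine exists_quotient_form (red p L) (red_surjective p L) L.subtype.toAddMonoidHom B hB
    (fun x => hL x x.2) ?_
  intro x hx
  obtain ⟨z, hz, h⟩ := (red_eq_zero_iff p L x).1 hx
  simp only [LinearMap.toAddMonoidHom_coe, Submodule.subtype_apply, h]
  constructor
  · obtain ⟨m, hm⟩ := hL z hz
    refine ⟨p * m, ?_⟩
    rw [map_smul, map_smul, LinearMap.smul_apply, hm]
    simp only [smul_eq_mul]; push_cast; ring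
  · intro y
    obtain ⟨m, hm⟩ := hL.integral hB y.2 hz
    exact ⟨m, by rw [map_smul, hm, smul_eq_mul]⟩

/-- The reduction of `½ B(x,x)` modulo `p`. -/
structure IsModPForm (p : ℕ) (B : LinearMap.BilinForm ℚ V) (L : Submodule ℤ V)
    (q : QuadraticForm (ZMod p) (ModP p L)) : Prop where
  apply_red : ∀ x : L, ∀ m : ℤ, B x x = 2 * m → q (red p L x) = m
  polar_red : ∀ x y : L, ∀ m : ℤ, B x y = m → QuadraticMap.polar q (red p L x) (red p L y) = m

section modP

variable {p : ℕ} {B : LinearMap.BilinForm ℚ V} {L : Submodule ℤ V}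
  {q : QuadraticForm (ZMod p) (ModP p L)}

theorem IsModPForm.nondegenerate (hq : IsModPForm p B L q) (hB : B.IsSymm)
    (hL : IsEvenIntegral B L) (hu : PUnimodular p B L) :
    LinearMap.Nondegenerate q.polarBilin := by
  have key : ∀ w : ModP p L, (∀ y, QuadraticMap.polar q w y = 0) → w = 0 := by
    intro w hw
    obtain ⟨x, rfl⟩ := red_surjective p L w
    rw [red_eq_zero_iff]
    refine hu x x.2 fun y hy => ?_
    obtain ⟨m, hm⟩ := hL.integral hB x.2 hy
    have := hw (red p L ⟨y, hy⟩)
    rw [hq.polar_red x ⟨y, hy⟩ m hm] at this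
    obtain ⟨c, rfl⟩ := (ZMod.intCast_zmod_eq_zero_iff_dvd m p).1 this
    exact ⟨c, by rw [hm]; push_cast; rfl⟩
  constructor
  · exact fun w hw => key w hw
  · refine fun w hw => key w fun y => ?_
    rw [QuadraticMap.polar_comm]
    exact hw y

/-- For odd p, `redForm` reduces Q rather than ½Q. The factor 2 is then a unit, so isotropy and
hyperbolicity do not depend on which of the two forms is used. -/
theorem IsModPForm.redForm_eq (hq : IsModPForm p B L q) (hB : B.IsSymm)
    (hL : IsEvenIntegral B L) (w : ModP p L) :
    redForm p B L w = (if p = 2 then 1 else 2) * q w := by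
  obtain ⟨x, rfl⟩ := red_surjective p L w
  obtain ⟨m, hm⟩ := hL x x.2
  rw [redForm_red p B L hB hL, hq.apply_red x m hm]
  unfold intForm
  have hfl : ⌊(2 : ℚ) * (m : ℚ)⌋ = 2 * m := by
    exact_mod_cast Int.floor_intCast (R := ℚ) (2 * m)
  split_ifs with hp
  · rw [hm, mul_div_cancel_left₀ _ (two_ne_zero), Int.floor_intCast]; simp
  · rw [hm, hfl]; push_cast; rfl

theorem two_const_ne_zero (hp : p.Prime) : (if p = 2 then 1 else 2 : ZMod p) ≠ 0 := by
  have := Fact.mk hp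
  split_ifs with h
  · exact one_ne_zero
  · intro h2
    have : ((2 : ℕ) : ZMod p) = 0 := by exact_mod_cast h2
    rw [ZMod.natCast_eq_zero_iff] at this
    exact h ((Nat.prime_dvd_prime_iff_eq hp Nat.prime_two).1 this)

theorem IsModPForm.redForm_eq_zero_iff (hq : IsModPForm p B L q) (hp : p.Prime) (hB : B.IsSymm)
    (hL : IsEvenIntegral B L) (w : ModP p L) : redForm p B L w = 0 ↔ q w = 0 := by
  have := Fact.mk hp
  rw [hq.redForm_eq hB hL, mul_eq_zero, or_iff_right (two_const_ne_zero hp)]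

theorem IsModPForm.isHyperbolic_iff (hq : IsModPForm p B L q) (hp : p.Prime) (hB : B.IsSymm)
    (hL : IsEvenIntegral B L) : IsHyperbolic p B L ↔
      ∃ (m : ℕ) (e : Module.Basis (Fin m ⊕ Fin m) (ZMod p) (ModP p L)), ∀ a c : Fin m → ZMod p,
        q (∑ i, a i • e (Sum.inl i) + ∑ i, c i • e (Sum.inr i)) = ∑ i, a i * c i := by
  have := Fact.mk hp
  unfold IsHyperbolic
  simp only [hq.redForm_eq hB hL, mul_right_inj' (two_const_ne_zero hp)]

/-- The reductions of a basis of `L` form a basis of `L / pL`. -/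
theorem exists_modP_basis {ι : Type*} [Fintype ι] (v : Basis ι ℤ L) :
    ∃ b : Basis ι (ZMod p) (ModP p L), ∀ i, b i = red p L (v i) := by
  have hsm : ∀ (n : ℤ) (x : L), ((n : ZMod p) • red p L x) = red p L (n • x) := by
    intro n x; rw [map_zsmul, Int.cast_smul_eq_zsmul]
  have hli : LinearIndependent (ZMod p) fun i => red p L (v i) := by
    rw [Fintype.linearIndependent_iff]
    intro c hc i
    choose n hn using fun i => ZMod.intCast_surjective (c i)
    simp only [← hn, hsm] at hc
    rw [← map_sum, ← map_zero (red p L), red_eq_iff] at hc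
    obtain ⟨z, hz⟩ := hc
    have h1 := congrArg (fun x => v.repr x i) hz
    rw [sub_zero] at h1
    simp only [map_smul, Finsupp.smul_apply, v.repr_sum_self] at h1
    rw [← hn i, h1]; simp
  have hsp : ⊤ ≤ Submodule.span (ZMod p) (Set.range fun i => red p L (v i)) := by
    intro w _
    obtain ⟨x, rfl⟩ := red_surjective p L w
    rw [← v.sum_repr x, map_sum]
    refine Submodule.sum_mem _ fun i _ => ?_
    rw [← hsm]
    exact Submodule.smul_mem _ _ (Submodule.subset_span ⟨i, rfl⟩)
  exact ⟨Basis.mk hli hsp, fun i => by simp⟩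

theorem finite_modP (hp : p.Prime) {ι : Type*} [Fintype ι] (v : Basis ι ℤ L) :
    Finite (ModP p L) := by
  have := Fact.mk hp
  obtain ⟨b, -⟩ := exists_modP_basis v
  exact Finite.of_equiv _ b.equivFun.symm.toEquiv

end modP

/-- A lattice is unimodular at the primes not dividing its level. -/
theorem pUnimodular_of_level {p : ℕ} {B : LinearMap.BilinForm ℚ V} {L : Submodule ℤ V}
    (hp : p.Prime) (hpos : ∀ x : V, x ≠ 0 → 0 < B x x) (hB : B.IsSymm)
    (hlat : Submodule.IsLattice ℚ L) (hlevel : ¬ p ∣ level B L) :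
    PUnimodular p B L ∧ Nonempty (Basis (Fin (finrank ℚ V)) ℤ L) := by
  -- If no admissible N existed, `sInf ∅ = 0` would make the level 0, which p divides. So p ∤ level
  -- also provides a basis of L.
  have hne : {N : ℕ | 0 < N ∧ ∃ v : Module.Basis (Fin (Module.finrank ℚ V)) ℤ L,
    IsEvenMatrix ((N : ℚ) • (gram B (fun i => ((v i : L) : V)))⁻¹)}.Nonempty := by
    by_contra h
    rw [Set.not_nonempty_iff_eq_empty] at h
    apply hlevel
    rw [level, h, Nat.sInf_empty]
    exact dvd_zero p
  obtain ⟨hN0, v, hv⟩ := Nat.sInf_mem hne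
  change 0 < level B L at hN0
  change IsEvenMatrix ((level B L : ℚ) • _) at hv
  set N := level B L
  refine ⟨?_, ⟨v⟩⟩
  set A := gram B (fun i => ((v i : L) : V)) with hA
  have hspan : ⊤ ≤ Submodule.span ℚ (Set.range fun i => ((v i : L) : V)) := by
    rw [← hlat.span_eq_top, Submodule.span_le]
    intro x hx
    have : (x : V) = ((∑ i, v.repr ⟨x, hx⟩ i • v i : L) : V) := by rw [v.sum_repr]
    rw [SetLike.mem_coe, this]
    push_cast
    refine Submodule.sum_mem _ fun i _ => ?_
    rw [← Int.cast_smul_eq_zsmul ℚ]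
    exact Submodule.smul_mem _ _ (Submodule.subset_span ⟨i, rfl⟩)
  have hli : LinearIndependent ℚ fun i => ((v i : L) : V) :=
    linearIndependent_of_top_le_span_of_card_eq_finrank hspan (by simp)
  -- Positive definiteness makes the Gram matrix invertible; otherwise `A⁻¹` would be the default
  -- value 0.
  have hdet : IsUnit A := by
    rw [← Matrix.mulVec_injective_iff_isUnit]
    refine (injective_iff_map_eq_zero (Matrix.mulVecLin A)).2 fun c hc => ?_
    have h1 : B (∑ i, c i • ((v i : L) : V)) (∑ i, c i • ((v i : L) : V)) = 0 := by
      have h2 : ∀ i, B ((v i : L) : V) (∑ k, c k • ((v k : L) : V)) = 0 := by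
        intro i
        have h3 := congrFun hc i
        simp only [Matrix.mulVecLin_apply, Matrix.mulVec, dotProduct, hA, gram, Matrix.of_apply,
          Pi.zero_apply] at h3
        rw [map_sum, ← h3]
        refine Finset.sum_congr rfl fun k _ => ?_
        rw [map_smul, smul_eq_mul, mul_comm]
      generalize hs : ∑ k, c k • ((v k : L) : V) = s at h2 ⊢
      nth_rewrite 1 [← hs]
      rw [map_sum, LinearMap.sum_apply]
      exact Finset.sum_eq_zero fun i _ => by rw [map_smul, LinearMap.smul_apply, h2, smul_zero]
    have h2 : ∑ i, c i • ((v i : L) : V) = 0 := by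
      by_contra h
      exact (hpos _ h).ne' h1
    funext i
    exact Fintype.linearIndependent_iff.1 hli c h2 i
  intro y hy hyp
  choose m hm using fun i => hyp (v i) (v i).2
  choose T hT using hv.1
  set c := v.repr ⟨y, hy⟩ with hc
  have hyc : (y : V) = ∑ i, (c i : ℚ) • ((v i : L) : V) := by
    have : (y : V) = ((∑ i, c i • v i : L) : V) := by rw [hc, v.sum_repr]
    rw [this]; push_cast
    simp only [Int.cast_smul_eq_zsmul]
  have hAc : A.mulVec (fun i => (c i : ℚ)) = fun i => (p : ℚ) * m i := by
    funext i
    rw [← hm i]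
    have h1 : B y ((v i : L) : V) = B ((v i : L) : V) y := hB.eq _ _
    rw [h1, hyc, map_sum]
    simp only [Matrix.mulVec, dotProduct, hA, gram, Matrix.of_apply, map_smul, smul_eq_mul]
    exact Finset.sum_congr rfl fun k _ => mul_comm _ _
  -- N c = (N A⁻¹)(A c), where N A⁻¹ = T is integral and A c = p m. As p ∤ N, every coordinate of y
  -- is divisible by p.
  have hNc : ∀ i, (N : ℤ) * c i = p * ∑ k, T i k * m k := by
    intro i
    have h1 : (((N : ℚ) • A⁻¹).mulVec (A.mulVec fun i => (c i : ℚ))) i = N * c i := by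
      rw [Matrix.smul_mulVec, Matrix.mulVec_mulVec,
        Matrix.nonsing_inv_mul _ ((Matrix.isUnit_iff_isUnit_det A).1 hdet), Matrix.one_mulVec]
      simp
    rw [hAc] at h1
    simp only [Matrix.mulVec, dotProduct, hT] at h1
    have h2 : (((N : ℤ) * c i : ℤ) : ℚ) = ((p * ∑ k, T i k * m k : ℤ) : ℚ) := by
      push_cast
      rw [← h1, Finset.mul_sum]
      exact Finset.sum_congr rfl fun k _ => by ring
    exact_mod_cast h2
  have hdvd : ∀ i, (p : ℤ) ∣ c i := by
    intro i
    have h1 : (p : ℤ) ∣ N * c i := ⟨_, hNc i⟩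
    refine ((Nat.prime_iff_prime_int.1 hp).dvd_or_dvd h1).resolve_left ?_
    exact_mod_cast hlevel
  choose d hd using hdvd
  refine ⟨∑ i, (d i : ℚ) • ((v i : L) : V),
    Submodule.sum_mem _ fun i _ => intCast_smul_mem L _ (v i).2, ?_⟩
  rw [hyc, Finset.smul_sum]
  refine Finset.sum_congr rfl fun i _ => ?_
  rw [smul_smul, hd i]; push_cast; rfl

end

end SiegelTheta

/-! ### Genera, reflections and chains of neighbours -/

namespace SiegelTheta

open Module

noncomputable section

variable {V : Type*} [AddCommGroup V] [Module ℚ V]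

theorem InGenus.refl (B : LinearMap.BilinForm ℚ V) (L : Submodule ℤ V) : InGenus B L L :=
  fun _ _ => ⟨LinearEquiv.refl _ _, fun _ _ => rfl, Set.image_id _⟩

theorem InGenus.trans {B : LinearMap.BilinForm ℚ V} {L K M : Submodule ℤ V}
    (h₁ : InGenus B L K) (h₂ : InGenus B K M) : InGenus B L M := by
  intro q hq
  obtain ⟨σ, hσ, hσ'⟩ := h₁ q
  obtain ⟨ρ, hρ, hρ'⟩ := h₂ q
  refine ⟨ρ.trans σ, fun x y => ?_, ?_⟩
  · rw [LinearEquiv.trans_apply, LinearEquiv.trans_apply, hσ, hρ]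
  · rw [← hσ', ← hρ', Set.image_image]; rfl

theorem isUnit_intCast_padicInt {q : ℕ} [Fact q.Prime] {d : ℤ} (hd : ¬ (q : ℤ) ∣ d) :
    IsUnit (d : ℤ_[q]) := by
  rw [PadicInt.isUnit_iff]
  refine le_antisymm (PadicInt.norm_le_one _) (not_lt.1 fun h => hd ?_)
  exact (PadicInt.norm_int_lt_one_iff_dvd d).1 h

/-- Denominators prime to q are units of ℤ_q. -/
theorem localization_mono {q : ℕ} [Fact q.Prime] {K M : Submodule ℤ V}
    (h : ∀ x ∈ K, ∃ d : ℤ, ¬ (q : ℤ) ∣ d ∧ (d : ℚ) • x ∈ M) :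
    localization q K ≤ localization q M := by
  unfold localization
  rw [Submodule.span_le]
  rintro _ ⟨x, hx, rfl⟩
  obtain ⟨d, hd, hdx⟩ := h x hx
  obtain ⟨u, hu⟩ := isUnit_intCast_padicInt hd
  have h1 : (1 : ℚ_[q]) ⊗ₜ[ℚ] x =
      (u⁻¹ : ℤ_[q]ˣ).val • ((1 : ℚ_[q]) ⊗ₜ[ℚ] ((d : ℚ) • x)) := by
    have h2 : (1 : ℚ_[q]) ⊗ₜ[ℚ] ((d : ℚ) • x) = (d : ℤ_[q]) • ((1 : ℚ_[q]) ⊗ₜ[ℚ] x) := by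
      rw [Int.cast_smul_eq_zsmul, Int.cast_smul_eq_zsmul]
      exact map_zsmul (TensorProduct.mk ℚ ℚ_[q] V 1) d x
    rw [h2, smul_smul, ← hu, Units.inv_mul, one_smul]
  rw [SetLike.mem_coe]
  simp only
  rw [h1]
  exact Submodule.smul_mem _ _ (Submodule.subset_span ⟨_, hdx, rfl⟩)

theorem localization_map {q : ℕ} [Fact q.Prime] (s : V ≃ₗ[ℚ] V) (K : Submodule ℤ V) :
    (s.baseChange ℚ ℚ_[q] V V) '' (localization q K : Set (ℚ_[q] ⊗[ℚ] V)) =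
      localization q (K.map (s.toLinearMap.restrictScalars ℤ)) := by
  have h : (localization q K).map ((s.baseChange ℚ ℚ_[q] V V).toLinearMap.restrictScalars ℤ_[q]) =
      localization q (K.map (s.toLinearMap.restrictScalars ℤ)) := by
    unfold localization
    rw [Submodule.map_span]
    congr 1
    ext z
    constructor
    · rintro ⟨_, ⟨x, hx, rfl⟩, rfl⟩
      exact ⟨s x, ⟨x, hx, rfl⟩, by simp⟩
    · rintro ⟨_, ⟨x, hx, rfl⟩, rfl⟩
      exact ⟨_, ⟨x, hx, rfl⟩, by simp⟩
  rw [← h]; rfl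

theorem baseChange_isometry {q : ℕ} [Fact q.Prime] {B : LinearMap.BilinForm ℚ V} (s : V ≃ₗ[ℚ] V)
    (hs : ∀ x y, B (s x) (s y) = B x y) (x y : ℚ_[q] ⊗[ℚ] V) :
    LinearMap.BilinForm.baseChange ℚ_[q] B (s.baseChange ℚ ℚ_[q] V V x)
      (s.baseChange ℚ ℚ_[q] V V y) = LinearMap.BilinForm.baseChange ℚ_[q] B x y := by
  induction x with
  | zero => simp
  | add x x' hx hx' => simp only [map_add, LinearMap.add_apply, hx, hx']
  | tmul a v =>
    induction y with
    | zero => simp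
    | add y y' hy hy' => simp only [map_add, hy, hy']
    | tmul b w => simp [LinearMap.BilinForm.baseChange_tmul, hs]

/-- The reflection in `v`. -/
def reflectionOf (B : LinearMap.BilinForm ℚ V) (v : V) (h : ℚ) (hv : B v v = 2 * h) (h0 : h ≠ 0) :
    V ≃ₗ[ℚ] V :=
  LinearEquiv.ofInvolutive (LinearMap.id - (h⁻¹ • LinearMap.flip B v).smulRight v) (by
    intro y
    simp only [LinearMap.sub_apply, LinearMap.id_apply, LinearMap.smulRight_apply,
      LinearMap.smul_apply, LinearMap.flip_apply, map_sub, map_smul, hv, smul_eq_mul]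
    have : h⁻¹ * (2 * h) = 2 := by field_simp
    rw [this]
    module)

theorem reflectionOf_apply (B : LinearMap.BilinForm ℚ V) (v : V) (h : ℚ) (hv : B v v = 2 * h)
    (h0 : h ≠ 0) (y : V) : reflectionOf B v h hv h0 y = y - (h⁻¹ * B y v) • v := by
  change (LinearMap.id - (h⁻¹ • LinearMap.flip B v).smulRight v : V →ₗ[ℚ] V) y = _
  simp

theorem reflectionOf_isometry {B : LinearMap.BilinForm ℚ V} (hB : B.IsSymm) (v : V) (h : ℚ)
    (hv : B v v = 2 * h) (h0 : h ≠ 0) (x y : V) :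
    B (reflectionOf B v h hv h0 x) (reflectionOf B v h hv h0 y) = B x y := by
  have hs : B v y = B y v := hB.eq _ _
  simp only [reflectionOf_apply, map_sub, LinearMap.sub_apply, map_smul, LinearMap.smul_apply,
    smul_eq_mul, hv, hs]
  field_simp
  ring

/-- At q ≠ p the two localizations coincide, since p is a unit there; only the prime p needs an
isometry. -/
theorem inGenus_of_smul_mem {B : LinearMap.BilinForm ℚ V} {L K : Submodule ℤ V} {p : ℕ}
    (hp : p.Prime) (h₁ : ∀ x ∈ K, (p : ℚ) • x ∈ L) (h₂ : ∀ x ∈ L, (p : ℚ) • x ∈ K)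
    (hloc : ∀ _ : Fact p.Prime, ∃ σ : (ℚ_[p] ⊗[ℚ] V) ≃ₗ[ℚ_[p]] (ℚ_[p] ⊗[ℚ] V),
      (∀ x y, LinearMap.BilinForm.baseChange ℚ_[p] B (σ x) (σ y) =
        LinearMap.BilinForm.baseChange ℚ_[p] B x y) ∧
      σ '' (localization p K : Set (ℚ_[p] ⊗[ℚ] V)) = localization p L) : InGenus B L K := by
  intro q hq
  by_cases hqp : q = p
  · subst hqp
    exact hloc hq
  · have hd : ¬ (q : ℤ) ∣ (p : ℤ) := by
      intro h
      exact hqp ((Nat.prime_dvd_prime_iff_eq hq.out hp).1 (by exact_mod_cast h))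
    refine ⟨LinearEquiv.refl _ _, fun _ _ => rfl, ?_⟩
    have : localization q K = localization q L :=
      le_antisymm (localization_mono fun x hx => ⟨p, hd, by exact_mod_cast h₁ x hx⟩)
        (localization_mono fun x hx => ⟨p, hd, by exact_mod_cast h₂ x hx⟩)
    rw [this]; exact Set.image_id _

/-- The neighbour `{y ∈ L : B(y,x) ∈ ℤ} + ℤx` of `L`. -/
def adjoin (B : LinearMap.BilinForm ℚ V) (L : Submodule ℤ V) (x : V) : Submodule ℤ V where
  carrier := {y | ∃ l ∈ L, ∃ a m : ℤ, B l x = m ∧ y = l + (a : ℚ) • x}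
  add_mem' := by
    rintro _ _ ⟨l, hl, a, m, hm, rfl⟩ ⟨l', hl', a', m', hm', rfl⟩
    refine ⟨l + l', L.add_mem hl hl', a + a', m + m', ?_, ?_⟩
    · rw [map_add, LinearMap.add_apply, hm, hm']; push_cast; rfl
    · push_cast; rw [add_smul]; abel
  zero_mem' := ⟨0, L.zero_mem, 0, 0, by simp, by simp⟩
  smul_mem' := by
    rintro n _ ⟨l, hl, a, m, hm, rfl⟩
    refine ⟨n • l, L.smul_mem n hl, n * a, n * m, ?_, ?_⟩
    · rw [bilin_zsmul_left, hm]; push_cast; rfl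
    · rw [smul_add, ← Int.cast_smul_eq_zsmul ℚ n ((a : ℚ) • x), smul_smul]; push_cast; rfl

section neighbour

variable {B : LinearMap.BilinForm ℚ V} {L : Submodule ℤ V} {x : V}

theorem mem_adjoin_self : x ∈ adjoin B L x :=
  ⟨0, L.zero_mem, 1, 0, by simp, by simp⟩

theorem mem_adjoin_of_mem {y : V} (hy : y ∈ L) {m : ℤ} (hm : B y x = m) : y ∈ adjoin B L x :=
  ⟨y, hy, 0, m, hm, by simp⟩

theorem adjoin_even (hB : B.IsSymm) (hL : IsEvenIntegral B L) {a : ℤ} (ha : B x x = 2 * a) :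
    IsEvenIntegral B (adjoin B L x) := by
  rintro _ ⟨l, hl, t, m, hm, rfl⟩
  obtain ⟨c, hc⟩ := hL l hl
  have hs : B x l = B l x := hB.eq _ _
  refine ⟨c + t * m + t * t * a, ?_⟩
  simp only [map_add, LinearMap.add_apply, map_smul, LinearMap.smul_apply, smul_eq_mul, hs, hm, hc,
    ha]
  push_cast; ring

/-- In a lattice unimodular at `p`, an element `x` of `(1/p)L` outside `L` pairs to `1/p`. -/
theorem exists_pairing {p : ℕ} (hp : p.Prime) (hB : B.IsSymm) (hL : IsEvenIntegral B L)
    (hu : PUnimodular p B L) (hpx : (p : ℚ) • x ∈ L) (hx : x ∉ L) :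
    ∃ w ∈ L, ∃ t : ℤ, p * B x w = 1 + p * t := by
  have hp0 : (p : ℚ) ≠ 0 := by exact_mod_cast hp.ne_zero
  have h1 : ∃ w ∈ L, ¬ ∃ m : ℤ, B ((p : ℚ) • x) w = p * m := by
    by_contra h
    push Not at h
    obtain ⟨z, hz, hxz⟩ := hu _ hpx fun w hw => by
      obtain ⟨m, hm⟩ := not_forall_not.1 fun hh => (h w hw).elim hh
      exact ⟨m, hm⟩
    have : x = z := by
      have := congrArg (fun y => (p : ℚ)⁻¹ • y) hxz
      simpa [smul_smul, hp0] using this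
    exact hx (this ▸ hz)
  obtain ⟨w, hw, hw'⟩ := h1
  obtain ⟨m, hm⟩ := hL.integral hB hpx hw
  have hcop : IsCoprime (m : ℤ) (p : ℤ) := by
    refine ((Nat.prime_iff_prime_int.1 hp).coprime_iff_not_dvd.2 ?_).symm
    rintro ⟨c, rfl⟩
    exact hw' ⟨c, by rw [hm]; push_cast; rfl⟩
  obtain ⟨u, v, huv⟩ := hcop
  refine ⟨(u : ℚ) • w, intCast_smul_mem L u hw, -v, ?_⟩
  rw [map_smul, LinearMap.smul_apply, smul_eq_mul] at hm
  rw [map_smul, smul_eq_mul]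
  have : (u : ℚ) * m + v * p = 1 := by exact_mod_cast huv
  push_cast
  linear_combination (u : ℚ) * hm + this

/-- Pairing y with pw, where w ∈ L and B(x, w) ≡ 1/p mod ℤ, shows that y ∈ L. With μ = B(y, w), the
vector y − μpx pairs with all of L into pℤ, because every u ∈ L differs by a multiple of w from a
vector of L that pairs integrally with x. Unimodularity of L then gives y = p(z + μx). -/
theorem adjoin_pUnimodular {p : ℕ} (hp : p.Prime) (hB : B.IsSymm) (hL : IsEvenIntegral B L)
    (hu : PUnimodular p B L) (hpx : (p : ℚ) • x ∈ L) (hx : x ∉ L) {a : ℤ} (ha : B x x = 2 * a) :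
    PUnimodular p B (adjoin B L x) := by
  have hp0 : (p : ℚ) ≠ 0 := by exact_mod_cast hp.ne_zero
  obtain ⟨w, hw, t, hwt⟩ := exists_pairing hp hB hL hu hpx hx
  have hsymm : ∀ y z, B y z = B z y := fun y z => hB.eq y z
  rintro y hyL hy
  have hyL' := hyL
  obtain ⟨y₀, hy₀, a₀, m₀, hm₀, rfl⟩ := hyL
  have hpwL : (p : ℚ) • w ∈ adjoin B L x :=
    mem_adjoin_of_mem (natCast_smul_mem L p hw) (m := 1 + p * t) (by
      rw [map_smul, LinearMap.smul_apply, smul_eq_mul, hsymm, hwt]; push_cast; rfl)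
  have hdvd : (p : ℤ) ∣ a₀ := by
    obtain ⟨m₁, hm₁⟩ := hy _ hpwL
    obtain ⟨c, hc⟩ := hL.integral hB hy₀ hw
    rw [map_smul, map_add, LinearMap.add_apply, map_smul, LinearMap.smul_apply, smul_eq_mul,
      smul_eq_mul, hc] at hm₁
    refine ⟨m₁ - c - a₀ * t, ?_⟩
    have : (a₀ : ℚ) = p * (m₁ - c - a₀ * t) := by linear_combination hm₁ - a₀ * hwt
    exact_mod_cast this
  obtain ⟨a', rfl⟩ := hdvd
  set y : V := y₀ + ((p * a' : ℤ) : ℚ) • x with hydef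
  have hyL : y ∈ L := by
    rw [hydef]
    push_cast
    rw [mul_comm, mul_smul]
    exact L.add_mem hy₀ (intCast_smul_mem L a' hpx)
  obtain ⟨μ, hμ⟩ := hL.integral hB hyL hw
  obtain ⟨z, hz, hyz⟩ := hu (y - ((μ : ℚ) • ((p : ℚ) • x)))
    (L.sub_mem hyL (intCast_smul_mem L μ hpx)) (by
      intro u hu'
      obtain ⟨α, hα⟩ := hL.integral hB hpx hu'
      rw [map_smul, LinearMap.smul_apply, smul_eq_mul] at hα
      have hl : B (u - (α : ℚ) • w) x = ((-(α * t) : ℤ) : ℚ) := by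
        rw [map_sub, LinearMap.sub_apply, map_smul, LinearMap.smul_apply, smul_eq_mul, hsymm u,
          hsymm w]
        push_cast
        apply mul_left_cancel₀ hp0
        linear_combination hα - α * hwt
      obtain ⟨m₂, hm₂⟩ := hy _ (mem_adjoin_of_mem (L.sub_mem hu' (intCast_smul_mem L α hw)) hl)
      rw [map_sub, map_smul, smul_eq_mul, hμ] at hm₂
      refine ⟨m₂, ?_⟩
      rw [map_sub, LinearMap.sub_apply, map_smul, LinearMap.smul_apply, map_smul,
        LinearMap.smul_apply, smul_eq_mul, smul_eq_mul, hα]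
      linear_combination hm₂)
  obtain ⟨m₂, hm₂⟩ := hy x mem_adjoin_self
  refine ⟨z + (μ : ℚ) • x, ⟨z, hz, μ, m₂ - μ * (2 * a), ?_, rfl⟩, ?_⟩
  · have := congrArg (fun u => B u x) hyz
    simp only [map_sub, LinearMap.sub_apply, map_smul, LinearMap.smul_apply, smul_eq_mul, hm₂,
      ha] at this
    push_cast
    apply mul_left_cancel₀ hp0
    linear_combination -this
  · rw [smul_add, ← hyz, smul_comm]; abel

/-- `L` and its neighbour are exchanged, at `p`, by a reflection. -/
theorem adjoin_inGenus {p : ℕ} (hp : p.Prime) (hB : B.IsSymm) (hL : IsEvenIntegral B L)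
    (hu : PUnimodular p B L) (hpx : (p : ℚ) • x ∈ L) (hx : x ∉ L) {a : ℤ} (ha : B x x = 2 * a) :
    InGenus B L (adjoin B L x) := by
  have hp0 : (p : ℚ) ≠ 0 := by exact_mod_cast hp.ne_zero
  obtain ⟨w, hw, t, hwt⟩ := exists_pairing hp hB hL hu hpx hx
  obtain ⟨c, hc⟩ := hL w hw
  have hsymm : ∀ y z, B y z = B z y := fun y z => hB.eq y z
  have hint : ∀ y ∈ L, ∃ α : ℤ, p * B y x = α := by
    intro y hy
    obtain ⟨α, hα⟩ := hL.integral hB hy hpx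
    exact ⟨α, by rw [← hα, map_smul, smul_eq_mul]⟩
  refine inGenus_of_smul_mem hp ?_ ?_ ?_
  · rintro _ ⟨l, hl, n, m, hm, rfl⟩
    rw [smul_add, smul_comm]
    exact L.add_mem (natCast_smul_mem L p hl) (intCast_smul_mem L n hpx)
  · intro y hy
    obtain ⟨α, hα⟩ := hint y hy
    exact mem_adjoin_of_mem (natCast_smul_mem L p hy)
      (by rw [map_smul, LinearMap.smul_apply, smul_eq_mul, hα])
  intro _
  -- For v = p(x + w) one has B(v, v) = 2pd with d ≡ 1 mod p, so d is a unit of ℤ_p. The reflection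
  -- in v is the required local isometry.
  set d : ℤ := p * a + (1 + p * t) + p * c with hd
  have hdp : ¬ (p : ℤ) ∣ d := by
    intro h
    have h1 : (p : ℤ) ∣ 1 := by
      have : (1 : ℤ) = d - p * (a + t + c) := by rw [hd]; ring
      rw [this]
      exact dvd_sub h (dvd_mul_right _ _)
    exact (Nat.prime_iff_prime_int.1 hp).not_isUnit (isUnit_of_dvd_one h1)
  have hd0 : (d : ℚ) ≠ 0 := by
    intro h
    apply hdp
    rw [show d = 0 by exact_mod_cast h]
    exact dvd_zero _
  set v : V := (p : ℚ) • (x + w) with hv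
  have hvL : v ∈ L := by
    rw [hv, smul_add]
    exact L.add_mem hpx (natCast_smul_mem L p hw)
  have hvv : B v v = 2 * (p * d) := by
    simp only [hv, map_smul, LinearMap.smul_apply, map_add, LinearMap.add_apply, smul_eq_mul,
      hsymm w x, ha, hc]
    rw [hd]
    push_cast
    linear_combination 2 * (p : ℚ) * hwt
  have hh0 : (p : ℚ) * d ≠ 0 := mul_ne_zero hp0 hd0
  let s := reflectionOf B v (p * d) hvv hh0
  have hs : ∀ y, (d : ℚ) • s y = (d : ℚ) • y - (B y x + B y w) • v := by
    intro y
    simp only [s, reflectionOf_apply]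
    rw [smul_sub, smul_smul, hv, map_smul, map_add, smul_eq_mul]
    congr 2
    field_simp
  -- Multiplying by d clears the denominators of the reflection other than p, and as a unit at p it
  -- does not affect the localizations.
  have h1 : ∀ y ∈ L, (d : ℚ) • s y ∈ adjoin B L x := by
    intro y hy
    obtain ⟨α, hα⟩ := hint y hy
    obtain ⟨β, hβ⟩ := hL.integral hB hy hw
    refine ⟨(d : ℚ) • y - ((α + p * β : ℤ) : ℚ) • w,
      L.sub_mem (intCast_smul_mem L d hy) (intCast_smul_mem L _ hw), -(α + p * β),
      α * (a + c) - β * (1 + p * t), ?_, ?_⟩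
    · rw [map_sub, LinearMap.sub_apply, map_smul, map_smul, LinearMap.smul_apply,
        LinearMap.smul_apply, smul_eq_mul, smul_eq_mul, hsymm w x]
      apply mul_left_cancel₀ hp0
      rw [hd]
      push_cast
      linear_combination ((p : ℚ) * a + (1 + p * t) + p * c) * hα - (α + p * β) * hwt
    · rw [hs, hv, smul_smul, hβ]
      have : (B y x + (β : ℚ)) * p = ((α + p * β : ℤ) : ℚ) := by
        push_cast; linear_combination hα
      rw [this, smul_add]
      push_cast
      rw [neg_smul]
      abel
  have h2 : ∀ y ∈ adjoin B L x, (d : ℚ) • s y ∈ L := by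
    rintro _ ⟨l, hl, n, m, hm, rfl⟩
    rw [map_add, smul_add]
    refine L.add_mem ?_ ?_
    · obtain ⟨β, hβ⟩ := hL.integral hB hl hw
      rw [hs, hm, hβ]
      have := L.sub_mem (intCast_smul_mem L d hl) (intCast_smul_mem L (m + β) hvL)
      exact_mod_cast this
    · rw [map_smul, smul_comm]
      refine intCast_smul_mem L n ?_
      have h3 : (d : ℚ) • s x = ((c - a : ℤ) : ℚ) • ((p : ℚ) • x) -
          ((2 * p * a + (1 + p * t) : ℤ) : ℚ) • w := by
        have h4 : (B x x + B x w) * p = ((2 * p * a + (1 + p * t) : ℤ) : ℚ) := by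
          rw [ha]; push_cast; linear_combination hwt
        rw [hs, hv, smul_smul, h4, smul_add, ← sub_sub, ← sub_smul, smul_smul]
        congr 2
        rw [hd]; push_cast; ring
      rw [h3]
      exact L.sub_mem (intCast_smul_mem L _ hpx) (intCast_smul_mem L _ hw)
  refine ⟨s.baseChange ℚ ℚ_[p] V V,
    baseChange_isometry s (reflectionOf_isometry hB v _ hvv hh0), ?_⟩
  rw [localization_map]
  congr 1
  refine le_antisymm (localization_mono ?_) (localization_mono ?_)
  · rintro _ ⟨y, hy, rfl⟩
    exact ⟨d, hdp, h2 y hy⟩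
  · intro y hy
    refine ⟨d, hdp, (d : ℚ) • s y, h1 y hy, ?_⟩
    have hss : s (s y) = y := by
      change (LinearEquiv.ofInvolutive _ _) ((LinearEquiv.ofInvolutive _ _) y) = y
      exact (LinearEquiv.ofInvolutive _ _).apply_symm_apply y
    change s ((d : ℚ) • s y) = _
    rw [map_smul, hss]

/-- Even lattices unimodular at `p` that agree outside `p` are in the same genus. -/
theorem inGenus_of_commensurable {p : ℕ} (hp : p.Prime) (hB : B.IsSymm) {K : Submodule ℤ V}
    (hK : IsEvenIntegral B K) (huK : PUnimodular p B K) (hfg : K.FG)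
    (hL : IsEvenIntegral B L) (hu : PUnimodular p B L)
    (hKL : ∃ N : ℕ, ∀ x ∈ K, ((p : ℚ) ^ N) • x ∈ L)
    (hLK : ∃ N : ℕ, ∀ x ∈ L, ((p : ℚ) ^ N) • x ∈ K) : InGenus B L K := by
  have hp0 : (p : ℚ) ≠ 0 := by exact_mod_cast hp.ne_zero
  have : Module.Finite ℤ K := Module.Finite.iff_fg.2 hfg
  -- Noetherian induction on L ∩ K as a submodule of K: replacing L by a neighbour through some x ∈
  -- K outside L enlarges this intersection strictly.
  suffices h : ∀ S : Submodule ℤ K, ∀ L : Submodule ℤ V, L.comap K.subtype = S →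
      IsEvenIntegral B L → PUnimodular p B L → (∃ N : ℕ, ∀ x ∈ K, ((p : ℚ) ^ N) • x ∈ L) →
      (∃ N : ℕ, ∀ x ∈ L, ((p : ℚ) ^ N) • x ∈ K) → InGenus B L K from
    h _ L rfl hL hu hKL hLK
  intro S
  induction S using IsNoetherian.induction with
  | hgt S ih =>
  rintro L rfl hL hu ⟨N, hN⟩ ⟨N', hN'⟩
  by_cases hle : K ≤ L
  -- If K ⊆ L, then p^(n+1) y with p^n y ∈ L pairs with K into pℤ, so unimodularity of K at p allows
  -- one factor p to be removed at a time.
  · have hle' : L ≤ K := by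
      have key : ∀ n : ℕ, ∀ y ∈ L, ((p : ℚ) ^ n) • y ∈ K → y ∈ K := by
        intro n
        induction n with
        | zero => intro y _ hy; simpa using hy
        | succ n ihn =>
          intro y hy hyK
          refine ihn y hy ?_
          have hy' : ((p : ℚ) ^ n) • y ∈ L := by
            have := natCast_smul_mem L (p ^ n) hy
            push_cast at this; exact this
          have hpy : (p : ℚ) • ((p : ℚ) ^ n • y) ∈ K := by
            rwa [smul_smul, ← pow_succ']
          obtain ⟨z, hz, hzy⟩ := huK _ hpy fun w hw => by
            obtain ⟨m, hm⟩ := hL.integral hB hy' (hle hw)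
            exact ⟨m, by rw [map_smul, LinearMap.smul_apply, hm, smul_eq_mul]⟩
          have h2 := congrArg (fun y => (p : ℚ)⁻¹ • y) hzy
          simp only [inv_smul_smul₀ hp0] at h2
          rw [h2]; exact hz
      exact fun y hy => key N' y hy (hN' y hy)
    rw [le_antisymm hle' hle]
    exact InGenus.refl B K
  · obtain ⟨x, hxK, hxL, hpx⟩ : ∃ x ∈ K, x ∉ L ∧ (p : ℚ) • x ∈ L := by
      obtain ⟨x, hxK, hxL⟩ := SetLike.not_le_iff_exists.1 hle
      by_contra hcon
      push Not at hcon
      have : ∀ n : ℕ, ((p : ℚ) ^ n) • x ∈ K ∧ ((p : ℚ) ^ n) • x ∉ L := by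
        intro n
        induction n with
        | zero => simpa using ⟨hxK, hxL⟩
        | succ n ihn =>
          rw [pow_succ', mul_smul]
          exact ⟨natCast_smul_mem K p ihn.1, hcon _ ihn.1 ihn.2⟩
      exact (this N).2 (hN x hxK)
    obtain ⟨a, ha⟩ := hK x hxK
    have hge : ∀ y ∈ K, y ∈ L → y ∈ adjoin B L x := by
      intro y hyK hyL
      obtain ⟨m, hm⟩ := hK.integral hB hyK hxK
      exact mem_adjoin_of_mem hyL hm
    refine (adjoin_inGenus hp hB hL hu hpx hxL ha).trans
      (ih ((adjoin B L x).comap K.subtype) ?_ _ rfl (adjoin_even hB hL ha)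
        (adjoin_pUnimodular hp hB hL hu hpx hxL ha) ⟨N + 1, ?_⟩ ⟨N' + 1, ?_⟩)
    · refine lt_of_le_of_ne (fun y hy => hge y y.2 hy) fun h => hxL ?_
      have : (⟨x, hxK⟩ : K) ∈ (adjoin B L x).comap K.subtype := mem_adjoin_self
      rw [← h] at this
      exact this
    · intro y hy
      rw [pow_succ', mul_smul]
      obtain ⟨m, hm⟩ := hL.integral hB (hN y hy) hpx
      refine mem_adjoin_of_mem (natCast_smul_mem L p (hN y hy)) (m := m) ?_
      rw [← hm]
      simp
    · rintro _ ⟨l, hl, n, m, hm, rfl⟩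
      rw [smul_add]
      refine K.add_mem ?_ ?_
      · rw [pow_succ', mul_smul]
        exact natCast_smul_mem K p (hN' l hl)
      · have := natCast_smul_mem K (p ^ (N' + 1)) (intCast_smul_mem K n hxK)
        push_cast at this; exact this

end neighbour

end

end SiegelTheta

/-! ### Evenness in the genus, invariant factors, and the images of pK and K ∩ L -/

/-! ### The lattices `K_j` -/

namespace SiegelTheta

open Module IsotropicCount

noncomputable section

variable {V : Type*} [AddCommGroup V] [Module ℚ V]

theorem exists_int_of_padic {r : ℚ} (h : ∀ (q : ℕ) [Fact q.Prime], ‖(r : ℚ_[q])‖ ≤ 1) :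
    ∃ m : ℤ, r = m := by
  have hden : r.den = 1 := by
    by_contra hne
    obtain ⟨q, hq, hqd⟩ := Nat.exists_prime_and_dvd hne
    have := Fact.mk hq
    have h1 := (Padic.norm_rat_le_one_iff_padicValuation_le_one q).1 (h q)
    exact (Rat.padicValuation_le_one_iff.1 h1) hqd
  exact ⟨r.num, (Rat.den_eq_one_iff r).1 hden |>.symm⟩

/-- A lattice in the genus of an even lattice is even. -/
theorem InGenus.isEvenIntegral {B : LinearMap.BilinForm ℚ V} {L K : Submodule ℤ V}
    (hB : B.IsSymm) (hL : IsEvenIntegral B L) (h : InGenus B L K) : IsEvenIntegral B K := by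
  intro x hx
  -- Evenness extends from L to ℤ_q L, the cross terms being handled by integrality, and is carried
  -- to K by the local isometry. Then ½B(x, x) is integral at every prime, hence an integer.
  have key : ∀ (q : ℕ) [Fact q.Prime], ‖((B x x / 2 : ℚ) : ℚ_[q])‖ ≤ 1 := by
    intro q hq
    obtain ⟨σ, hσ, hσ'⟩ := h q
    set β := LinearMap.BilinForm.baseChange ℚ_[q] B
    have hβ : ∀ v w : V, β (1 ⊗ₜ v) (1 ⊗ₜ w) = ((B v w : ℚ) : ℚ_[q]) := by
      intro v w
      simp [β, LinearMap.BilinForm.baseChange_tmul]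
    have hsm : ∀ (c : ℤ_[q]) (z : ℚ_[q] ⊗[ℚ] V), c • z = (c : ℚ_[q]) • z := fun c z => rfl
    have hint : ∀ z ∈ localization q L, ∀ w ∈ localization q L, ∃ c : ℤ_[q], β z w = c := by
      intro z hz w hw
      unfold localization at hz hw
      induction hz using Submodule.span_induction with
      | mem z hz =>
        obtain ⟨z, hz, rfl⟩ := hz
        induction hw using Submodule.span_induction with
        | mem w hw =>
          obtain ⟨w, hw, rfl⟩ := hw
          obtain ⟨m, hm⟩ := hL.integral hB hz hw
          exact ⟨m, by simp [hβ, hm]⟩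
        | zero => exact ⟨0, by simp⟩
        | add a b _ _ ha hb =>
          obtain ⟨c, hc⟩ := ha
          obtain ⟨d, hd⟩ := hb
          exact ⟨c + d, by rw [map_add, hc, hd]; push_cast; rfl⟩
        | smul r a _ ha =>
          obtain ⟨c, hc⟩ := ha
          exact ⟨r * c, by rw [hsm, map_smul, hc]; push_cast; rfl⟩
      | zero => exact ⟨0, by simp⟩
      | add a b _ _ ha hb =>
        obtain ⟨c, hc⟩ := ha
        obtain ⟨d, hd⟩ := hb
        exact ⟨c + d, by rw [map_add, LinearMap.add_apply, hc, hd]; push_cast; rfl⟩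
      | smul r a _ ha =>
        obtain ⟨c, hc⟩ := ha
        exact ⟨r * c, by rw [hsm, map_smul, LinearMap.smul_apply, hc]; push_cast; rfl⟩
    have hβs : ∀ z w, β z w = β w z := by
      intro z w
      exact (LinearMap.BilinForm.IsSymm.baseChange ℚ_[q]
        (LinearMap.BilinForm.isSymm_iff.1 hB)).eq z w
    have heven : ∀ z ∈ localization q L, ∃ c : ℤ_[q], β z z = 2 * c := by
      intro z hz
      have hz' := hz
      unfold localization at hz
      induction hz using Submodule.span_induction with
      | mem z hz =>
        obtain ⟨z, hz, rfl⟩ := hz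
        obtain ⟨m, hm⟩ := hL z hz
        exact ⟨m, by simp [hβ, hm]⟩
      | zero => exact ⟨0, by simp⟩
      | add a b ha' hb' ha hb =>
        obtain ⟨c, hc⟩ := ha ha'
        obtain ⟨d, hd⟩ := hb hb'
        obtain ⟨e, he⟩ := hint a ha' b hb'
        refine ⟨c + d + e, ?_⟩
        rw [map_add, map_add, LinearMap.add_apply, LinearMap.add_apply, hc, hd, hβs b a, he]
        push_cast; ring
      | smul r a ha' ha =>
        obtain ⟨c, hc⟩ := ha ha'
        refine ⟨r * r * c, ?_⟩
        rw [hsm, map_smul, map_smul, LinearMap.smul_apply, hc, smul_eq_mul, smul_eq_mul]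
        push_cast; ring
    have hmem : σ (1 ⊗ₜ x) ∈ localization q L := by
      have : σ (1 ⊗ₜ x) ∈ σ '' (localization q K : Set (ℚ_[q] ⊗[ℚ] V)) :=
        ⟨_, Submodule.subset_span ⟨x, hx, rfl⟩, rfl⟩
      rwa [hσ'] at this
    obtain ⟨c, hc⟩ := heven _ hmem
    rw [hσ, hβ] at hc
    have : ((B x x / 2 : ℚ) : ℚ_[q]) = c := by
      push_cast
      rw [hc]; field_simp
    rw [this]
    exact c.2
  obtain ⟨m, hm⟩ := exists_int_of_padic key
  exact ⟨m, by rw [← hm]; ring⟩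

/-- The image of a subgroup of `L` in `L / pL`. -/
def redImage (p : ℕ) (L : Submodule ℤ V) (S : Submodule ℤ L) : Submodule (ZMod p) (ModP p L) :=
  AddSubgroup.toZModSubmodule p (S.toAddSubgroup.map (red p L))

/-- The elements `y` of `L` with `p⁻¹ y ∈ K`. -/
def divisible (p : ℕ) (L K : Submodule ℤ V) : Submodule ℤ L :=
  K.comap ((((p : ℚ)⁻¹ • LinearMap.id : V →ₗ[ℚ] V).restrictScalars ℤ) ∘ₗ L.subtype)

theorem mem_divisible {p : ℕ} {L K : Submodule ℤ V} {y : L} :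
    y ∈ divisible p L K ↔ (p : ℚ)⁻¹ • (y : V) ∈ K := Iff.rfl

/-- The image of `pK` in `L / pL`. -/
def scaledImage (p : ℕ) (L K : Submodule ℤ V) : Submodule (ZMod p) (ModP p L) :=
  redImage p L (divisible p L K)

/-- The image of `K ∩ L` in `L / pL`. -/
def interImage (p : ℕ) (L K : Submodule ℤ V) : Submodule (ZMod p) (ModP p L) :=
  redImage p L (K.comap L.subtype)

theorem mem_scaledImage {p : ℕ} {L K : Submodule ℤ V} {w : ModP p L} :
    w ∈ scaledImage p L K ↔ ∃ y : L, (p : ℚ)⁻¹ • (y : V) ∈ K ∧ red p L y = w := Iff.rfl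

theorem mem_interImage {p : ℕ} {L K : Submodule ℤ V} {w : ModP p L} :
    w ∈ interImage p L K ↔ ∃ y : L, (y : V) ∈ K ∧ red p L y = w := Iff.rfl

/-- Modulo p, the image of S is spanned by the basis vectors with index in I, since the other
coordinates of its elements vanish. -/
theorem finrank_redImage {p : ℕ} (hp : p.Prime) {L : Submodule ℤ V} {ι : Type*} [Fintype ι]
    (v : Basis ι ℤ L) (S : Submodule ℤ L) (I : ι → Prop) (h₁ : ∀ i, I i → v i ∈ S)
    (h₂ : ∀ y ∈ S, ∀ i, ¬ I i → (p : ℤ) ∣ v.repr y i) :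
    finrank (ZMod p) (redImage p L S) = Nat.card {i // I i} := by
  classical
  have := Fact.mk hp
  obtain ⟨b, hb⟩ := exists_modP_basis (p := p) v
  have hsm : ∀ (n : ℤ) (x : L), ((n : ZMod p) • red p L x) = red p L (n • x) := by
    intro n x; rw [map_zsmul, Int.cast_smul_eq_zsmul]
  have : redImage p L S = Submodule.span (ZMod p) (Set.range fun i : {i // I i} => b i) := by
    refine le_antisymm ?_ ?_
    · rintro _ ⟨y, hy, rfl⟩
      rw [← v.sum_repr y, map_sum]
      refine Submodule.sum_mem _ fun i _ => ?_
      rw [← hsm]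
      by_cases hi : I i
      · exact Submodule.smul_mem _ _ (Submodule.subset_span ⟨⟨i, hi⟩, hb i⟩)
      · rw [(ZMod.intCast_zmod_eq_zero_iff_dvd _ p).2 (h₂ y hy i hi), zero_smul]
        exact Submodule.zero_mem _
    · rw [Submodule.span_le]
      rintro _ ⟨i, rfl⟩
      exact ⟨v i, h₁ i i.2, (hb i).symm⟩
  have hli : LinearIndependent (ZMod p) fun i : {i // I i} => b i :=
    b.linearIndependent.comp _ Subtype.val_injective
  rw [this, finrank_span_eq_card hli, Nat.card_eq_fintype_card]

theorem repr_eq_of_sum {ι : Type*} [Fintype ι] {L : Submodule ℤ V} (v : Basis ι ℤ L) (r : ι → ℚ)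
    {y : V} (hyL : y ∈ L) (h : y = ∑ i, r i • ((v i : L) : V)) (i : ι) :
    (v.repr ⟨y, hyL⟩ i : ℚ) = r i := by
  have hli : LinearIndependent ℚ fun i => ((v i : L) : V) :=
    (LinearIndependent.iff_fractionRing ℤ ℚ).1
      (v.linearIndependent.map' L.subtype (Submodule.ker_subtype L))
  have h1 : y = ∑ i, (v.repr ⟨y, hyL⟩ i : ℚ) • ((v i : L) : V) := by
    have : y = ((∑ i, v.repr ⟨y, hyL⟩ i • v i : L) : V) := by rw [v.sum_repr]
    nth_rewrite 1 [this]; push_cast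
    simp only [Int.cast_smul_eq_zsmul]
  have h2 : ∑ i, ((v.repr ⟨y, hyL⟩ i : ℚ) - r i) • ((v i : L) : V) = 0 := by
    simp only [sub_smul, Finset.sum_sub_distrib]
    rw [← h1, ← h, sub_self]
  exact sub_eq_zero.1 (Fintype.linearIndependent_iff.1 hli _ h2 i)

theorem mem_span_smul_basis {ι : Type*} [Fintype ι] {L : Submodule ℤ V} (v : Basis ι ℤ L)
    (a : ι → ℚ) {x : V} :
    x ∈ Submodule.span ℤ (Set.range fun i => a i • ((v i : L) : V)) ↔
      ∃ c : ι → ℤ, x = ∑ i, ((c i : ℚ) * a i) • ((v i : L) : V) := by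
  rw [Submodule.mem_span_range_iff_exists_fun]
  refine exists_congr fun c => ?_
  simp only [mul_smul, Int.cast_smul_eq_zsmul, eq_comm]

/-- The invariant factors of `K` in `L` if `pL ⊆ K ⊆ p⁻¹L`. -/
theorem IsInvariantFactors.finrank_images {p : ℕ} (hp : p.Prime) {L K : Submodule ℤ V} {r : ℕ}
    {a : Fin r → ℚ} (h₁ : ∀ x ∈ L, (p : ℚ) • x ∈ K) (h₂ : ∀ x ∈ K, (p : ℚ) • x ∈ L)
    (h : IsInvariantFactors L K a) :
    finrank (ZMod p) (scaledImage p L K) = Nat.card {i // a i = 1 / (p : ℚ)} ∧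
      finrank (ZMod p) (interImage p L K) + Nat.card {i // a i = (p : ℚ)} = r := by
  have hp0 : (p : ℚ) ≠ 0 := by exact_mod_cast hp.ne_zero
  obtain ⟨hpos, -, v, rfl⟩ := h
  have hmem : ∀ i, a i • ((v i : L) : V) ∈
      Submodule.span ℤ (Set.range fun i => a i • ((v i : L) : V)) :=
    fun i => Submodule.subset_span ⟨i, rfl⟩
  -- From K ⊆ p⁻¹L and pL ⊆ K, the number p·a i is a positive integer dividing p².
  have hval : ∀ i, a i = 1 / p ∨ a i = 1 ∨ a i = p := by
    intro i
    have hn := repr_eq_of_sum v (Pi.single i (p * a i)) (h₂ _ (hmem i)) (by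
      rw [Finset.sum_eq_single i] <;> simp +contextual [mul_smul]) i
    obtain ⟨c, hc⟩ := (mem_span_smul_basis v a).1 (h₁ _ (v i).2)
    have hc' := repr_eq_of_sum v _ (natCast_smul_mem L p (v i).2) hc i
    rw [show (⟨(p : ℚ) • ((v i : L) : V), natCast_smul_mem L p (v i).2⟩ : L) = (p : ℤ) • v i from
      Subtype.ext (by rw [Submodule.coe_smul, ← Int.cast_smul_eq_zsmul ℚ]; simp)] at hc'
    simp only [map_smul, Finsupp.smul_apply, Basis.repr_self, Finsupp.single_eq_same,
      smul_eq_mul, mul_one, Int.cast_natCast] at hc'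
    rw [Pi.single_eq_same] at hn
    set n := v.repr ⟨_, h₂ _ (hmem i)⟩ i
    have hnpos : 0 < n := by
      have : (0 : ℚ) < n := by
        rw [hn]; exact mul_pos (by exact_mod_cast hp.pos) (hpos i)
      exact_mod_cast this
    have hdvd : n ∣ (p : ℤ) ^ 2 := by
      refine ⟨c i, ?_⟩
      have : ((p : ℤ) ^ 2 : ℚ) = n * c i := by
        rw [hn, pow_two]; push_cast; nth_rewrite 2 [hc']; ring
      exact_mod_cast this
    lift n to ℕ using hnpos.le with n' hn'
    have hdvd' : n' ∣ p ^ 2 := by exact_mod_cast hdvd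
    obtain ⟨t, ht, rfl⟩ := (Nat.dvd_prime_pow hp).1 hdvd'
    have e : a i = (p : ℚ) ^ t / p := by
      rw [eq_div_iff hp0, mul_comm, ← hn]; push_cast; rfl
    interval_cases t
    · left; simpa using e
    · right; left; rw [e]; field_simp
    · right; right; rw [e]; field_simp
  have hp1 : (1 : ℚ) < p := by exact_mod_cast hp.one_lt
  have hpp : (p : ℚ) ≠ 1 / p := by
    intro h
    rw [eq_div_iff hp0] at h
    nlinarith
  constructor
  · refine finrank_redImage hp v _ _ ?_ ?_
    · intro i hi
      rw [mem_divisible, ← one_div, ← hi]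
      exact hmem i
    · intro y hy i hi
      rw [mem_divisible] at hy
      obtain ⟨c, hc⟩ := (mem_span_smul_basis v a).1 hy
      have := repr_eq_of_sum v (fun i => p * (c i * a i)) y.2 (by
        simp only [mul_smul (p : ℚ)]
        rw [← Finset.smul_sum, ← hc, smul_smul, mul_inv_cancel₀ hp0, one_smul]) i
      rcases (hval i).resolve_left hi with h1 | h1
      · refine ⟨c i, ?_⟩
        rw [h1, mul_one] at this
        exact_mod_cast this
      · refine ⟨c i * p, ?_⟩
        rw [h1] at this
        exact_mod_cast this
  · have h3 : finrank (ZMod p) (interImage p L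
        (Submodule.span ℤ (Set.range fun i => a i • ((v i : L) : V)))) =
        Nat.card {i // ¬ a i = p} := by
      refine finrank_redImage hp v _ _ ?_ ?_
      · intro i hi
        change ((v i : L) : V) ∈ Submodule.span ℤ (Set.range fun i => a i • ((v i : L) : V))
        rcases hval i with h1 | h1 | h1
        · have := Submodule.smul_mem _ (p : ℤ) (hmem i)
          rw [h1, ← Int.cast_smul_eq_zsmul ℚ, smul_smul] at this
          simpa [hp0] using this
        · simpa [h1] using hmem i
        · exact absurd h1 hi
      · intro y hy i hi
        change (y : V) ∈ Submodule.span ℤ (Set.range fun i => a i • ((v i : L) : V)) at hy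
        obtain ⟨c, hc⟩ := (mem_span_smul_basis v a).1 hy
        have := repr_eq_of_sum v _ y.2 hc i
        rw [not_not.1 hi] at this
        refine ⟨c i, ?_⟩
        rw [mul_comm]
        exact_mod_cast this
    rw [h3]
    classical
    rw [Nat.card_eq_fintype_card, Nat.card_eq_fintype_card, add_comm,
      Fintype.card_subtype_compl]
    have := Fintype.card_subtype_le (fun i => a i = (p : ℚ))
    rw [Fintype.card_fin] at *
    omega

/-- Smith normal form of pK inside L. Since p²L ⊆ pK, the elementary divisors divide p²; they are
normalised in sign, sorted by exponent for the divisibility chain, and divided by p. -/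
theorem exists_invariantFactors {p : ℕ} (hp : p.Prime) {L K : Submodule ℤ V} {r : ℕ}
    (b : Basis (Fin r) ℤ L) (h₁ : ∀ x ∈ L, (p : ℚ) • x ∈ K) (h₂ : ∀ x ∈ K, (p : ℚ) • x ∈ L) :
    ∃ a : Fin r → ℚ, IsInvariantFactors L K a := by
  have hp0 : (p : ℚ) ≠ 0 := by exact_mod_cast hp.ne_zero
  have := Module.Free.of_basis b
  have := Module.Finite.of_basis b
  have hSp : ∀ y : L, ((p : ℤ) ^ 2) • y ∈ divisible p L K := by
    intro y
    rw [mem_divisible, Submodule.coe_smul, ← Int.cast_smul_eq_zsmul ℚ, smul_smul]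
    have : (p : ℚ)⁻¹ * (((p : ℤ) ^ 2 : ℤ) : ℚ) = p := by push_cast; field_simp
    rw [this]
    exact h₁ _ y.2
  have hrk : finrank ℤ (divisible p L K) = finrank ℤ L := by
    refine le_antisymm (Submodule.finrank_le _) ?_
    have hinj : Function.Injective ((LinearMap.lsmul ℤ L ((p : ℤ) ^ 2)).codRestrict
        (divisible p L K) hSp) := by
      intro x y hxy
      have h3 : ((p : ℤ) ^ 2) • x = ((p : ℤ) ^ 2) • y := congrArg Subtype.val hxy
      exact smul_right_injective L (pow_ne_zero 2 (by exact_mod_cast hp.ne_zero)) h3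
    exact LinearMap.finrank_le_finrank_of_injective hinj
  obtain ⟨b', a, ab', hab⟩ := Submodule.exists_smith_normal_form_of_rank_eq b hrk
  have hdvd : ∀ i, ∃ t ≤ 2, (a i).natAbs = p ^ t := by
    intro i
    have h3 : a i ∣ (p : ℤ) ^ 2 := by
      have h4 := ab'.sum_repr ⟨((p : ℤ) ^ 2) • b' i, hSp _⟩
      have h5 := congrArg (fun z : divisible p L K => b'.repr (z : L) i) h4
      simp only [Submodule.coe_sum, Submodule.coe_smul, hab, map_sum, map_smul,
        Finsupp.coe_finsetSum, Finset.sum_apply, Finsupp.smul_apply, Basis.repr_self,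
        smul_eq_mul, Finsupp.single_eq_same, mul_one] at h5
      rw [Finset.sum_eq_single i (fun j _ hj => by simp [Finsupp.single_eq_of_ne, hj.symm])
        (by simp)] at h5
      rw [Finsupp.single_eq_same, mul_one] at h5
      exact ⟨_, by rw [← h5, mul_comm]⟩
    have h4 : (a i).natAbs ∣ p ^ 2 := by
      have := Int.natAbs_dvd_natAbs.2 h3
      rwa [Int.natAbs_pow, Int.natAbs_natCast] at this
    exact (Nat.dvd_prime_pow hp).1 h4
  choose t ht2 ht using hdvd
  set σ := Tuple.sort t
  have hmono : Monotone (t ∘ σ) := Tuple.monotone_sort t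
  refine ⟨fun i => (p : ℚ) ^ (t (σ i)) / p, ?_, ?_, b'.reindex σ.symm, ?_⟩
  · intro i
    have : (0 : ℚ) < p := by exact_mod_cast hp.pos
    positivity
  · intro i i' hii
    have h3 : t (σ i) ≤ t (σ i') := hmono hii
    refine ⟨(p : ℤ) ^ (t (σ i') - t (σ i)), ?_⟩
    push_cast
    rw [← mul_div_assoc, ← pow_add, Nat.sub_add_cancel h3]
  · have hreidx : (Set.range fun i => ((p : ℚ) ^ (t (σ i)) / p) •
        (((b'.reindex σ.symm) i : L) : V)) =
        Set.range fun i => ((p : ℚ) ^ (t i) / p) • ((b' i : L) : V) := by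
      ext x
      constructor
      · rintro ⟨i, rfl⟩
        exact ⟨σ i, by simp⟩
      · rintro ⟨i, rfl⟩
        exact ⟨σ.symm i, by simp⟩
    rw [hreidx]
    have hsgn : ∀ i, ∃ s : ℤ, a i = s * (p : ℤ) ^ t i ∧ s * s = 1 := by
      intro i
      have h3 := ht i
      rcases Int.natAbs_eq (a i) with h4 | h4
      · exact ⟨1, by rw [h4, h3]; push_cast; ring, by norm_num⟩
      · exact ⟨-1, by rw [h4, h3]; push_cast; ring, by norm_num⟩
    have hgen : ∀ i, (p : ℚ)⁻¹ • (((ab' i : divisible p L K) : L) : V) ∈ K := fun i => (ab' i).2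
    refine le_antisymm ?_ ?_
    · intro x hx
      have hxS : (⟨(p : ℚ) • x, h₂ x hx⟩ : L) ∈ divisible p L K := by
        rw [mem_divisible, smul_smul, inv_mul_cancel₀ hp0, one_smul]
        exact hx
      have h4 := congrArg (fun z : divisible p L K => (p : ℚ)⁻¹ • ((z : L) : V))
        (ab'.sum_repr ⟨_, hxS⟩)
      simp only [Submodule.coe_sum, Submodule.coe_smul, hab, smul_smul,
        inv_mul_cancel₀ hp0, one_smul] at h4
      rw [← h4, Finset.smul_sum]
      refine Submodule.sum_mem _ fun i _ => ?_
      obtain ⟨s, hs, -⟩ := hsgn i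
      have : (p : ℚ)⁻¹ • (((ab'.repr ⟨_, hxS⟩ i * a i : ℤ)) • ((b' i : L) : V)) =
          (ab'.repr ⟨_, hxS⟩ i * s : ℤ) • (((p : ℚ) ^ (t i) / p) • ((b' i : L) : V)) := by
        rw [← Int.cast_smul_eq_zsmul ℚ, ← Int.cast_smul_eq_zsmul ℚ, smul_smul, smul_smul, hs]
        congr 1
        push_cast; ring
      rw [this]
      exact Submodule.smul_mem _ _ (Submodule.subset_span ⟨i, rfl⟩)
    · rw [Submodule.span_le]
      rintro _ ⟨i, rfl⟩
      obtain ⟨s, hs, hss⟩ := hsgn i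
      have h4 := K.smul_mem s (hgen i)
      rw [hab] at h4
      have : s • (p : ℚ)⁻¹ • ((a i • b' i : L) : V) = ((p : ℚ) ^ (t i) / p) • ((b' i : L) : V) := by
        rw [Submodule.coe_smul, ← Int.cast_smul_eq_zsmul ℚ, ← Int.cast_smul_eq_zsmul ℚ, smul_smul,
          smul_smul, hs]
        congr 1
        have : (s : ℚ) * s = 1 := by exact_mod_cast hss
        push_cast
        calc (s : ℚ) * (p : ℚ)⁻¹ * (s * p ^ t i) = (s * s) * (p ^ t i / p) := by ring
          _ = _ := by rw [this, one_mul]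
      rw [this] at h4
      exact h4

section images

variable {p : ℕ} {B : LinearMap.BilinForm ℚ V} {L K : Submodule ℤ V}
  {q : QuadraticForm (ZMod p) (ModP p L)}

theorem polar_red_eq_zero_iff (hq : IsModPForm p B L q) (hB : B.IsSymm) (hL : IsEvenIntegral B L)
    (x y : L) : QuadraticMap.polar q (red p L x) (red p L y) = 0 ↔
      ∃ m : ℤ, B (x : V) (y : V) = p * m := by
  obtain ⟨m, hm⟩ := hL.integral hB x.2 y.2
  rw [hq.polar_red x y m hm, ZMod.intCast_zmod_eq_zero_iff_dvd, hm]
  exact exists_congr fun c => by exact_mod_cast Iff.rfl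

/-- For p⁻¹y ∈ K the half-norm of y is p² times that of p⁻¹y, which is an integer. -/
theorem scaledImage_totIso [Fact p.Prime] (hq : IsModPForm p B L q)
    (hK : IsEvenIntegral B K) : TotIso q (scaledImage p L K) := by
  have hp0 : (p : ℚ) ≠ 0 := by exact_mod_cast (Fact.out : p.Prime).ne_zero
  intro w hw
  obtain ⟨y, hy, rfl⟩ := mem_scaledImage.1 hw
  obtain ⟨m, hm⟩ := hK _ hy
  rw [hq.apply_red y (p * p * m)]
  · simp
  · rw [map_smul, map_smul, LinearMap.smul_apply, smul_eq_mul, smul_eq_mul] at hm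
    push_cast
    field_simp at hm
    rw [hm]; ring

theorem interImage_le_perp [Fact p.Prime] [Finite (ModP p L)] (hq : IsModPForm p B L q)
    (hB : B.IsSymm) (hL : IsEvenIntegral B L) (hK : IsEvenIntegral B K) :
    interImage p L K ≤ perp q (scaledImage p L K) := by
  have hp0 : (p : ℚ) ≠ 0 := by exact_mod_cast (Fact.out : p.Prime).ne_zero
  intro w hw
  obtain ⟨d, hd, rfl⟩ := mem_interImage.1 hw
  rw [mem_perp]
  intro c hc
  obtain ⟨y, hy, rfl⟩ := mem_scaledImage.1 hc
  rw [polar_red_eq_zero_iff hq hB hL]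
  obtain ⟨m, hm⟩ := hK.integral hB hd hy
  refine ⟨m, ?_⟩
  rw [map_smul, smul_eq_mul] at hm
  rw [← hm]; field_simp

/-- An even lattice between `pL` and `p⁻¹L` inherits unimodularity at `p`. -/
theorem pUnimodular_of_images [Fact p.Prime] [Finite (ModP p L)] (hq : IsModPForm p B L q)
    (hB : B.IsSymm) (hL : IsEvenIntegral B L) (hu : PUnimodular p B L)
    (hK : IsEvenIntegral B K) (h₁ : ∀ x ∈ L, (p : ℚ) • x ∈ K) (h₂ : ∀ x ∈ K, (p : ℚ) • x ∈ L)
    (hD : perp q (scaledImage p L K) ≤ interImage p L K) : PUnimodular p B K := by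
  have hp0 : (p : ℚ) ≠ 0 := by exact_mod_cast (Fact.out : p.Prime).ne_zero
  have nd := hq.nondegenerate hB hL hu
  have hD' := le_antisymm hD (interImage_le_perp hq hB hL hK)
  intro y hyK hy
  -- Since K contains pL, the vector py pairs with L into pℤ, so py ∈ pL.
  have hyL : y ∈ L := by
    obtain ⟨z, hz, hyz⟩ := hu _ (h₂ y hyK) fun w hw => by
      obtain ⟨m, hm⟩ := hy _ (h₁ w hw)
      refine ⟨m, ?_⟩
      rw [map_smul, LinearMap.smul_apply, ← map_smul]
      exact hm
    rwa [smul_right_injective V hp0 hyz]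
  -- The class of y is orthogonal to C^⊥, hence lies in C^⊥⊥ = C. So y = y' + pl with p⁻¹y' ∈ K, and
  -- pairing with K shows that l reduces into C^⊥, hence l ∈ K.
  have hyC : red p L ⟨y, hyL⟩ ∈ scaledImage p L K := by
    rw [← perp_perp nd (scaledImage p L K), hD', mem_perp]
    intro d hd
    obtain ⟨d, hd', rfl⟩ := mem_interImage.1 hd
    rw [polar_red_eq_zero_iff hq hB hL]
    exact hy _ hd'
  obtain ⟨y', hy', hyy⟩ := mem_scaledImage.1 hyC
  obtain ⟨l, hl, hyl⟩ := (red_eq_zero_iff p L (⟨y, hyL⟩ - y')).1 (by rw [map_sub, hyy, sub_self])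
  have hyl' : y = (y' : V) + (p : ℚ) • l := by
    rw [← hyl]; simp
  have hlD : red p L ⟨l, hl⟩ ∈ interImage p L K := by
    rw [← hD', mem_perp]
    intro c hc
    obtain ⟨z, hz, rfl⟩ := mem_scaledImage.1 hc
    rw [polar_red_eq_zero_iff hq hB hL]
    obtain ⟨m, hm⟩ := hy _ hz
    obtain ⟨m', hm'⟩ := hK.integral hB hy' hz
    refine ⟨m - m', ?_⟩
    rw [hyl', map_add, LinearMap.add_apply] at hm
    simp only [map_smul, LinearMap.smul_apply, smul_eq_mul] at hm hm'
    push_cast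
    rw [mul_sub, ← hm, ← hm']
    field_simp
    ring
  obtain ⟨d, hd, hdl⟩ := mem_interImage.1 hlD
  obtain ⟨l', hl', hll⟩ := (red_eq_zero_iff p L (⟨l, hl⟩ - d)).1 (by rw [map_sub, hdl, sub_self])
  have hlK : l ∈ K := by
    have : l = (d : V) + (p : ℚ) • l' := by rw [← hll]; simp
    rw [this]
    exact K.add_mem hd (h₁ _ hl')
  refine ⟨(p : ℚ)⁻¹ • (y' : V) + l, K.add_mem hy' hlK, ?_⟩
  rw [hyl', smul_add, smul_smul, mul_inv_cancel₀ hp0, one_smul]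

theorem fg_of_smul_mem (hp : p.Prime) {ι : Type*} [Fintype ι] (v : Basis ι ℤ L)
    (h₂ : ∀ x ∈ K, (p : ℚ) • x ∈ L) : K.FG := by
  have hp0 : (p : ℚ) ≠ 0 := by exact_mod_cast hp.ne_zero
  have := Module.Finite.of_basis v
  let f : K →ₗ[ℤ] L :=
    { toFun := fun x => ⟨(p : ℚ) • (x : V), h₂ x x.2⟩
      map_add' := fun x y => Subtype.ext (smul_add _ _ _)
      map_smul' := fun n x => Subtype.ext (smul_comm _ n _) }
  have hf : Function.Injective f := by
    intro x y hxy
    exact Subtype.ext (smul_right_injective V hp0 (congrArg Subtype.val hxy))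
  exact Module.Finite.iff_fg.1 (Module.Finite.of_injective f hf)

/-- The genus condition becomes evenness. One direction is locality of evenness; in the other, the
dimensions force the image of K ∩ L to be all of C^⊥, so K is unimodular at p and a chain of
neighbours connects it to L. -/
theorem mem_neighbours_iff (hp : p.Prime) [Finite (ModP p L)] (hq : IsModPForm p B L q)
    (hB : B.IsSymm) (hL : IsEvenIntegral B L) (hu : PUnimodular p B L)
    (v : Basis (Fin (finrank ℚ V)) ℤ L) {j : ℕ} :
    K ∈ neighbours p B L j ↔ (∀ x ∈ L, (p : ℚ) • x ∈ K) ∧ (∀ x ∈ K, (p : ℚ) • x ∈ L) ∧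
      IsEvenIntegral B K ∧ finrank (ZMod p) (scaledImage p L K) = j ∧
        finrank (ZMod p) (interImage p L K) + j = finrank ℚ V := by
  have := Fact.mk hp
  constructor
  · rintro ⟨h₁, h₂, ⟨a, ha, ha₁, ha₂⟩, hg⟩
    obtain ⟨h₃, h₄⟩ := ha.finrank_images hp h₁ h₂
    exact ⟨h₁, h₂, hg.isEvenIntegral hB hL, h₃.trans ha₁, by rw [← h₄, ha₂]⟩
  · rintro ⟨h₁, h₂, hK, hC, hD⟩
    obtain ⟨a, ha⟩ := exists_invariantFactors hp v h₁ h₂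
    obtain ⟨h₃, h₄⟩ := ha.finrank_images hp h₁ h₂
    refine ⟨h₁, h₂, ⟨a, ha, h₃.symm.trans hC, by omega⟩, ?_⟩
    have nd := hq.nondegenerate hB hL hu
    obtain ⟨b, -⟩ := exists_modP_basis (p := p) v
    have hW : finrank (ZMod p) (ModP p L) = finrank ℚ V := by
      rw [finrank_eq_card_basis b, Fintype.card_fin]
    have hperp := finrank_perp nd (scaledImage p L K)
    have heq : interImage p L K = perp q (scaledImage p L K) :=
      Submodule.eq_of_le_of_finrank_eq (interImage_le_perp hq hB hL hK) (by omega)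
    refine inGenus_of_commensurable hp hB hK
      (pUnimodular_of_images hq hB hL hu hK h₁ h₂ heq.ge) (fg_of_smul_mem hp v h₂) hL hu
      ⟨1, by simpa using h₂⟩ ⟨1, by simpa using h₁⟩

end images

end

end SiegelTheta

/-! ### The lattices `K_j` with given image of `p K_j` in `L / pL` -/

namespace IsotropicCount

theorem totIso_span {F W ι : Type*} [Field F] [AddCommGroup W] [Module F W]
    {q : QuadraticForm F W} (v : ι → W) (h : ∀ i, q (v i) = 0)
    (h' : ∀ i i', QuadraticMap.polar q (v i) (v i') = 0) :
    ∀ x ∈ Submodule.span F (Set.range v), q x = 0 := by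
  have h1 : ∀ i, ∀ x ∈ Submodule.span F (Set.range v), QuadraticMap.polar q (v i) x = 0 := by
    intro i x hx
    induction hx using Submodule.span_induction with
    | mem x hx => obtain ⟨j, rfl⟩ := hx; exact h' i j
    | zero => exact QuadraticMap.polar_zero_right q _
    | add a b _ _ ha hb => rw [QuadraticMap.polar_add_right, ha, hb, add_zero]
    | smul c a _ ha => rw [QuadraticMap.polar_smul_right, ha, smul_zero]
  have h2 : ∀ y ∈ Submodule.span F (Set.range v), ∀ x ∈ Submodule.span F (Set.range v),
      QuadraticMap.polar q y x = 0 := by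
    intro y hy x hx
    induction hy using Submodule.span_induction with
    | mem y hy => obtain ⟨j, rfl⟩ := hy; exact h1 j x hx
    | zero => exact QuadraticMap.polar_zero_left q _
    | add a b _ _ ha hb => rw [QuadraticMap.polar_add_left, ha, hb, add_zero]
    | smul c a _ ha => rw [QuadraticMap.polar_smul_left, ha, smul_zero]
  intro x hx
  induction hx using Submodule.span_induction with
  | mem x hx => obtain ⟨j, rfl⟩ := hx; exact h j
  | zero => exact QuadraticMap.map_zero q
  | add a b ha' hb' ha hb => rw [QuadraticMap.map_add q, ha, hb, h2 a ha' b hb']; simp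
  | smul c a _ ha => rw [QuadraticMap.map_smul, ha, smul_zero]

end IsotropicCount

namespace SiegelTheta

open Module IsotropicCount

noncomputable section

universe u

variable {V : Type*} [AddCommGroup V] [Module ℚ V]

/-- The `x ∈ p⁻¹L` with `px mod p` in `C`. -/
def hatLattice (p : ℕ) (L : Submodule ℤ V) (C : Submodule (ZMod p) (ModP p L)) :
    Submodule ℤ V where
  carrier := {x | ∃ y : L, (p : ℚ) • x = y ∧ red p L y ∈ C}
  add_mem' := by
    rintro a b ⟨y, hy, hyC⟩ ⟨z, hz, hzC⟩
    exact ⟨y + z, by rw [smul_add, hy, hz]; rfl, by rw [map_add]; exact C.add_mem hyC hzC⟩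
  zero_mem' := ⟨0, by simp, by simp⟩
  smul_mem' := by
    rintro n a ⟨y, hy, hyC⟩
    refine ⟨n • y, by rw [smul_comm, hy]; rfl, ?_⟩
    rw [map_zsmul, ← Int.cast_smul_eq_zsmul (ZMod p)]
    exact C.smul_mem _ hyC

/-- The `x ∈ L` with `x mod p` in `C`. -/
def coreLattice (p : ℕ) (L : Submodule ℤ V) (C : Submodule (ZMod p) (ModP p L)) :
    Submodule ℤ V where
  carrier := {x | ∃ y : L, x = y ∧ red p L y ∈ C}
  add_mem' := by
    rintro a b ⟨y, hy, hyC⟩ ⟨z, hz, hzC⟩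
    exact ⟨y + z, by rw [hy, hz]; rfl, by rw [map_add]; exact C.add_mem hyC hzC⟩
  zero_mem' := ⟨0, by simp, by simp⟩
  smul_mem' := by
    rintro n a ⟨y, hy, hyC⟩
    refine ⟨n • y, by rw [hy]; rfl, ?_⟩
    rw [map_zsmul, ← Int.cast_smul_eq_zsmul (ZMod p)]
    exact C.smul_mem _ hyC

section fibre

variable {p : ℕ} {B : LinearMap.BilinForm ℚ V} {L K : Submodule ℤ V}
  {q : QuadraticForm (ZMod p) (ModP p L)} {C : Submodule (ZMod p) (ModP p L)}

theorem mem_hatLattice {x : V} :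
    x ∈ hatLattice p L C ↔ ∃ y : L, (p : ℚ) • x = y ∧ red p L y ∈ C := Iff.rfl

theorem mem_coreLattice {x : V} : x ∈ coreLattice p L C ↔ ∃ y : L, x = y ∧ red p L y ∈ C := Iff.rfl

theorem coe_mem_coreLattice {x : L} : (x : V) ∈ coreLattice p L C ↔ red p L x ∈ C := by
  rw [mem_coreLattice]
  exact ⟨fun ⟨y, hy, h⟩ => by rwa [Subtype.ext hy], fun h => ⟨x, rfl, h⟩⟩

theorem le_hatLattice : L ≤ hatLattice p L C := by
  intro x hx
  refine ⟨⟨_, natCast_smul_mem L p hx⟩, rfl, ?_⟩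
  rw [(red_eq_zero_iff p L _).2 ⟨x, hx, rfl⟩]
  exact C.zero_mem

theorem inv_smul_mem_hatLattice [Fact p.Prime] {y : L} :
    (p : ℚ)⁻¹ • (y : V) ∈ hatLattice p L C ↔ red p L y ∈ C := by
  have hp0 : (p : ℚ) ≠ 0 := by exact_mod_cast (Fact.out : p.Prime).ne_zero
  rw [mem_hatLattice]
  simp only [smul_smul, mul_inv_cancel₀ hp0, one_smul]
  exact ⟨fun ⟨z, hz, h⟩ => by rwa [Subtype.ext hz], fun h => ⟨y, rfl, h⟩⟩

/-- `hatLattice C / coreLattice C^⊥` as a vector space, given by the quotient map. -/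
structure IsFibreQuotient (q : QuadraticForm (ZMod p) (ModP p L)) [Fact p.Prime]
    (C : Submodule (ZMod p) (ModP p L))
    {Y : Type*} [AddCommGroup Y] (π : hatLattice p L C →+ Y) : Prop where
  surj : Function.Surjective π
  ker : ∀ x, π x = 0 ↔ (x : V) ∈ coreLattice p L (perp q C)

theorem exists_fibreQuotient {V : Type u} [AddCommGroup V] [Module ℚ V] {L : Submodule ℤ V}
    {q : QuadraticForm (ZMod p) (ModP p L)} {C : Submodule (ZMod p) (ModP p L)} [Fact p.Prime]
    [Finite (ModP p L)] (hC : TotIso q C) :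
    ∃ (Y : Type u) (_ : AddCommGroup Y) (_ : Module (ZMod p) Y) (π : hatLattice p L C →+ Y),
      IsFibreQuotient q C π := by
  let S : Submodule ℤ (hatLattice p L C) :=
    (coreLattice p L (perp q C)).comap (hatLattice p L C).subtype
  have hS : ∀ x, S.mkQ x = 0 ↔ (x : V) ∈ coreLattice p L (perp q C) := by
    intro x
    rw [Submodule.mkQ_apply, Submodule.Quotient.mk_eq_zero]; rfl
  have h : ∀ x : hatLattice p L C ⧸ S, p • x = 0 := by
    intro x
    obtain ⟨x, rfl⟩ := S.mkQ_surjective x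
    rw [← map_nsmul, hS]
    obtain ⟨y, hy, hyC⟩ := mem_hatLattice.1 x.2
    refine ⟨y, ?_, hC.le_perp hyC⟩
    rw [← hy, Nat.cast_smul_eq_nsmul ℚ]; rfl
  exact ⟨_, inferInstance, AddCommGroup.zmodModule h, S.mkQ.toAddMonoidHom,
    S.mkQ_surjective, hS⟩

variable [Fact p.Prime] [Finite (ModP p L)] {Y : Type*} [AddCommGroup Y] [Module (ZMod p) Y]
  {π : hatLattice p L C →+ Y}

theorem IsFibreQuotient.finite {ι : Type*} [Fintype ι] (v : Basis ι ℤ L)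
    (hπ : IsFibreQuotient q C π) : Finite Y := by
  have h1 : Module.Finite ℤ (hatLattice p L C) :=
    Module.Finite.iff_fg.2 (fg_of_smul_mem (Fact.out : p.Prime) v fun x hx => by
      obtain ⟨y, hy, -⟩ := mem_hatLattice.1 hx
      rw [hy]; exact y.2)
  have h2 : Module.Finite ℤ Y := Module.Finite.of_surjective π.toIntLinearMap hπ.surj
  have h3 : Module.Finite (ZMod p) Y := Module.Finite.of_restrictScalars_finite ℤ (ZMod p) Y
  exact Module.finite_of_finite (ZMod p)

/-- Multiplication by p and the inclusion of L descend to an exact sequence L/pL → Y → L/pL in which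
the first map has kernel C^⊥ and the second has image C. This gives dim Y = 2 dim C and identifies
the image of L in Y. -/
theorem IsFibreQuotient.exists_maps (hπ : IsFibreQuotient q C π) :
    ∃ (ψ : Y →ₗ[ZMod p] ModP p L) (φ : ModP p L →ₗ[ZMod p] Y),
      (∀ (x : hatLattice p L C) (y : L), (p : ℚ) • (x : V) = y → ψ (π x) = red p L y) ∧
      (∀ x : L, φ (red p L x) = π ⟨x, le_hatLattice x.2⟩) ∧
      LinearMap.ker ψ = LinearMap.range φ ∧ LinearMap.range ψ = C ∧
      LinearMap.ker φ = perp q C := by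
  have hp0 : (p : ℚ) ≠ 0 := by exact_mod_cast (Fact.out : p.Prime).ne_zero
  have hmem : ∀ x : hatLattice p L C, (p : ℚ) • (x : V) ∈ L := fun x => by
    obtain ⟨y, hy, -⟩ := mem_hatLattice.1 x.2
    rw [hy]; exact y.2
  let mulP : hatLattice p L C →+ L :=
    { toFun := fun x => ⟨(p : ℚ) • (x : V), hmem x⟩
      map_zero' := Subtype.ext (smul_zero _)
      map_add' := fun x y => Subtype.ext (smul_add _ _ _) }
  let incl : L →+ hatLattice p L C := (Submodule.inclusion le_hatLattice).toAddMonoidHom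
  have h1 : π.ker ≤ ((red p L).comp mulP).ker := by
    intro x hx
    obtain ⟨y, hy, -⟩ := mem_coreLattice.1 ((hπ.ker x).1 hx)
    exact (red_eq_zero_iff p L _).2 ⟨y, y.2, by rw [← hy]; rfl⟩
  have h2 : (red p L).ker ≤ (π.comp incl).ker := by
    intro x hx
    obtain ⟨z, hz, hxz⟩ := (red_eq_zero_iff p L x).1 hx
    refine (hπ.ker _).2 ?_
    refine mem_coreLattice.2 ⟨x, rfl, ?_⟩
    rw [show red p L x = 0 from hx]
    exact Submodule.zero_mem _
  let ψ₀ : Y →+ ModP p L := AddMonoidHom.liftOfSurjective π hπ.surj ⟨_, h1⟩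
  let φ₀ : ModP p L →+ Y := AddMonoidHom.liftOfSurjective (red p L) (red_surjective p L) ⟨_, h2⟩
  have hψ₀ : ∀ x, ψ₀ (π x) = red p L (mulP x) := fun x =>
    AddMonoidHom.liftOfRightInverse_comp_apply π _ _ ⟨_, h1⟩ x
  have hφ₀ : ∀ x, φ₀ (red p L x) = π (incl x) := fun x =>
    AddMonoidHom.liftOfRightInverse_comp_apply (red p L) _ _ ⟨_, h2⟩ x
  refine ⟨ψ₀.toZModLinearMap p, φ₀.toZModLinearMap p, ?_, hφ₀, ?_, ?_, ?_⟩
  · intro x y hxy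
    have : y = mulP x := Subtype.ext hxy.symm
    rw [this]; exact hψ₀ x
  · ext z
    obtain ⟨x, rfl⟩ := hπ.surj z
    rw [LinearMap.mem_ker, LinearMap.mem_range]
    change ψ₀ (π x) = 0 ↔ _
    rw [hψ₀, red_eq_zero_iff]
    constructor
    · rintro ⟨z, hz, hxz⟩
      have : (x : V) = z := smul_right_injective V hp0 hxz
      refine ⟨red p L ⟨z, hz⟩, (hφ₀ _).trans ?_⟩
      congr 1
      exact Subtype.ext this.symm
    · rintro ⟨w, hw⟩
      obtain ⟨y, rfl⟩ := red_surjective p L w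
      replace hw : φ₀ (red p L y) = π x := hw
      rw [hφ₀, ← sub_eq_zero, ← map_sub, hπ.ker] at hw
      obtain ⟨z, hz, -⟩ := mem_coreLattice.1 hw
      refine ⟨y - z, L.sub_mem y.2 z.2, ?_⟩
      change (p : ℚ) • (x : V) = _
      rw [← hz]
      simp [incl]
  · ext w
    rw [LinearMap.mem_range]
    constructor
    · rintro ⟨z, rfl⟩
      obtain ⟨x, rfl⟩ := hπ.surj z
      obtain ⟨y, hy, hyC⟩ := mem_hatLattice.1 x.2
      have : y = mulP x := Subtype.ext hy.symm
      change ψ₀ (π x) ∈ C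
      rwa [hψ₀, ← this]
    · intro hw
      obtain ⟨y, rfl⟩ := red_surjective p L w
      refine ⟨π ⟨_, inv_smul_mem_hatLattice.2 hw⟩, (hψ₀ _).trans ?_⟩
      congr 1
      exact Subtype.ext (by
        change (p : ℚ) • ((p : ℚ)⁻¹ • (y : V)) = _
        rw [smul_smul, mul_inv_cancel₀ hp0, one_smul])
  · ext w
    obtain ⟨y, rfl⟩ := red_surjective p L w
    rw [LinearMap.mem_ker]
    change φ₀ (red p L y) = 0 ↔ _
    rw [hφ₀, hπ.ker]
    exact coe_mem_coreLattice

/-- Isotropy of C makes p·½B integral on `hatLattice`. For nondegeneracy, an x in the radical pairs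
integrally with `hatLattice`. In particular it pairs integrally with L, so x ∈ L by unimodularity;
then pairing with p⁻¹C puts its class in C^⊥. -/
theorem exists_fibre_form (hq : IsModPForm p B L q) (hB : B.IsSymm) (hL : IsEvenIntegral B L)
    (hu : PUnimodular p B L) (hC : TotIso q C) (hπ : IsFibreQuotient q C π) :
    ∃ qY : QuadraticForm (ZMod p) Y, LinearMap.Nondegenerate qY.polarBilin ∧
      (∀ x : hatLattice p L C, ∀ m : ℤ, p * B (x : V) (x : V) = 2 * m → qY (π x) = m) ∧
      ∀ x y : hatLattice p L C, ∀ m : ℤ, p * B (x : V) (y : V) = m → QuadraticMap.polar qY (π x) (π y) = m := by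
  have hp0 : (p : ℚ) ≠ 0 := by exact_mod_cast (Fact.out : p.Prime).ne_zero
  have hsymm : ∀ y z, B y z = B z y := fun y z => hB.eq y z
  have hpair : ∀ x ∈ coreLattice p L (perp q C), ∀ y ∈ hatLattice p L C, ∃ m : ℤ, B y x = m := by
    intro x hx y hy
    obtain ⟨x, rfl, hxC⟩ := mem_coreLattice.1 hx
    obtain ⟨z, hz, hzC⟩ := mem_hatLattice.1 hy
    have h1 := mem_perp.1 hxC _ hzC
    rw [QuadraticMap.polar_comm, polar_red_eq_zero_iff hq hB hL] at h1
    obtain ⟨m, hm⟩ := h1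
    rw [← hz, map_smul, LinearMap.smul_apply, smul_eq_mul] at hm
    exact ⟨m, mul_left_cancel₀ hp0 hm⟩
  have heven : ∀ x ∈ hatLattice p L C, ∃ m : ℤ, p * B x x = 2 * m := by
    intro x hx
    obtain ⟨z, hz, hzC⟩ := mem_hatLattice.1 hx
    obtain ⟨m, hm⟩ := hL z z.2
    have h1 := hC _ hzC
    rw [hq.apply_red z m hm, ZMod.intCast_zmod_eq_zero_iff_dvd] at h1
    obtain ⟨c, rfl⟩ := h1
    refine ⟨c, mul_left_cancel₀ hp0 ?_⟩
    rw [← hz, map_smul, map_smul, LinearMap.smul_apply, smul_eq_mul, smul_eq_mul] at hm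
    rw [hm]; push_cast; ring
  have hBs : ((p : ℚ) • B).IsSymm := ⟨fun x y => by
    simp only [LinearMap.smul_apply, hsymm y x]⟩
  obtain ⟨qY, h1, h2⟩ := exists_quotient_form π hπ.surj (hatLattice p L C).subtype.toAddMonoidHom
    ((p : ℚ) • B) hBs (fun x => heven x x.2) (by
      intro x hx
      have hx' := (hπ.ker x).1 hx
      constructor
      · obtain ⟨y, hy, -⟩ := mem_coreLattice.1 hx'
        obtain ⟨m, hm⟩ := hL y y.2
        refine ⟨m, ?_⟩
        change (p : ℚ) * B (x : V) (x : V) = _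
        rw [hy, hm]; ring
      · intro y
        obtain ⟨m, hm⟩ := hpair x hx' y y.2
        refine ⟨m, ?_⟩
        change (p : ℚ) * B (y : V) (x : V) = _
        rw [hm])
  refine ⟨qY, ?_, h1, h2⟩
  have key : ∀ z : Y, (∀ y, QuadraticMap.polar qY z y = 0) → z = 0 := by
    intro z hz
    obtain ⟨x, rfl⟩ := hπ.surj z
    have hxy : ∀ y ∈ hatLattice p L C, ∃ m : ℤ, B (x : V) y = m := by
      intro y hy
      obtain ⟨m₁, hm₁⟩ := heven x x.2
      obtain ⟨m₂, hm₂⟩ := heven y hy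
      obtain ⟨m₃, hm₃⟩ := heven _ (Submodule.add_mem _ x.2 hy)
      have hm : p * B (x : V) y = (m₃ - m₁ - m₂ : ℤ) := by
        simp only [map_add, LinearMap.add_apply, hsymm y x] at hm₃
        push_cast; linarith
      have h3 := hz (π ⟨y, hy⟩)
      rw [h2 x ⟨y, hy⟩ _ hm, ZMod.intCast_zmod_eq_zero_iff_dvd] at h3
      obtain ⟨c, hc⟩ := h3
      refine ⟨c, mul_left_cancel₀ hp0 ?_⟩
      rw [hm, hc]; push_cast; rfl
    obtain ⟨y, hy, hyC⟩ := mem_hatLattice.1 x.2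
    obtain ⟨z, hz', hyz⟩ := hu y y.2 fun w hw => by
      obtain ⟨m, hm⟩ := hxy w (le_hatLattice hw)
      exact ⟨m, by rw [← hy, map_smul, LinearMap.smul_apply, hm, smul_eq_mul]⟩
    have hxz : (x : V) = z := smul_right_injective V hp0 (hy.trans hyz)
    refine (hπ.ker x).2 (mem_coreLattice.2 ⟨⟨z, hz'⟩, hxz, mem_perp.2 fun c hc => ?_⟩)
    obtain ⟨c, rfl⟩ := red_surjective p L c
    rw [polar_red_eq_zero_iff hq hB hL]
    obtain ⟨m, hm⟩ := hxy _ (inv_smul_mem_hatLattice.2 hc)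
    refine ⟨m, ?_⟩
    rw [map_smul, smul_eq_mul, hxz] at hm
    change B z (c : V) = _
    rw [← hm]; field_simp
  constructor
  · exact fun w hw => key w hw
  · refine fun w hw => key w fun y => ?_
    rw [QuadraticMap.polar_comm]
    exact hw y

/-- The lattice corresponding to a subspace of `hatLattice C / coreLattice C^⊥`. -/
def latticeOf (π : hatLattice p L C →+ Y) (D : Submodule (ZMod p) Y) : Submodule ℤ V :=
  AddSubgroup.toIntSubmodule ((D.toAddSubgroup.comap π).map
    (hatLattice p L C).subtype.toAddMonoidHom)

/-- The subspace of `hatLattice C / coreLattice C^⊥` corresponding to a lattice. -/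
def spaceOf (π : hatLattice p L C →+ Y) (K : Submodule ℤ V) : Submodule (ZMod p) Y :=
  AddSubgroup.toZModSubmodule p ((K.comap (hatLattice p L C).subtype).toAddSubgroup.map π)

theorem mem_latticeOf {D : Submodule (ZMod p) Y} {x : V} :
    x ∈ latticeOf π D ↔ ∃ h : x ∈ hatLattice p L C, π ⟨x, h⟩ ∈ D :=
  ⟨fun ⟨y, hy, hx⟩ => hx ▸ ⟨y.2, hy⟩, fun ⟨h, hD⟩ => ⟨⟨x, h⟩, hD, rfl⟩⟩

theorem coe_mem_latticeOf {D : Submodule (ZMod p) Y} {x : hatLattice p L C} :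
    (x : V) ∈ latticeOf π D ↔ π x ∈ D :=
  mem_latticeOf.trans ⟨fun ⟨_, h⟩ => h, fun h => ⟨x.2, h⟩⟩

theorem IsFibreQuotient.mem_spaceOf (hπ : IsFibreQuotient q C π)
    (hK : coreLattice p L (perp q C) ≤ K) {x : hatLattice p L C} :
    π x ∈ spaceOf π K ↔ (x : V) ∈ K := by
  constructor
  · rintro ⟨y, hy, hxy⟩
    have h := hK ((hπ.ker (x - y)).1 (by rw [map_sub, hxy, sub_self]))
    have h2 := K.add_mem h hy
    simpa using h2
  · exact fun h => ⟨x, h, rfl⟩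

theorem IsFibreQuotient.spaceOf_latticeOf (hπ : IsFibreQuotient q C π)
    (D : Submodule (ZMod p) Y) : spaceOf π (latticeOf π D) = D := by
  ext z
  obtain ⟨x, rfl⟩ := hπ.surj z
  constructor
  · rintro ⟨y, hy, hxy⟩
    rw [← hxy]
    exact coe_mem_latticeOf.1 hy
  · exact fun h => ⟨x, coe_mem_latticeOf.2 h, rfl⟩

theorem IsFibreQuotient.latticeOf_spaceOf (hπ : IsFibreQuotient q C π)
    (h₁ : coreLattice p L (perp q C) ≤ K) (h₂ : K ≤ hatLattice p L C) :
    latticeOf π (spaceOf π K) = K := by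
  ext x
  rw [mem_latticeOf]
  constructor
  · rintro ⟨h, hx⟩
    exact (hπ.mem_spaceOf h₁).1 hx
  · exact fun hx => ⟨h₂ hx, (hπ.mem_spaceOf h₁).2 hx⟩

end fibre

end

end SiegelTheta

/-! ### The K_j over a fixed C as Lagrangian complements -/

namespace SiegelTheta

open Module IsotropicCount

noncomputable section

universe u

variable {V : Type u} [AddCommGroup V] [Module ℚ V]

section fibre

variable {p : ℕ} {B : LinearMap.BilinForm ℚ V} {L K : Submodule ℤ V}
  {q : QuadraticForm (ZMod p) (ModP p L)} {C : Submodule (ZMod p) (ModP p L)}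
  [Fact p.Prime] [Finite (ModP p L)]

theorem coreLattice_le (hD : perp q C ≤ interImage p L K) (h₁ : ∀ x ∈ L, (p : ℚ) • x ∈ K) :
    coreLattice p L (perp q C) ≤ K := by
  intro x hx
  obtain ⟨y, rfl, hy⟩ := mem_coreLattice.1 hx
  obtain ⟨d, hd, hdy⟩ := mem_interImage.1 (hD hy)
  obtain ⟨l, hl, hyl⟩ := (red_eq_zero_iff p L (y - d)).1 (by rw [map_sub, hdy, sub_self])
  have : (y : V) = d + (p : ℚ) • l := by rw [← hyl]; simp
  rw [this]
  exact K.add_mem hd (h₁ _ hl)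

theorem le_hatLattice_scaledImage (h₂ : ∀ x ∈ K, (p : ℚ) • x ∈ L) :
    K ≤ hatLattice p L (scaledImage p L K) := by
  have hp0 : (p : ℚ) ≠ 0 := by exact_mod_cast (Fact.out : p.Prime).ne_zero
  intro x hx
  refine ⟨⟨_, h₂ x hx⟩, rfl, mem_scaledImage.2 ⟨_, ?_, rfl⟩⟩
  rwa [smul_smul, inv_mul_cancel₀ hp0, one_smul]

/-- The lattices `K_j` lying over a given `C` correspond to the complements of a Lagrangian. -/
theorem neighbours_over_iff {Y : Type u} [AddCommGroup Y] [Module (ZMod p) Y] [Finite Y]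
    {π : hatLattice p L C →+ Y} (hq : IsModPForm p B L q)
    (hB : B.IsSymm) (hL : IsEvenIntegral B L) (hu : PUnimodular p B L)
    (v : Basis (Fin (finrank ℚ V)) ℤ L) (hC : TotIso q C) {j : ℕ} (hCj : finrank (ZMod p) C = j)
    (hπ : IsFibreQuotient q C π) {ψ : Y →ₗ[ZMod p] ModP p L} {φ : ModP p L →ₗ[ZMod p] Y}
    (hψ : ∀ (x : hatLattice p L C) (y : L), (p : ℚ) • (x : V) = y → ψ (π x) = red p L y)
    (hφ : ∀ x : L, φ (red p L x) = π ⟨x, le_hatLattice x.2⟩)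
    (hψφ : LinearMap.ker ψ = LinearMap.range φ) (hφj : finrank (ZMod p) (LinearMap.range φ) = j)
    (hY : finrank (ZMod p) Y = 2 * j) {qY : QuadraticForm (ZMod p) Y}
    (hqY : ∀ x : hatLattice p L C, ∀ m : ℤ, p * B (x : V) (x : V) = 2 * m → qY (π x) = m) :
    (∀ K, K ∈ neighbours p B L j ∧ scaledImage p L K = C →
      (coreLattice p L (perp q C) ≤ K ∧ K ≤ hatLattice p L C) ∧
      (TotIso qY (spaceOf π K) ∧ finrank (ZMod p) (spaceOf π K) = j) ∧
        spaceOf π K ⊓ LinearMap.range φ = ⊥) ∧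
    ∀ D : Submodule (ZMod p) Y, (TotIso qY D ∧ finrank (ZMod p) D = j) ∧
      D ⊓ LinearMap.range φ = ⊥ → latticeOf π D ∈ neighbours p B L j ∧
        scaledImage p L (latticeOf π D) = C := by
  have hp0 : (p : ℚ) ≠ 0 := by exact_mod_cast (Fact.out : p.Prime).ne_zero
  have hp : p.Prime := Fact.out
  have nd := hq.nondegenerate hB hL hu
  have hW : finrank (ZMod p) (ModP p L) = finrank ℚ V := by
    obtain ⟨b, -⟩ := exists_modP_basis (p := p) v
    rw [finrank_eq_card_basis b, Fintype.card_fin]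
  have hperp := finrank_perp nd C
  have hrange : ∀ x : hatLattice p L C, π x ∈ LinearMap.range φ ↔ (x : V) ∈ L := by
    intro x
    rw [← hψφ, LinearMap.mem_ker]
    obtain ⟨y, hy, -⟩ := mem_hatLattice.1 x.2
    rw [hψ x y hy, red_eq_zero_iff, ← hy]
    constructor
    · rintro ⟨z, hz, hxz⟩
      rwa [smul_right_injective V hp0 hxz]
    · exact fun h => ⟨x, h, rfl⟩
  have hdim : ∀ D : Submodule (ZMod p) Y, D ⊓ LinearMap.range φ = ⊥ →
      (finrank (ZMod p) D = j ↔ D ⊔ LinearMap.range φ = ⊤) := by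
    intro D hD
    have h1 := Submodule.finrank_sup_add_finrank_inf_eq D (LinearMap.range φ)
    rw [hD, finrank_bot, hφj] at h1
    constructor
    · intro h
      exact Submodule.eq_top_of_finrank_eq (by omega)
    · intro h
      rw [h, finrank_top] at h1
      omega
  constructor
  · rintro K ⟨hK, rfl⟩
    obtain ⟨h₁, h₂, hKe, -, hKD⟩ := (mem_neighbours_iff hp hq hB hL hu v).1 hK
    have heq : interImage p L K = perp q (scaledImage p L K) :=
      Submodule.eq_of_le_of_finrank_eq (interImage_le_perp hq hB hL hKe) (by omega)
    have hcK := coreLattice_le heq.ge h₁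
    have hKh := le_hatLattice_scaledImage h₂
    -- The intersection is represented by vectors of K ∩ L; these reduce into C^⊥ and so lie in the
    -- kernel of π.
    have hinf : spaceOf π K ⊓ LinearMap.range φ = ⊥ := by
      rw [eq_bot_iff]
      rintro z ⟨hz, hz'⟩
      obtain ⟨x, rfl⟩ := hπ.surj z
      have hxK := (hπ.mem_spaceOf hcK).1 hz
      have hxL := (hrange x).1 hz'
      refine (Submodule.mem_bot _).2 ((hπ.ker x).2 (mem_coreLattice.2 ⟨⟨x, hxL⟩, rfl, ?_⟩))
      rw [← heq]
      exact mem_interImage.2 ⟨⟨x, hxL⟩, hxK, rfl⟩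
    refine ⟨⟨hcK, hKh⟩, ⟨?_, ?_⟩, hinf⟩
    · rintro _ ⟨x, hx, rfl⟩
      obtain ⟨m, hm⟩ := hKe x hx
      rw [hqY x (p * m) (by rw [hm]; push_cast; ring)]
      simp
    -- The dimension is obtained from K + L = `hatLattice`, which holds because pK maps onto C.
    · rw [hdim _ hinf, eq_top_iff]
      rintro z -
      obtain ⟨x, rfl⟩ := hπ.surj z
      obtain ⟨y, hy, hyC⟩ := mem_hatLattice.1 x.2
      obtain ⟨y', hy', hyy⟩ := mem_scaledImage.1 hyC
      have h3 := (hrange (x - ⟨_, hKh hy'⟩)).2 (by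
        obtain ⟨l, hl, hyl⟩ := (red_eq_zero_iff p L (y - y')).1 (by rw [map_sub, hyy, sub_self])
        have : ((x - ⟨_, hKh hy'⟩ : hatLattice p L _) : V) = l := by
          apply smul_right_injective V hp0
          change (p : ℚ) • ((x : V) - (p : ℚ)⁻¹ • (y' : V)) = _
          rw [smul_sub, hy, smul_smul, mul_inv_cancel₀ hp0, one_smul]
          exact hyl
        rwa [this])
      rw [map_sub] at h3
      rw [← add_sub_cancel (π ⟨_, hKh hy'⟩) (π x)]
      exact Submodule.add_mem_sup ((hπ.mem_spaceOf hcK).2 hy') h3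
  · rintro D ⟨⟨hD, hDj⟩, hinf⟩
    have hsup := (hdim D hinf).1 hDj
    have hcore : coreLattice p L (perp q C) ≤ latticeOf π D := by
      intro x hx
      have hxh : x ∈ hatLattice p L C := by
        obtain ⟨y, rfl, -⟩ := mem_coreLattice.1 hx
        exact le_hatLattice y.2
      refine mem_latticeOf.2 ⟨hxh, ?_⟩
      rw [(hπ.ker _).2 hx]
      exact D.zero_mem
    have h₁ : ∀ x ∈ L, (p : ℚ) • x ∈ latticeOf π D := by
      intro x hx
      refine hcore (mem_coreLattice.2 ⟨⟨_, natCast_smul_mem L p hx⟩, rfl, ?_⟩)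
      rw [(red_eq_zero_iff p L _).2 ⟨x, hx, rfl⟩]
      exact Submodule.zero_mem _
    have h₂ : ∀ x ∈ latticeOf π D, (p : ℚ) • x ∈ L := by
      intro x hx
      obtain ⟨hxh, -⟩ := mem_latticeOf.1 hx
      obtain ⟨y, hy, -⟩ := mem_hatLattice.1 hxh
      rw [hy]; exact y.2
    have hint : interImage p L (latticeOf π D) = perp q C := by
      ext w
      constructor
      · intro hw
        obtain ⟨d, hd, rfl⟩ := mem_interImage.1 hw
        obtain ⟨hdh, hdD⟩ := mem_latticeOf.1 hd
        have h0 : π ⟨d, hdh⟩ ∈ D ⊓ LinearMap.range φ := ⟨hdD, (hrange _).2 d.2⟩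
        rw [hinf, Submodule.mem_bot, hπ.ker] at h0
        exact coe_mem_coreLattice.1 h0
      · intro hw
        obtain ⟨y, rfl⟩ := red_surjective p L w
        exact mem_interImage.2 ⟨y, hcore (coe_mem_coreLattice.2 hw), rfl⟩
    have hsc : scaledImage p L (latticeOf π D) = C := by
      ext w
      constructor
      · intro hw
        obtain ⟨y, hy, rfl⟩ := mem_scaledImage.1 hw
        obtain ⟨hyh, -⟩ := mem_latticeOf.1 hy
        exact inv_smul_mem_hatLattice.1 hyh
      · intro hw
        obtain ⟨y, rfl⟩ := red_surjective p L w
        have hyh := inv_smul_mem_hatLattice.2 hw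
        -- As D + Λ = Y, some l ∈ L moves the class of p⁻¹y into D. Replacing y by y − pl does not
        -- change its reduction.
        have h3 : π ⟨_, hyh⟩ ∈ D ⊔ LinearMap.range φ := by rw [hsup]; trivial
        obtain ⟨d, hd, r, ⟨s, rfl⟩, hdr⟩ := Submodule.mem_sup.1 h3
        obtain ⟨l, rfl⟩ := red_surjective p L s
        refine mem_scaledImage.2 ⟨y - (p : ℤ) • l, ?_, ?_⟩
        · have h4 : ((⟨_, hyh⟩ - ⟨l, le_hatLattice l.2⟩ : hatLattice p L C) : V) =
              (p : ℚ)⁻¹ • ((y - (p : ℤ) • l : L) : V) := by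
            change (p : ℚ)⁻¹ • (y : V) - (l : V) = (p : ℚ)⁻¹ • ((y : V) - (p : ℤ) • (l : V))
            rw [smul_sub, ← Int.cast_smul_eq_zsmul ℚ, smul_smul, Int.cast_natCast,
              inv_mul_cancel₀ hp0, one_smul]
          rw [← h4, coe_mem_latticeOf, map_sub, ← hdr, hφ, add_sub_cancel_right]
          exact hd
        · rw [map_sub, map_zsmul, ← Int.cast_smul_eq_zsmul (ZMod p)]
          simp
    refine ⟨(mem_neighbours_iff hp hq hB hL hu v).2 ⟨h₁, h₂, ?_, ?_, ?_⟩, hsc⟩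
    -- The form on Y reduces p·½B, so its vanishing on D says that p divides p·½B(x, x), that is,
    -- B(x, x) ∈ 2ℤ.
    · intro x hx
      obtain ⟨hxh, hxD⟩ := mem_latticeOf.1 hx
      obtain ⟨y, hy, hyC⟩ := mem_hatLattice.1 hxh
      obtain ⟨m, hm⟩ := hL y y.2
      have h5 := hC _ hyC
      rw [hq.apply_red y m hm, ZMod.intCast_zmod_eq_zero_iff_dvd] at h5
      obtain ⟨c, rfl⟩ := h5
      have h6 : p * B x x = 2 * c := by
        apply mul_left_cancel₀ hp0
        rw [← hy, map_smul, map_smul, LinearMap.smul_apply, smul_eq_mul, smul_eq_mul] at hm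
        rw [hm]; push_cast; ring
      have h7 := hD _ hxD
      rw [hqY ⟨x, hxh⟩ c h6, ZMod.intCast_zmod_eq_zero_iff_dvd] at h7
      obtain ⟨e, rfl⟩ := h7
      refine ⟨e, mul_left_cancel₀ hp0 ?_⟩
      rw [h6]; push_cast; ring
    · rw [hsc, hCj]
    · rw [hint]; omega

/-- The vectors p⁻¹ g i span a subspace A of Y, totally isotropic because their Gram matrix is even.
It meets Λ = ker ψ trivially since ψ sends their classes to the independent reductions of the g i.
The K sought are the Lagrangian complements of Λ that contain A. -/
theorem count_neighbours_over (hq : IsModPForm p B L q) (hB : B.IsSymm) (hL : IsEvenIntegral B L)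
    (hu : PUnimodular p B L) (v : Basis (Fin (finrank ℚ V)) ℤ L) (hC : TotIso q C) {j : ℕ}
    (hCj : finrank (ZMod p) C = j) {ι : Type*} [Fintype ι] (g : ι → L)
    (hgC : ∀ i, red p L (g i) ∈ C) (hli : LinearIndependent (ZMod p) fun i => red p L (g i))
    (hge : IsEvenMatrix (gram B fun i => (p : ℚ)⁻¹ • (g i : V))) {n : ℕ}
    (hn : Fintype.card ι + n = j) :
    count (fun K => (K ∈ neighbours p B L j ∧ scaledImage p L K = C) ∧
      ∀ i, (p : ℚ)⁻¹ • (g i : V) ∈ K) = (p : ℚ) ^ (n * (n - 1) / 2) := by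
  have hp0 : (p : ℚ) ≠ 0 := by exact_mod_cast (Fact.out : p.Prime).ne_zero
  have nd := hq.nondegenerate hB hL hu
  have hperp := finrank_perp nd C
  obtain ⟨Y, _, _, π, hπ⟩ := exists_fibreQuotient hC
  have := hπ.finite v
  obtain ⟨ψ, φ, hψ, hφ, hψφ, hψr, hφk⟩ := hπ.exists_maps
  obtain ⟨qY, ndY, hqY, hqY'⟩ := exists_fibre_form hq hB hL hu hC hπ
  have hφj : finrank (ZMod p) (LinearMap.range φ) = j := by
    have := LinearMap.finrank_range_add_finrank_ker φ
    rw [hφk] at this; omega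
  have hY : finrank (ZMod p) Y = 2 * j := by
    have := LinearMap.finrank_range_add_finrank_ker ψ
    rw [hψφ, hψr] at this; omega
  obtain ⟨hto, hfrom⟩ := neighbours_over_iff hq hB hL hu v hC hCj hπ hψ hφ hψφ hφj hY hqY
  let x : ι → hatLattice p L C := fun i => ⟨_, inv_smul_mem_hatLattice.2 (hgC i)⟩
  have hψx : ψ ∘ (fun i => π (x i)) = fun i => red p L (g i) := by
    funext i
    refine hψ (x i) (g i) ?_
    change (p : ℚ) • ((p : ℚ)⁻¹ • (g i : V)) = _
    rw [smul_smul, mul_inv_cancel₀ hp0, one_smul]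
  set A : Submodule (ZMod p) Y := Submodule.span (ZMod p) (Set.range fun i => π (x i)) with hA
  have hAli : LinearIndependent (ZMod p) fun i => π (x i) :=
    LinearIndependent.of_comp ψ (by rw [hψx]; exact hli)
  have hAΛ : A ⊓ LinearMap.range φ = ⊥ := by
    rw [← hψφ]
    exact (Submodule.range_ker_disjoint (by rw [hψx]; exact hli)).eq_bot
  have hAc : finrank (ZMod p) A + n = j := by
    rw [hA, finrank_span_eq_card hAli, hn]
  have hAiso : TotIso qY A := by
    refine totIso_span _ (fun i => ?_) fun i i' => ?_
    · obtain ⟨m, hm⟩ := hge.2 i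
      change B (x i : V) (x i : V) = _ at hm
      rw [hqY (x i) (p * m) (by rw [hm]; push_cast; ring)]
      simp
    · obtain ⟨m, hm⟩ := hge.1 i i'
      change B (x i : V) (x i' : V) = _ at hm
      rw [hqY' (x i) (x i') (p * m) (by rw [hm]; push_cast; ring)]
      simp
  have hΛ : TotIso qY (LinearMap.range φ) := by
    rintro _ ⟨w, rfl⟩
    obtain ⟨y, rfl⟩ := red_surjective p L w
    obtain ⟨m, hm⟩ := hL y y.2
    rw [hφ, hqY ⟨y, le_hatLattice y.2⟩ (p * m) (by
      change p * B (y : V) (y : V) = _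
      rw [hm]; push_cast; ring)]
    simp
  have hcount := count_complements ndY hY hΛ hφj n A hAiso hAΛ hAc
  rw [ZMod.card] at hcount
  rw [← hcount]
  unfold count
  congr 1
  refine Nat.card_congr ⟨fun K => ⟨spaceOf π K.1, ?_⟩, fun D => ⟨latticeOf π D.1, ?_⟩, ?_, ?_⟩
  · obtain ⟨⟨hc, -⟩, ⟨h1, h2⟩, h3⟩ := hto K.1 K.2.1
    refine ⟨⟨?_, h1, h2⟩, h3⟩
    rw [hA, Submodule.span_le]
    rintro _ ⟨i, rfl⟩
    exact (hπ.mem_spaceOf hc).2 (K.2.2 i)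
  · obtain ⟨D, ⟨hAD, h1, h2⟩, h3⟩ := D
    refine ⟨hfrom D ⟨⟨h1, h2⟩, h3⟩, fun i => ?_⟩
    exact coe_mem_latticeOf.2 (hAD (Submodule.subset_span ⟨i, rfl⟩) : π (x i) ∈ D)
  · rintro ⟨K, hK⟩
    obtain ⟨⟨hc, hc'⟩, -⟩ := hto K hK.1
    exact Subtype.ext (hπ.latticeOf_spaceOf hc hc')
  · rintro ⟨D, hD⟩
    exact Subtype.ext (hπ.spaceOf_latticeOf D)

end fibre

end

end SiegelTheta

/-! ### The coefficients `b_j(Ω)` -/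

namespace IsotropicCount

open Module

theorem count_fiberwise {α β : Type*} [Fintype β] (f : α → β) (P : α → Prop)
    (hfin : ∀ b, Finite {a // P a ∧ f a = b}) : count P = ∑ b, count fun a => P a ∧ f a = b := by
  have e : {a // P a} ≃ Σ b, {a // P a ∧ f a = b} :=
    { toFun := fun a => ⟨f a.1, a.1, a.2, rfl⟩
      invFun := fun a => ⟨a.2.1, a.2.2.1⟩
      left_inv := fun a => rfl
      right_inv := by rintro ⟨b, a, ha, rfl⟩; rfl }
  unfold count
  rw [Nat.card_congr e, Nat.card_sigma]
  push_cast; rfl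

variable {F W : Type*} [Field F] [Fintype F] [AddCommGroup W] [Module F W] [Finite W]
  {q : QuadraticForm F W}

theorem span_le_perp_span {ι κ : Type*} (v : ι → W) (w : κ → W)
    (h : ∀ i i', QuadraticMap.polar q (v i) (w i') = 0) :
    Submodule.span F (Set.range v) ≤ perp q (Submodule.span F (Set.range w)) := by
  rw [Submodule.span_le]
  rintro _ ⟨i, rfl⟩
  refine mem_perp.2 fun x hx => ?_
  induction hx using Submodule.span_induction with
  | mem x hx => obtain ⟨j, rfl⟩ := hx; exact h i j
  | zero => exact QuadraticMap.polar_zero_right q _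
  | add a b _ _ ha hb => rw [QuadraticMap.polar_add_right, ha, hb, add_zero]
  | smul c a _ ha => rw [QuadraticMap.polar_smul_right, ha, smul_zero]

/-- If `A` is totally isotropic and orthogonal to `U`, the totally isotropic subspaces between
`A` and `A ⊕ U` correspond to those of `U`. -/
theorem isoSub_sup {A U : Submodule F W} (hA : TotIso q A) (hAU : A ≤ perp q U)
    (hinf : A ⊓ U = ⊥) (d : ℕ) : isoSub q A (A ⊔ U) (finrank F A + d) =
      count fun E : Submodule F W => E ≤ U ∧ finrank F E = d ∧ TotIso q E := by
  have hfin : ∀ E ≤ U, finrank F (A ⊔ E : Submodule F W) = finrank F A + finrank F E := by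
    intro E hE
    have h1 := Submodule.finrank_sup_add_finrank_inf_eq A E
    rw [show A ⊓ E = ⊥ from le_bot_iff.1 (hinf ▸ inf_le_inf_left A hE), finrank_bot] at h1
    exact h1
  have h₁ : ∀ E, A ≤ E → E ≤ A ⊔ U → A ⊔ (E ⊓ U) = E := by
    intro E hE hE'
    rw [inf_comm, ← sup_inf_assoc_of_le U hE]
    exact inf_eq_right.2 hE'
  have h₂ : ∀ E ≤ U, (A ⊔ E) ⊓ U = E := by
    intro E hE
    rw [sup_comm, sup_inf_assoc_of_le A hE, hinf, sup_bot_eq]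
  unfold isoSub count
  congr 1
  refine Nat.card_congr ⟨fun E => ⟨E.1 ⊓ U, ?_⟩, fun E => ⟨A ⊔ E.1, ?_⟩, ?_, ?_⟩
  · obtain ⟨E, hAE, hEU, hd, hE⟩ := E
    refine ⟨inf_le_right, ?_, hE.mono inf_le_left⟩
    have := hfin (E ⊓ U) inf_le_right
    rw [h₁ E hAE hEU] at this
    simp only
    omega
  · obtain ⟨E, hEU, hd, hE⟩ := E
    refine ⟨le_sup_left, sup_le_sup_left hEU A, by rw [hfin E hEU, hd], ?_⟩
    intro x hx
    obtain ⟨a, ha, e, he, rfl⟩ := Submodule.mem_sup.1 hx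
    rw [q_add, hA a ha, hE e he, mem_perp.1 (hAU ha) e (hEU he)]
    simp
  · rintro ⟨E, hAE, hEU, hd, hE⟩
    exact Subtype.ext (h₁ E hAE hEU)
  · rintro ⟨E, hEU, hd, hE⟩
    exact Subtype.ext (h₂ E hEU)

end IsotropicCount

namespace SiegelTheta

open Module IsotropicCount

noncomputable section

universe u

variable {V : Type u} [AddCommGroup V] [Module ℚ V]

section

variable {p : ℕ} {B : LinearMap.BilinForm ℚ V} {L : Submodule ℤ V}
  {q : QuadraticForm (ZMod p) (ModP p L)}

/-- The data of a nondegenerate quadratic space `L / pL`. -/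
structure GoodReduction (p : ℕ) (B : LinearMap.BilinForm ℚ V) (L : Submodule ℤ V)
    (q : QuadraticForm (ZMod p) (ModP p L)) : Prop where
  prime : Fact p.Prime
  finite : Finite (ModP p L)
  form : IsModPForm p B L q
  symm : B.IsSymm
  even : IsEvenIntegral B L
  unimodular : PUnimodular p B L
  basis : Nonempty (Basis (Fin (finrank ℚ V)) ℤ L)

/-- `Nat.card` of an infinite type is 0, whereas `count_neighbours_over` with an empty family gives
a power of p; so a nonempty fibre is finite. -/
theorem finite_over (h : GoodReduction p B L q) {j : ℕ} (C : Submodule (ZMod p) (ModP p L)) :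
    Finite {K // K ∈ neighbours p B L j ∧ scaledImage p L K = C} := by
  have := h.prime
  have := h.finite
  obtain ⟨v⟩ := h.basis
  by_cases hC : ∃ K, K ∈ neighbours p B L j ∧ scaledImage p L K = C
  · obtain ⟨K, hK, rfl⟩ := hC
    obtain ⟨-, -, hKe, hKj, -⟩ :=
      (mem_neighbours_iff Fact.out h.form h.symm h.even h.unimodular v).1 hK
    have h1 := count_neighbours_over h.form h.symm h.even h.unimodular v
      (scaledImage_totIso h.form hKe) hKj (ι := Fin 0) (fun i => i.elim0) (fun i => i.elim0)
      linearIndependent_empty_type ⟨fun i => i.elim0, fun i => i.elim0⟩ (n := j) (by simp)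
    refine Nat.finite_of_card_ne_zero fun h0 => ?_
    have h2 : count (fun K' => (K' ∈ neighbours p B L j ∧ scaledImage p L K' =
        scaledImage p L K) ∧ ∀ i : Fin 0, (p : ℚ)⁻¹ • ((i.elim0 : L) : V) ∈ K') = 0 := by
      rw [count_congr (t := fun K' => K' ∈ neighbours p B L j ∧ scaledImage p L K' =
        scaledImage p L K) fun K' => ⟨fun h => h.1, fun h => ⟨h, fun i => i.elim0⟩⟩]
      rw [count, h0, Nat.cast_zero]
    rw [h2] at h1
    have hp : (p : ℚ) ≠ 0 := by exact_mod_cast (Fact.out : p.Prime).ne_zero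
    exact pow_ne_zero _ hp h1.symm
  · have : IsEmpty {K // K ∈ neighbours p B L j ∧ scaledImage p L K = C} :=
      ⟨fun K => hC ⟨K.1, K.2⟩⟩
    infer_instance

theorem finite_neighbours (h : GoodReduction p B L q) (j : ℕ) : (neighbours p B L j).Finite := by
  have := h.finite
  have h1 : neighbours p B L j = ⋃ C : Submodule (ZMod p) (ModP p L),
      {K | K ∈ neighbours p B L j ∧ scaledImage p L K = C} := by
    ext K; simp
  rw [h1]
  refine Set.finite_iUnion fun C => ?_
  exact Set.finite_coe_iff.1 (finite_over h C)

variable {n : ℕ} {x : Fin n → V}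

/-- The subspace `Ω̄₀` of `L / pL`. -/
def Decomposition.omegaZeroBar (D : Decomposition p L x) : Submodule (ZMod p) (ModP p L) :=
  Submodule.span (ZMod p) (Set.range fun i : {i // D.part i = 0} => red p L (D.gen i.1))

theorem Decomposition.coe_zero (D : Decomposition p L x) {i : Fin n} (hi : D.part i = 0) :
    x i = (p : ℚ)⁻¹ • (D.gen i : V) := by
  rw [D.eq_smul, hi]; simp

theorem Decomposition.coe_one (D : Decomposition p L x) {i : Fin n} (hi : D.part i = 1) :
    x i = (D.gen i : V) := by
  rw [D.eq_smul, hi]; simp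

theorem Decomposition.coe_two (D : Decomposition p L x) {i : Fin n} (hi : D.part i = 2) :
    x i = (p : ℚ) • (D.gen i : V) := by
  rw [D.eq_smul, hi]; simp

theorem Decomposition.linearIndependent (D : Decomposition p L x) {s : Fin 3} (hs : s ≠ 2) :
    LinearIndependent (ZMod p) fun i : {i // D.part i = s} => red p L (D.gen i.1) :=
  D.primitive.comp (fun i : {i // D.part i = s} => ⟨i.1, by rw [i.2]; exact hs⟩)
    fun i i' h => Subtype.ext (congrArg (fun z : {i // D.part i ≠ 2} => z.1) h)

theorem Decomposition.finrank_zero [Fact p.Prime] (D : Decomposition p L x) :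
    finrank (ZMod p) D.omegaZeroBar = D.rank 0 :=
  finrank_span_eq_card (D.linearIndependent (by decide))

theorem Decomposition.finrank_one [Fact p.Prime] (D : Decomposition p L x) :
    finrank (ZMod p) D.omegaOneBar = D.rank 1 :=
  finrank_span_eq_card (D.linearIndependent (by decide))

theorem Decomposition.inf_eq_bot [Fact p.Prime] (D : Decomposition p L x) :
    D.omegaZeroBar ⊓ D.omegaOneBar = ⊥ := by
  have h := D.primitive.disjoint_span_image
    (s := {i : {i // D.part i ≠ 2} | D.part i.1 = 0})
    (t := {i : {i // D.part i ≠ 2} | D.part i.1 = 1}) (by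
      rw [Set.disjoint_left]
      intro i hi hi'
      exact absurd ((show D.part i.1 = 0 from hi).symm.trans hi') (by decide))
  refine (h.mono ?_ ?_).eq_bot
  · refine Submodule.span_mono ?_
    rintro _ ⟨i, rfl⟩
    exact ⟨⟨i.1, by rw [i.2]; decide⟩, i.2, rfl⟩
  · refine Submodule.span_mono ?_
    rintro _ ⟨i, rfl⟩
    exact ⟨⟨i.1, by rw [i.2]; decide⟩, i.2, rfl⟩

theorem Decomposition.totIso_zero [Fact p.Prime] (D : Decomposition p L x) (h : GoodReduction p B L q)
    (hx : IsEvenMatrix (gram B x)) : TotIso q D.omegaZeroBar := by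
  have hp0 : (p : ℚ) ≠ 0 := by exact_mod_cast h.prime.out.ne_zero
  refine totIso_span _ (fun i => ?_) fun i i' => ?_
  · obtain ⟨m, hm⟩ := hx.2 i
    simp only [gram, Matrix.of_apply] at hm
    rw [D.coe_zero i.2, map_smul, map_smul, LinearMap.smul_apply, smul_eq_mul, smul_eq_mul] at hm
    rw [h.form.apply_red _ (p * p * m)]
    · simp
    · push_cast; field_simp at hm; rw [hm]; ring
  · obtain ⟨m, hm⟩ := hx.1 i i'
    simp only [gram, Matrix.of_apply] at hm
    rw [D.coe_zero i.2, D.coe_zero i'.2, map_smul, map_smul, LinearMap.smul_apply, smul_eq_mul,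
      smul_eq_mul] at hm
    rw [polar_red_eq_zero_iff h.form h.symm h.even]
    refine ⟨p * m, ?_⟩
    push_cast; field_simp at hm; rw [hm]; ring

theorem Decomposition.zero_le_perp_one (D : Decomposition p L x) [Finite (ModP p L)]
    [Fact p.Prime] (h : GoodReduction p B L q)
    (hx : IsEvenMatrix (gram B x)) : D.omegaZeroBar ≤ perp q D.omegaOneBar := by
  have hp0 : (p : ℚ) ≠ 0 := by exact_mod_cast h.prime.out.ne_zero
  refine span_le_perp_span _ _ fun i i' => ?_
  obtain ⟨m, hm⟩ := hx.1 i i'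
  simp only [gram, Matrix.of_apply] at hm
  rw [D.coe_zero i.2, D.coe_one i'.2, map_smul, LinearMap.smul_apply, smul_eq_mul] at hm
  rw [polar_red_eq_zero_iff h.form h.symm h.even]
  refine ⟨m, ?_⟩
  field_simp at hm; exact hm

/-- Fibre the K over C. Those containing Ω have Ω̄₀ ⊆ C and Ω̄₁ ⊆ C^⊥. Conversely, over such a C
only p⁻¹Ω₀ imposes a condition on K, because K contains `coreLattice` of C^⊥ and pL. The number of K
over C depends only on j − r₀. -/
theorem count_neighbours (D : Decomposition p L x) (h : GoodReduction p B L q) [Fact p.Prime]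
    [Finite (ModP p L)] (hx : IsEvenMatrix (gram B x)) (j : ℕ) :
    count (fun K => K ∈ neighbours p B L j ∧ ∀ i, x i ∈ K) =
      (p : ℚ) ^ ((j - D.rank 0) * (j - D.rank 0 - 1) / 2) *
        isoSub q D.omegaZeroBar (perp q (D.omegaZeroBar ⊔ D.omegaOneBar)) j := by
  classical
  cases nonempty_fintype (Submodule (ZMod p) (ModP p L))
  obtain ⟨v⟩ := h.basis
  have hp : p.Prime := Fact.out
  have hp0 : (p : ℚ) ≠ 0 := by exact_mod_cast hp.ne_zero
  have nd := h.form.nondegenerate h.symm h.even h.unimodular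
  have hW : finrank (ZMod p) (ModP p L) = finrank ℚ V := by
    obtain ⟨b, -⟩ := exists_modP_basis (p := p) v
    rw [finrank_eq_card_basis b, Fintype.card_fin]
  have hfin : ∀ C, Finite {K // (K ∈ neighbours p B L j ∧ ∀ i, x i ∈ K) ∧
      scaledImage p L K = C} := fun C => by
    have := finite_over h (j := j) C
    exact Finite.of_injective (β := {K // K ∈ neighbours p B L j ∧ scaledImage p L K = C})
      (fun K => ⟨K.1, K.2.1.1, K.2.2⟩)
      fun K K' hK => Subtype.ext (congrArg (fun z => z.1) hK)
  rw [count_fiberwise (scaledImage p L) _ hfin, isoSub, count_eq_sum, Finset.mul_sum]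
  refine Finset.sum_congr rfl fun C _ => ?_
  split_ifs with hC
  · obtain ⟨hAC, hCU, hCj, hCiso⟩ := hC
    rw [mul_one]
    have hr0 : D.rank 0 ≤ j := by
      rw [← D.finrank_zero, ← hCj]
      exact Submodule.finrank_mono hAC
    have hmemC : ∀ i : {i // D.part i = 0}, red p L (D.gen i.1) ∈ C := fun i =>
      hAC (Submodule.subset_span ⟨i, rfl⟩)
    rw [← count_neighbours_over h.form h.symm h.even h.unimodular v hCiso hCj
      (fun i : {i // D.part i = 0} => D.gen i.1) hmemC
      (D.linearIndependent (by decide)) ⟨fun i i' => ?_, fun i => ?_⟩ (n := j - D.rank 0)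
      (by change D.rank 0 + _ = j; omega)]
    · refine count_congr fun K => ?_
      constructor
      · rintro ⟨⟨hK, hxK⟩, hKC⟩
        refine ⟨⟨hK, hKC⟩, fun i => ?_⟩
        rw [← D.coe_zero i.2]
        exact hxK i
      · rintro ⟨⟨hK, rfl⟩, hxK⟩
        refine ⟨⟨hK, fun i => ?_⟩, rfl⟩
        obtain ⟨h₁, h₂, hKe, -, hKD⟩ :=
          (mem_neighbours_iff hp h.form h.symm h.even h.unimodular v).1 hK
        have hperp := finrank_perp nd (scaledImage p L K)
        have heq : interImage p L K = perp q (scaledImage p L K) :=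
          Submodule.eq_of_le_of_finrank_eq (interImage_le_perp h.form h.symm h.even hKe) (by omega)
        obtain hi | hi | hi : D.part i = 0 ∨ D.part i = 1 ∨ D.part i = 2 := by
          generalize D.part i = s
          revert s; decide
        · rw [D.coe_zero hi]
          exact hxK ⟨i, hi⟩
        · rw [D.coe_one hi]
          refine coreLattice_le heq.ge h₁ (coe_mem_coreLattice.2 ?_)
          have h3 := le_perp_comm.1 (hCU.trans (perp_anti le_sup_right))
          exact h3 (Submodule.subset_span ⟨⟨i, hi⟩, rfl⟩)
        · rw [D.coe_two hi]
          exact h₁ _ (D.gen i).2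
    · simpa only [gram, Matrix.of_apply, D.coe_zero i.2, D.coe_zero i'.2] using hx.1 i i'
    · simpa only [gram, Matrix.of_apply, D.coe_zero i.2] using hx.2 i
  · rw [mul_zero, count]
    have : IsEmpty {K // (K ∈ neighbours p B L j ∧ ∀ i, x i ∈ K) ∧ scaledImage p L K = C} := by
      refine ⟨fun ⟨K, ⟨hK, hxK⟩, hKC⟩ => hC ?_⟩
      subst hKC
      obtain ⟨h₁, h₂, hKe, hKj, -⟩ :=
        (mem_neighbours_iff hp h.form h.symm h.even h.unimodular v).1 hK
      have hiso := scaledImage_totIso h.form hKe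
      have h0 : D.omegaZeroBar ≤ scaledImage p L K := by
        refine Submodule.span_le.2 ?_
        rintro _ ⟨i, rfl⟩
        refine mem_scaledImage.2 ⟨_, ?_, rfl⟩
        rw [← D.coe_zero i.2]
        exact hxK i
      have h1 : D.omegaOneBar ≤ interImage p L K := by
        refine Submodule.span_le.2 ?_
        rintro _ ⟨i, rfl⟩
        refine mem_interImage.2 ⟨_, ?_, rfl⟩
        rw [← D.coe_one i.2]
        exact hxK i
      refine ⟨h0, ?_, hKj, hiso⟩
      rw [perp_sup]
      exact le_inf (hiso.le_perp.trans (perp_anti h0))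
        (le_perp_comm.1 (h1.trans (interImage_le_perp h.form h.symm h.even hKe)))
    simp

theorem phi_eq [Fact p.Prime] (h : GoodReduction p B L q) (U : Submodule (ZMod p) (ModP p L)) (l : ℕ) :
    (phi p B L U l : ℚ) = count fun E : Submodule (ZMod p) (ModP p L) =>
      E ≤ U ∧ finrank (ZMod p) E = l ∧ TotIso q E := by
  rw [phi]
  refine count_congr fun E => ?_
  have hp := h.prime.out
  refine and_congr_right fun _ => and_congr_right fun _ => forall₂_congr fun w _ => ?_
  exact h.form.redForm_eq_zero_iff hp h.symm h.even w

/-- Reverses the order of the denominators, to match `coef`. -/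
theorem beta_eq (p : ℕ) (m : ℤ) (r : ℕ) : beta p m r =
    ∏ t ∈ Finset.range r, ((p : ℚ) ^ (m - t) - 1) / ((p : ℚ) ^ ((t : ℤ) + 1) - 1) := by
  rw [beta, Finset.prod_div_distrib, Finset.prod_div_distrib]
  congr 1
  rw [← Finset.prod_range_reflect]
  refine Finset.prod_congr rfl fun t ht => ?_
  have := Finset.mem_range.1 ht
  congr 2
  omega

/-- The denominators in `coef` sit under the second product. For ε = −1 it is the first product that
has numerators of the form P^t − 1, so the denominators are moved there and β and δ trade places. -/
theorem coef_eq (p : ℕ) {ε : ℚ} (M s : ℤ) {n l : ℕ} (hl : l ≤ n) :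
    (ε = 1 → coef p ε M s n l = (p : ℚ) ^ ((l : ℤ) * (s - n + l)) *
      delta p (M - l - 1) (n - l) * beta p s (n - l)) ∧
    (ε = -1 → coef p ε M s n l = (-1) ^ l * (p : ℚ) ^ ((l : ℤ) * (s - n + l)) *
      beta p (M - l - 1) (n - l) * delta p s (n - l)) := by
  constructor
  · rintro rfl
    rw [coef, if_pos hl, delta, beta_eq p]
    ring
  · rintro rfl
    rw [coef, if_pos hl, delta, beta_eq p]
    simp only [Finset.prod_div_distrib, sub_neg_eq_add, ← sub_eq_add_neg]
    ring

theorem count_neighbours_eq_sum [Fact p.Prime] (D : Decomposition p L x) (h : GoodReduction p B L q)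
    (hx : IsEvenMatrix (gram B x)) {k : ℕ} (hk : finrank ℚ V = 2 * k) (j : ℕ) :
    count (fun K => K ∈ neighbours p B L j ∧ ∀ i, x i ∈ K) =
      (p : ℚ) ^ ((j - D.rank 0) * (j - D.rank 0 - 1) / 2) *
        ∑ l ∈ (Finset.range (j + 1)).filter (fun l => l + D.rank 0 ≤ j),
          coef p (wittSign q k) ((k : ℤ) - D.rank 0) ((k : ℤ) - D.rank 0 - D.rank 1)
            (j - D.rank 0) l * phi p B L D.omegaOneBar l := by
  have := h.finite
  have nd := h.form.nondegenerate h.symm h.even h.unimodular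
  have hW : finrank (ZMod p) (ModP p L) = 2 * k := by
    obtain ⟨v⟩ := h.basis
    obtain ⟨b, -⟩ := exists_modP_basis (p := p) v
    rw [finrank_eq_card_basis b, Fintype.card_fin, hk]
  rw [count_neighbours D h hx]
  congr 1
  by_cases hj : D.rank 0 ≤ j
  · obtain ⟨n', rfl⟩ := Nat.exists_eq_add_of_le hj
    have hA := D.totIso_zero h hx
    have hA1 := D.zero_le_perp_one h hx
    have hU : finrank (ZMod p) (D.omegaZeroBar ⊔ D.omegaOneBar : Submodule _ _) =
        D.rank 0 + D.rank 1 := by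
      have := Submodule.finrank_sup_add_finrank_inf_eq D.omegaZeroBar D.omegaOneBar
      rwa [D.inf_eq_bot, finrank_bot, add_zero, D.finrank_zero, D.finrank_one] at this
    have h1 := isoSub_perp nd hW (D.omegaZeroBar ⊔ D.omegaOneBar) n' D.omegaZeroBar hA le_sup_left
      (by rw [perp_sup]; exact le_inf hA.le_perp hA1)
    have h2 : ∀ l, isoSub q D.omegaZeroBar (D.omegaZeroBar ⊔ D.omegaOneBar) (D.rank 0 + l) =
        phi p B L D.omegaOneBar l := fun l => by
      rw [phi_eq h, ← isoSub_sup hA hA1 D.inf_eq_bot, D.finrank_zero]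
    simp only [D.finrank_zero, hU, ZMod.card, h2] at h1
    rw [h1]
    have hfilter : (Finset.range (D.rank 0 + n' + 1)).filter (fun l => l + D.rank 0 ≤
        D.rank 0 + n') = Finset.range (n' + 1) := by
      ext l; simp only [Finset.mem_filter, Finset.mem_range]; omega
    rw [hfilter]
    refine Finset.sum_congr rfl fun l _ => ?_
    rw [Nat.add_sub_cancel_left]
    push_cast
    rw [sub_sub]
  -- For j < r₀ no j-dimensional subspace contains Ω̄₀ and the sum is empty; the truncated j − r₀ in
  -- the prefactor is then harmless.
  · rw [isoSub_eq_zero_of_lt (by rw [D.finrank_zero]; omega), Finset.filter_false_of_mem,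
      Finset.sum_empty]
    intro l _
    omega

/-- `χ(p)` is the sign of the quadratic space `L / pL`. -/
theorem wittSign_eq_chi [Fact p.Prime] (h : GoodReduction p B L q) {k : ℕ} (hk : finrank ℚ V = 2 * k) :
    wittSign q k = chi p B L := by
  have := h.finite
  have nd := h.form.nondegenerate h.symm h.even h.unimodular
  have hW : finrank (ZMod p) (ModP p L) = 2 * k := by
    obtain ⟨v⟩ := h.basis
    obtain ⟨b, -⟩ := exists_modP_basis (p := p) v
    rw [finrank_eq_card_basis b, Fintype.card_fin, hk]
  have h1 := wittSign_eq_one_iff nd hW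
  rw [← h.form.isHyperbolic_iff h.prime.out h.symm h.even] at h1
  unfold chi
  split_ifs with hh
  · rw [h1.2 hh]; simp
  · rcases wittSign_cases (q := q) k with h2 | h2
    · exact absurd (h1.1 h2) hh
    · rw [h2]; simp

theorem count_neighbours_eq_formula [Fact p.Prime] (D : Decomposition p L x) (h : GoodReduction p B L q)
    (hx : IsEvenMatrix (gram B x)) {k : ℕ} (hk : finrank ℚ V = 2 * k) (j : ℕ) :
    (chi p B L = 1 → count (fun K => K ∈ neighbours p B L j ∧ ∀ i, x i ∈ K) =
      formulaPlus p B k j D) ∧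
    (chi p B L = -1 → count (fun K => K ∈ neighbours p B L j ∧ ∀ i, x i ∈ K) =
      formulaMinus p B k j D) := by
  rw [count_neighbours_eq_sum D h hx hk j, wittSign_eq_chi h hk]
  constructor
  · intro hχ
    rw [formulaPlus]
    congr 1
    refine Finset.sum_congr rfl fun l hl => ?_
    have hl' := (Finset.mem_filter.1 hl).2
    rw [(coef_eq p _ _ (by omega)).1 (by rw [hχ]; simp)]
    rw [show (l : ℤ) * ((k : ℤ) - D.rank 0 - D.rank 1 - (j - D.rank 0 : ℕ) + l) =
      (l : ℤ) * ((k : ℤ) - j - D.rank 1 + l) by push_cast [show D.rank 0 ≤ j by omega]; ring]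
    ring
  · intro hχ
    rw [formulaMinus]
    congr 1
    refine Finset.sum_congr rfl fun l hl => ?_
    have hl' := (Finset.mem_filter.1 hl).2
    rw [(coef_eq p _ _ (by omega)).2 (by rw [hχ]; simp)]
    rw [show (l : ℤ) * ((k : ℤ) - D.rank 0 - D.rank 1 - (j - D.rank 0 : ℕ) + l) =
      (l : ℤ) * ((k : ℤ) - j - D.rank 1 + l) by push_cast [show D.rank 0 ≤ j by omega]; ring]
    ring

end

end

end SiegelTheta

/-! ### Formal lattices and their decompositions -/

namespace SiegelTheta

open Module IsotropicCount

noncomputable section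

variable {V : Type*} [AddCommGroup V] [Module ℚ V] {n : ℕ}

/-- The basis `(x_1, …, x_n) G`. -/
def frameMul (x : Fin n → V) (G : Matrix (Fin n) (Fin n) ℤ) : Fin n → V :=
  fun i => ∑ i', G i' i • x i'

theorem frameMul_frameMul (x : Fin n → V) (G H : Matrix (Fin n) (Fin n) ℤ) :
    frameMul (frameMul x G) H = frameMul x (G * H) := by
  funext i
  simp only [frameMul, Finset.smul_sum, smul_smul, Matrix.mul_apply, Finset.sum_smul]
  rw [Finset.sum_comm]
  exact Finset.sum_congr rfl fun a _ => Finset.sum_congr rfl fun b _ => by rw [mul_comm]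

theorem frameMul_one (x : Fin n → V) : frameMul x 1 = x := by
  funext i
  simp [frameMul, Matrix.one_apply]

theorem mem_frames {k : ℕ} {x y : Fin n → V} : y ∈ frames k x ↔
    ∃ G ∈ frameGroup n k, y = frameMul x (G : Matrix (Fin n) (Fin n) ℤ) := by
  simp only [frames, frameMul, funext_iff]
  rfl

theorem self_mem_frames (k : ℕ) (x : Fin n → V) : x ∈ frames k x :=
  mem_frames.2 ⟨1, one_mem _, (frameMul_one x).symm⟩

theorem frames_trans {k : ℕ} {x y z : Fin n → V} (h₁ : y ∈ frames k x) (h₂ : z ∈ frames k y) :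
    z ∈ frames k x := by
  obtain ⟨G, hG, rfl⟩ := mem_frames.1 h₁
  obtain ⟨H, hH, rfl⟩ := mem_frames.1 h₂
  refine mem_frames.2 ⟨G * H, mul_mem hG hH, ?_⟩
  rw [frameMul_frameMul]; rfl

theorem frames_symm {k : ℕ} {x y : Fin n → V} (h : y ∈ frames k x) : x ∈ frames k y := by
  obtain ⟨G, hG, rfl⟩ := mem_frames.1 h
  refine mem_frames.2 ⟨G⁻¹, inv_mem hG, ?_⟩
  rw [frameMul_frameMul, ← Units.val_mul, mul_inv_cancel]
  exact (frameMul_one x).symm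

theorem frames_eq {k : ℕ} {x y : Fin n → V} (h : y ∈ frames k x) : frames k y = frames k x :=
  Set.ext fun _ => ⟨fun hz => frames_trans h hz, fun hz => frames_trans (frames_symm h) hz⟩

theorem frames_mem {k : ℕ} {x y : Fin n → V} (h : y ∈ frames k x) (M : Submodule ℤ V)
    (hx : ∀ i, x i ∈ M) (i : Fin n) : y i ∈ M := by
  obtain ⟨G, -, rfl⟩ := mem_frames.1 h
  exact Submodule.sum_mem _ fun i' _ => M.smul_mem _ (hx i')

theorem isEvenIntegral_span {B : LinearMap.BilinForm ℚ V} (hB : B.IsSymm) {x : Fin n → V}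
    (hx : IsEvenMatrix (gram B x)) : IsEvenIntegral B (Submodule.span ℤ (Set.range x)) := by
  have h1 : ∀ i, ∀ y ∈ Submodule.span ℤ (Set.range x), ∃ m : ℤ, B (x i) y = m := by
    intro i y hy
    induction hy using Submodule.span_induction with
    | mem y hy => obtain ⟨i', rfl⟩ := hy; exact hx.1 i i'
    | zero => exact ⟨0, by simp⟩
    | add a b _ _ ha hb =>
      obtain ⟨c, hc⟩ := ha
      obtain ⟨d, hd⟩ := hb
      exact ⟨c + d, by rw [map_add, hc, hd]; push_cast; rfl⟩
    | smul r a _ ha =>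
      obtain ⟨c, hc⟩ := ha
      exact ⟨r * c, by rw [bilin_zsmul_right, hc]; push_cast; rfl⟩
  have h2 : ∀ z ∈ Submodule.span ℤ (Set.range x), ∀ y ∈ Submodule.span ℤ (Set.range x),
      ∃ m : ℤ, B z y = m := by
    intro z hz y hy
    induction hz using Submodule.span_induction with
    | mem z hz => obtain ⟨i', rfl⟩ := hz; exact h1 i' y hy
    | zero => exact ⟨0, by simp⟩
    | add a b _ _ ha hb =>
      obtain ⟨c, hc⟩ := ha
      obtain ⟨d, hd⟩ := hb
      exact ⟨c + d, by rw [map_add, LinearMap.add_apply, hc, hd]; push_cast; rfl⟩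
    | smul r a _ ha =>
      obtain ⟨c, hc⟩ := ha
      exact ⟨r * c, by rw [bilin_zsmul_left, hc]; push_cast; rfl⟩
  intro y hy
  induction hy using Submodule.span_induction with
  | mem y hy => obtain ⟨i, rfl⟩ := hy; exact hx.2 i
  | zero => exact ⟨0, by simp⟩
  | add a b ha' hb' ha hb =>
    obtain ⟨c, hc⟩ := ha
    obtain ⟨d, hd⟩ := hb
    obtain ⟨e, he⟩ := h2 a ha' b hb'
    have hs : B b a = B a b := hB.eq _ _
    refine ⟨c + d + e, ?_⟩
    simp only [map_add, LinearMap.add_apply, hc, hd, hs, he]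
    push_cast; ring
  | smul r a _ ha =>
    obtain ⟨c, hc⟩ := ha
    exact ⟨r * r * c, by rw [bilin_zsmul_left, bilin_zsmul_right, hc]; push_cast; ring⟩

theorem isEvenMatrix_gram {B : LinearMap.BilinForm ℚ V} (hB : B.IsSymm) {K : Submodule ℤ V}
    (hK : IsEvenIntegral B K) {x : Fin n → V} (hx : ∀ i, x i ∈ K) : IsEvenMatrix (gram B x) :=
  ⟨fun i i' => hK.integral hB (hx i) (hx i'), fun i => hK _ (hx i)⟩

theorem isEvenMatrix_gram_of_mem_frames {B : LinearMap.BilinForm ℚ V} (hB : B.IsSymm) {k : ℕ}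
    {x y : Fin n → V} (hx : IsEvenMatrix (gram B x)) (hy : y ∈ frames k x) :
    IsEvenMatrix (gram B y) :=
  isEvenMatrix_gram hB (isEvenIntegral_span hB hx)
    (frames_mem hy _ fun i => Submodule.subset_span ⟨i, rfl⟩)

/-- Adding a combination of the other vectors to one vector of a basis. -/
theorem update_mem_frames (k : ℕ) (y : Fin n → V) (i₀ : Fin n) (d : Fin n → ℤ) (hd : d i₀ = 1) :
    Function.update y i₀ (∑ i, d i • y i) ∈ frames k y := by
  have hdet : ((1 : Matrix (Fin n) (Fin n) ℤ).updateCol i₀ d).det = 1 := by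
    rw [← Matrix.cramer_apply, Matrix.cramer_one]
    exact hd
  refine mem_frames.2 ⟨Matrix.SpecialLinearGroup.toGL ⟨_, hdet⟩, ?_, ?_⟩
  · unfold frameGroup
    split_ifs
    · trivial
    · rw [MonoidHom.mem_ker]
      ext
      exact hdet
  · funext i
    change _ = ∑ i', ((1 : Matrix (Fin n) (Fin n) ℤ).updateCol i₀ d) i' i • y i'
    by_cases hi : i = i₀
    · subst hi; simp
    · rw [Function.update_of_ne hi]
      simp [Matrix.updateCol_ne hi, Matrix.one_apply]

/-- Write y i = p^(e i − 1) g i. A linear relation modulo p among the g i with e i < 2 allows one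
basis vector to be replaced by a combination divisible by one more power of p, which raises the sum
of the e i. That sum is at most 2n, and m bounds the number of steps left. -/
theorem exists_decomposition_aux {p : ℕ} (hp : p.Prime) (L : Submodule ℤ V) (k m : ℕ) :
    ∀ (y : Fin n → V) (e : Fin n → ℕ) (g : Fin n → L), (∀ i, e i ≤ 2) →
      (∀ i, y i = (p : ℚ) ^ ((e i : ℤ) - 1) • (g i : V)) → 2 * n ≤ (∑ i, e i) + m →
        ∃ z ∈ frames k y, Nonempty (Decomposition p L z) := by
  have := Fact.mk hp
  have hp0 : (p : ℚ) ≠ 0 := by exact_mod_cast hp.ne_zero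
  induction m with
  | zero =>
    intro y e g he hy hm
    refine ⟨y, self_mem_frames k y, ⟨⟨fun i => ⟨e i, by have := he i; omega⟩, g, hy, ?_⟩⟩⟩
    have h2 : ∀ i, e i = 2 := by
      by_contra h
      push Not at h
      obtain ⟨i, hi⟩ := h
      have h3 : ∑ i, e i < ∑ _i : Fin n, 2 :=
        Finset.sum_lt_sum (fun i _ => he i) ⟨i, Finset.mem_univ i, lt_of_le_of_ne (he i) hi⟩
      simp at h3
      omega
    have : IsEmpty {i // (⟨e i, by have := he i; omega⟩ : Fin 3) ≠ 2} :=
      ⟨fun i => i.2 (Fin.ext (h2 i.1))⟩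
    exact linearIndependent_empty_type
  | succ m ih =>
    intro y e g he hy hm
    by_cases hli : LinearIndependent (ZMod p) fun i : {i // e i ≠ 2} => red p L (g i.1)
    · refine ⟨y, self_mem_frames k y, ⟨⟨fun i => ⟨e i, by have := he i; omega⟩, g, hy, ?_⟩⟩⟩
      refine hli.comp (fun i : {i // (⟨e i, by have := he i; omega⟩ : Fin 3) ≠ 2} =>
        ⟨i.1, fun h => i.2 (Fin.ext h)⟩) ?_
      exact fun i i' h => Subtype.ext (congrArg (fun z : {i // e i ≠ 2} => z.1) h)
    · rw [Fintype.not_linearIndependent_iff] at hli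
      obtain ⟨c, hc, i₁, hi₁⟩ := hli
      -- Choosing e i₀ maximal among the indices in the relation makes the multipliers p^(e i₀ − e
      -- i) integral.
      obtain ⟨i₀, hi₀, hmax⟩ := Finset.exists_max_image
        (Finset.univ.filter fun i => c i ≠ 0) (fun i => e i.1) ⟨i₁, by simpa using hi₁⟩
      replace hi₀ : c i₀ ≠ 0 := (Finset.mem_filter.1 hi₀).2
      -- Integral lifts of the relation normalised at i₀. The lift there is exactly 1, not merely 1
      -- modulo p, so that the change of basis has determinant one and also preserves orientation.
      have hex : ∀ i : Fin n, ∃ t : ℤ, (∀ h : e i ≠ 2, (t : ZMod p) = (c i₀)⁻¹ * c ⟨i, h⟩) ∧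
          (t ≠ 0 → e i ≤ e i₀.1) ∧ (e i = 2 → t = 0) ∧ (i = i₀.1 → t = 1) := by
        intro i
        by_cases h2 : e i = 2
        · exact ⟨0, fun h => absurd h2 h, fun h => absurd rfl h, fun _ => rfl,
            fun h => absurd (h ▸ h2) i₀.2⟩
        by_cases hi : i = i₀.1
        · subst hi
          exact ⟨1, fun _ => by simp [hi₀], fun _ => le_rfl, fun h => absurd h h2, fun _ => rfl⟩
        · by_cases h0 : c ⟨i, h2⟩ = 0
          · exact ⟨0, fun h => by simp [h0], fun h => absurd rfl h, fun _ => rfl,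
              fun h => absurd h hi⟩
          · obtain ⟨t, ht⟩ := ZMod.intCast_surjective ((c i₀)⁻¹ * c ⟨i, h2⟩)
            exact ⟨t, fun _ => ht, fun _ => hmax ⟨i, h2⟩ (by simpa using h0),
              fun h => absurd h h2, fun h => absurd h hi⟩
      choose t ht htle ht2 ht1 using hex
      have hsum : red p L (∑ i, t i • g i) = 0 := by
        rw [map_sum]
        have h1 : ∑ i, red p L (t i • g i) =
            ∑ i : {i // e i ≠ 2}, red p L (t i.1 • g i.1) := by
          rw [← Finset.sum_filter_add_sum_filter_not Finset.univ (fun i => e i ≠ 2)]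
          rw [Finset.sum_eq_zero (s := Finset.univ.filter fun i => ¬ e i ≠ 2), add_zero]
          · exact (Finset.sum_subtype _ (by simp) _)
          · intro i hi
            rw [ht2 i (not_not.1 (Finset.mem_filter.1 hi).2)]; simp
        rw [h1]
        have h2 : ∀ i : {i // e i ≠ 2}, red p L (t i.1 • g i.1) =
            (c i₀)⁻¹ • (c i • red p L (g i.1)) := by
          intro i
          rw [map_zsmul, ← Int.cast_smul_eq_zsmul (ZMod p), ht i.1 i.2, mul_smul]
        simp only [h2]
        rw [← Finset.smul_sum, hc, smul_zero]
      obtain ⟨h, hh, hgh⟩ := (red_eq_zero_iff p L _).1 hsum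
      let d : Fin n → ℤ := fun i => t i * (p : ℤ) ^ (e i₀.1 - e i)
      have hd1 : d i₀.1 = 1 := by simp [d, ht1]
      have hdy : ∑ i, d i • y i = (p : ℚ) ^ ((e i₀.1 : ℤ) + 1 - 1) • h := by
        have h1 : ∀ i, d i • y i = (p : ℚ) ^ ((e i₀.1 : ℤ) - 1) • (t i • (g i : V)) := by
          intro i
          by_cases h0 : t i = 0
          · simp [d, h0]
          · rw [hy i, ← Int.cast_smul_eq_zsmul ℚ, ← Int.cast_smul_eq_zsmul ℚ, smul_smul,
              smul_smul]
            congr 1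
            have hle := htle i h0
            simp only [d]
            push_cast
            rw [mul_comm, ← mul_assoc, mul_comm _ ((t i : ℤ) : ℚ), mul_comm _ ((t i : ℤ) : ℚ),
              mul_assoc]
            congr 1
            rw [← zpow_natCast, ← zpow_add₀ hp0]
            congr 1
            push_cast [hle]
            ring
        simp only [h1]
        rw [← Finset.smul_sum]
        have h2 : ∑ i, t i • (g i : V) = (p : ℚ) • h := by
          rw [← hgh]; push_cast; rfl
        rw [h2, smul_smul, ← zpow_add_one₀ hp0]
        congr 2
        ring
      obtain ⟨z, hz, hD⟩ := ih (Function.update y i₀.1 (∑ i, d i • y i))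
        (fun i => e i + if i = i₀.1 then 1 else 0) (Function.update g i₀.1 ⟨h, hh⟩) (by
          intro i
          have h1 := he i
          by_cases hi : i = i₀.1
          · have h2 := i₀.2
            rw [← hi] at h2
            rw [if_pos hi]; omega
          · rw [if_neg hi]; omega) (by
          intro i
          by_cases hi : i = i₀.1
          · subst hi
            simp only [Function.update_self, if_true]
            rw [hdy]
            push_cast; rfl
          · simp only [Function.update_of_ne hi, if_neg hi, add_zero]
            exact hy i) (by
          rw [Finset.sum_add_distrib]
          simp
          omega)
      exact ⟨z, frames_trans (update_mem_frames k y i₀.1 d hd1) hz, hD⟩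

/-- The decomposition `(1/p) Ω₀ ⊕ Ω₁ ⊕ p Ω₂`. -/
theorem exists_decomposition {p : ℕ} (hp : p.Prime) (L : Submodule ℤ V) (k : ℕ) (x : Fin n → V)
    (hx : ∀ i, (p : ℚ) • x i ∈ L) : ∃ z ∈ frames k x, Nonempty (Decomposition p L z) := by
  have hp0 : (p : ℚ) ≠ 0 := by exact_mod_cast hp.ne_zero
  refine exists_decomposition_aux hp L k (2 * n) x (fun _ => 0) (fun i => ⟨_, hx i⟩)
    (fun _ => by omega) (fun i => ?_) (by simp)
  simp [smul_smul, hp0]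

theorem thetaCoeff_frames (S : Set (Submodule ℤ V)) (k : ℕ) (x : Fin n → V) :
    (thetaCoeff S (frames k x) : ℚ) = count fun K => K ∈ S ∧ ∀ i, x i ∈ K := by
  have : {K ∈ S | ∀ y ∈ frames k x, ∀ i, y i ∈ K} = {K | K ∈ S ∧ ∀ i, x i ∈ K} := by
    ext K
    exact and_congr_right fun _ => ⟨fun h => h x (self_mem_frames k x),
      fun h y hy => frames_mem hy K h⟩
  rw [thetaCoeff, this]
  rfl

end

end SiegelTheta

/-! ### Convergence of theta series -/

namespace SiegelTheta

open Module

noncomputable section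

theorem summable_pi_prod {α : Type*} {k : ℕ} (f : Fin k → α → ℝ) (h0 : ∀ i x, 0 ≤ f i x)
    (hf : ∀ i, Summable (f i)) : Summable fun x : Fin k → α => ∏ i, f i (x i) := by
  induction k with
  | zero => exact (hasSum_fintype _).summable
  | succ k ih =>
    have h1 := ih (fun i => f i.succ) (fun i => h0 i.succ) fun i => hf i.succ
    have h2 := (hf 0).mul_of_nonneg h1 (h0 0) fun x => Finset.prod_nonneg fun i _ => h0 _ _
    rw [← (Fin.consEquiv fun _ : Fin (k + 1) => α).summable_iff]
    refine h2.congr fun x => ?_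
    simp [Fin.prod_univ_succ, Fin.consEquiv]

theorem summable_exp_neg_mul_sq {b : ℝ} (hb : 0 < b) :
    Summable fun m : ℤ => Real.exp (-b * (m : ℝ) ^ 2) := by
  have h1 : Summable fun m : ℕ => Real.exp (-b * (m : ℝ) ^ 2) := by
    refine Summable.of_nonneg_of_le (fun _ => (Real.exp_pos _).le) (fun m => ?_)
      (Real.summable_exp_nat_mul_iff.2 (neg_lt_zero.2 hb))
    rw [Real.exp_le_exp]
    have h2 : (m : ℝ) ≤ (m : ℝ) ^ 2 := by
      have : m ≤ m ^ 2 := Nat.le_self_pow two_ne_zero m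
      exact_mod_cast this
    nlinarith
  refine Summable.of_nat_of_neg ?_ ?_
  · simpa using h1
  · simpa using h1

/-- Take the minimum of the form on the compact unit sphere of the sup norm; dividing by n passes
from the sup norm to the sum of squares. -/
theorem exists_pos_le_dotProduct {n : ℕ} {Y : Matrix (Fin n) (Fin n) ℝ} (hY : Y.PosDef) :
    ∃ c : ℝ, 0 < c ∧ ∀ w : Fin n → ℝ, c * ∑ i, w i ^ 2 ≤ ∑ i, ∑ i', w i * w i' * Y i' i := by
  have hform : ∀ w : Fin n → ℝ, star w ⬝ᵥ Y.mulVec w = ∑ i, ∑ i', w i * w i' * Y i' i := by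
    intro w
    simp only [dotProduct, Matrix.mulVec, star_trivial, Finset.mul_sum]
    rw [Finset.sum_comm]
    exact Finset.sum_congr rfl fun i _ => Finset.sum_congr rfl fun i' _ => by ring
  simp only [← hform]
  rcases Nat.eq_zero_or_pos n with rfl | hn
  · refine ⟨1, one_pos, fun w => ?_⟩
    simp [dotProduct]
  have : Nonempty (Fin n) := ⟨⟨0, hn⟩⟩
  have hcont : Continuous fun w : Fin n → ℝ => star w ⬝ᵥ Y.mulVec w := by
    simp only [hform]
    fun_prop
  have hne : (Metric.sphere (0 : Fin n → ℝ) 1).Nonempty :=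
    NormedSpace.sphere_nonempty.2 zero_le_one
  obtain ⟨u, hu, hmin⟩ := (isCompact_sphere (0 : Fin n → ℝ) 1).exists_isMinOn hne
    hcont.continuousOn
  have hu0 : u ≠ 0 := by
    rintro rfl
    simp at hu
  set μ := star u ⬝ᵥ Y.mulVec u
  have hμ : 0 < μ := hY.dotProduct_mulVec_pos hu0
  refine ⟨μ / n, by positivity, fun w => ?_⟩
  by_cases hw : w = 0
  · subst hw; simp
  have hnorm : 0 < ‖w‖ := norm_pos_iff.2 hw
  have h1 : μ ≤ star (‖w‖⁻¹ • w) ⬝ᵥ Y.mulVec (‖w‖⁻¹ • w) := by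
    refine hmin ?_
    simp [norm_smul, hnorm.ne']
  have h2 : star (‖w‖⁻¹ • w) ⬝ᵥ Y.mulVec (‖w‖⁻¹ • w) = (‖w‖ ^ 2)⁻¹ * (star w ⬝ᵥ Y.mulVec w) := by
    rw [star_trivial, star_trivial, Matrix.mulVec_smul, smul_dotProduct, dotProduct_smul,
      smul_eq_mul, smul_eq_mul]
    field_simp
  rw [h2, le_inv_mul_iff₀ (by positivity)] at h1
  have h3 : ∑ i, w i ^ 2 ≤ n * ‖w‖ ^ 2 := by
    calc ∑ i, w i ^ 2 ≤ ∑ _i : Fin n, ‖w‖ ^ 2 := by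
          refine Finset.sum_le_sum fun i _ => ?_
          have := norm_le_pi_norm w i
          rw [← sq_abs, ← Real.norm_eq_abs]
          gcongr
      _ = n * ‖w‖ ^ 2 := by simp
  have hn' : (0 : ℝ) < n := by exact_mod_cast hn
  calc μ / n * ∑ i, w i ^ 2 ≤ μ / n * (n * ‖w‖ ^ 2) := by gcongr
    _ = ‖w‖ ^ 2 * μ := by field_simp
    _ ≤ _ := h1

variable {V : Type*} [AddCommGroup V] [Module ℚ V] {B : LinearMap.BilinForm ℚ V}

theorem bilin_eq_sum {ι : Type*} [Fintype ι] (e : Basis ι ℚ V) (he : LinearMap.IsOrthoᵢ B e)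
    (x y : V) : B x y = ∑ a, e.repr x a * e.repr y a * B (e a) (e a) := by
  classical
  conv_lhs => rw [← e.sum_repr x, ← e.sum_repr y]
  simp only [map_sum, LinearMap.sum_apply, map_smul, LinearMap.smul_apply, smul_eq_mul]
  refine Finset.sum_congr rfl fun a _ => ?_
  rw [Finset.sum_eq_single a]
  · ring
  · intro b _ hb
    rw [show B (e b) (e a) = 0 from he hb]; ring
  · simp

/-- An orthogonal basis, together with a common denominator of the coordinates of a lattice. -/
theorem exists_orthogonal_coordinates (hB : B.IsSymm) (hpos : ∀ x : V, x ≠ 0 → 0 < B x x)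
    {L M : Submodule ℤ V} {p : ℕ} (hp : p ≠ 0) [FiniteDimensional ℚ V] {ι : Type*} [Fintype ι]
    (v : Basis ι ℤ L) (hM : ∀ x ∈ M, (p : ℚ) • x ∈ L) :
    ∃ e : Basis (Fin (finrank ℚ V)) ℚ V, LinearMap.IsOrthoᵢ B e ∧ (∀ a, 0 < B (e a) (e a)) ∧
      ∃ N : ℤ, N ≠ 0 ∧ ∀ x ∈ M, ∀ a, ∃ m : ℤ, N * e.repr x a = m := by
  have : Invertible (2 : ℚ) := invertibleOfNonzero two_ne_zero
  obtain ⟨e, he⟩ := LinearMap.BilinForm.exists_orthogonal_basis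
    (LinearMap.BilinForm.isSymm_iff.1 hB)
  refine ⟨e, he, fun a => hpos _ (e.ne_zero a), ?_⟩
  obtain ⟨N, hN⟩ := IsLocalization.exist_integer_multiples_of_finite (nonZeroDivisors ℤ)
    (fun ia : ι × Fin (finrank ℚ V) => e.repr (v ia.1 : V) ia.2)
  refine ⟨N * p, mul_ne_zero (nonZeroDivisors.coe_ne_zero N) (by exact_mod_cast hp),
    fun x hx a => ?_⟩
  choose t ht using fun i => hN (i, a)
  have h1 : (p : ℚ) • x = ∑ i, (v.repr ⟨_, hM x hx⟩ i : ℚ) • (v i : V) := by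
    have : (p : ℚ) • x = ((∑ i, v.repr ⟨_, hM x hx⟩ i • v i : L) : V) := by rw [v.sum_repr]
    refine this.trans ?_
    push_cast
    simp only [Int.cast_smul_eq_zsmul]
  refine ⟨∑ i, v.repr ⟨_, hM x hx⟩ i * t i, ?_⟩
  have h2 := congrArg (fun z => e.repr z a) h1
  simp only [map_smul, map_sum, Finsupp.smul_apply, Finsupp.coe_finsetSum, Finset.sum_apply,
    smul_eq_mul] at h2
  push_cast
  rw [mul_assoc, h2, Finset.mul_sum]
  refine Finset.sum_congr rfl fun i _ => ?_
  have h3 : (t i : ℚ) = N * e.repr (v i : V) a := by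
    have := ht i
    simpa [zsmul_eq_mul] using this
  rw [h3]; ring

/-- Orthogonal coordinates with common denominator N embed M into ℤ^m, where the series is part of a
product of one-dimensional Gaussian sums. -/
theorem summable_exp_form {M : Submodule ℤ V} {ι : Type*} [Fintype ι] {m : ℕ}
    (e : Basis (Fin m) ℚ V) (he : LinearMap.IsOrthoᵢ B e) (hpos : ∀ a, 0 < B (e a) (e a))
    {N : ℤ} (hN : N ≠ 0) (hM : ∀ x ∈ M, ∀ a, ∃ m : ℤ, N * e.repr x a = m) {c : ℝ} (hc : 0 < c) :
    Summable fun x : M => Real.exp (-c * (B (x : V) (x : V) : ℚ)) := by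
  choose F hF using hM
  let b : Fin m → ℝ := fun a => c * (B (e a) (e a) : ℚ) / (N : ℝ) ^ 2
  have hN' : (N : ℝ) ≠ 0 := by exact_mod_cast hN
  have hN'' : (N : ℚ) ≠ 0 := by exact_mod_cast hN
  have hb : ∀ a, 0 < b a := fun a => by
    have : (0 : ℝ) < (B (e a) (e a) : ℚ) := by exact_mod_cast hpos a
    positivity
  have h1 := summable_pi_prod (fun a (t : ℤ) => Real.exp (-(b a) * (t : ℝ) ^ 2))
    (fun _ _ => (Real.exp_pos _).le) fun a => summable_exp_neg_mul_sq (hb a)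
  have hinj : Function.Injective fun (x : M) a => F x x.2 a := by
    intro x y hxy
    refine Subtype.ext (e.repr.injective (Finsupp.ext fun a => ?_))
    have h2 : (F x x.2 a : ℚ) = F y y.2 a := by exact_mod_cast congrFun hxy a
    rw [← hF, ← hF] at h2
    exact mul_left_cancel₀ hN'' h2
  refine (h1.comp_injective hinj).congr fun x => ?_
  rw [Function.comp_apply, ← Real.exp_sum, bilin_eq_sum e he]
  congr 1
  push_cast
  rw [Finset.mul_sum]
  refine Finset.sum_congr rfl fun a _ => ?_
  have h2 : (F x x.2 a : ℝ) = N * (e.repr (x : V) a : ℚ) := by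
    have := hF x x.2 a
    exact_mod_cast this.symm
  simp only [b]
  rw [h2]
  field_simp

/-- In orthogonal coordinates Im Tr(Tτ) is a sum, with positive weights B(e a, e a), of values of
the form Im τ. Bounding each one below by c times a sum of squares separates the variables x i. -/
theorem norm_expTr_le {n : ℕ} {m : ℕ} (e : Basis (Fin m) ℚ V) (he : LinearMap.IsOrthoᵢ B e)
    (hpos : ∀ a, 0 < B (e a) (e a)) {τ : Matrix (Fin n) (Fin n) ℂ} {c : ℝ}
    (hc : ∀ w : Fin n → ℝ, c * ∑ i, w i ^ 2 ≤ ∑ i, ∑ i', w i * w i' * (τ.map Complex.im) i' i)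
    (x : Fin n → V) : ‖expTr (gram B x) τ‖ ≤
      ∏ i, Real.exp (-(Real.pi * c) * (B (x i) (x i) : ℚ)) := by
  have hre : ∀ w : ℂ, ((Real.pi : ℂ) * Complex.I * w).re = -Real.pi * w.im := by
    intro w; simp
  rw [expTr, Complex.norm_exp, hre, ← Real.exp_sum, Real.exp_le_exp]
  have him : (Matrix.trace ((gram B x).map (fun t : ℚ => (t : ℂ)) * τ)).im =
      ∑ a, (B (e a) (e a) : ℝ) * ∑ i, ∑ i',
        (e.repr (x i) a : ℝ) * (e.repr (x i') a : ℝ) * (τ.map Complex.im) i' i := by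
    simp only [Matrix.trace, Matrix.diag, Matrix.mul_apply, Matrix.map_apply, gram,
      Matrix.of_apply, Complex.im_sum]
    have h1 : ∀ i i', (((B (x i) (x i') : ℚ) : ℂ) * τ i' i).im =
        ∑ a, (B (e a) (e a) : ℝ) * ((e.repr (x i) a : ℝ) * (e.repr (x i') a : ℝ) *
          (τ i' i).im) := by
      intro i i'
      have : ((B (x i) (x i') : ℚ) : ℂ) = (((B (x i) (x i') : ℚ) : ℝ) : ℂ) := by simp
      rw [this, Complex.im_ofReal_mul, bilin_eq_sum e he]
      push_cast
      rw [Finset.sum_mul]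
      exact Finset.sum_congr rfl fun a _ => by ring
    simp only [h1, Finset.mul_sum]
    rw [Finset.sum_congr rfl fun i _ => Finset.sum_comm, Finset.sum_comm]
  have hle : ∑ i, c * ((B (x i) (x i) : ℚ) : ℝ) ≤
      (Matrix.trace ((gram B x).map (fun t : ℚ => (t : ℂ)) * τ)).im := by
    rw [him]
    have h1 : ∑ i, c * ((B (x i) (x i) : ℚ) : ℝ) =
        ∑ a, (B (e a) (e a) : ℝ) * (c * ∑ i, (e.repr (x i) a : ℝ) ^ 2) := by
      simp only [bilin_eq_sum e he (x _)]
      push_cast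
      simp only [Finset.mul_sum]
      rw [Finset.sum_comm]
      exact Finset.sum_congr rfl fun a _ => Finset.sum_congr rfl fun i _ => by ring
    rw [h1]
    refine Finset.sum_le_sum fun a _ => ?_
    have h2 : (0 : ℝ) ≤ (B (e a) (e a) : ℚ) := by exact_mod_cast (hpos a).le
    exact mul_le_mul_of_nonneg_left (hc fun i => (e.repr (x i) a : ℝ)) h2
  have hpi := Real.pi_pos
  calc _ ≤ -Real.pi * ∑ i, c * ((B (x i) (x i) : ℚ) : ℝ) := by
        have := mul_le_mul_of_nonneg_left hle hpi.le
        linarith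
    _ = _ := by
        rw [Finset.mul_sum]
        exact Finset.sum_congr rfl fun i _ => by ring

/-- Absolute convergence of theta series. -/
theorem summable_expTr (hB : B.IsSymm) (hpos : ∀ x : V, x ≠ 0 → 0 < B x x)
    {L M : Submodule ℤ V} {p : ℕ} (hp : p ≠ 0) [FiniteDimensional ℚ V] {ι : Type*} [Fintype ι]
    (v : Basis ι ℤ L) (hM : ∀ x ∈ M, (p : ℚ) • x ∈ L) {n : ℕ} {τ : Matrix (Fin n) (Fin n) ℂ}
    (hτ : τ ∈ siegelUpperHalfSpace n) :
    Summable fun x : Fin n → M => expTr (gram B fun i => ((x i : M) : V)) τ := by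
  obtain ⟨e, he, hepos, N, hN, hNM⟩ := exists_orthogonal_coordinates hB hpos hp v hM
  obtain ⟨c, hc, hcY⟩ := exists_pos_le_dotProduct hτ.2
  refine Summable.of_norm_bounded (summable_pi_prod
    (fun _ (x : M) => Real.exp (-(Real.pi * c) * (B (x : V) (x : V) : ℚ)))
    (fun _ _ => (Real.exp_pos _).le) fun _ => summable_exp_form (ι := ι) e he hepos hN hNM
      (mul_pos Real.pi_pos hc)) fun x => norm_expTr_le e he hepos hcY _

end

end SiegelTheta

/-! ### The sum of the theta series of the `K_j` -/

namespace SiegelTheta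

open Module

noncomputable section

variable {V : Type*} [AddCommGroup V] [Module ℚ V] {B : LinearMap.BilinForm ℚ V}

/-- The lattice `p⁻¹L`. -/
def invLattice (p : ℕ) (L : Submodule ℤ V) : Submodule ℤ V where
  carrier := {x | (p : ℚ) • x ∈ L}
  add_mem' := fun {x y} hx hy => by
    change (p : ℚ) • (x + y) ∈ L
    rw [smul_add]; exact L.add_mem hx hy
  zero_mem' := by
    change (p : ℚ) • (0 : V) ∈ L
    rw [smul_zero]; exact L.zero_mem
  smul_mem' := fun n x hx => by
    change (p : ℚ) • (n • x) ∈ L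
    rw [smul_comm]; exact L.smul_mem n hx

/-- Each theta series is a sum over pairs (Ω, basis of Ω) with the basis in K. Evenness of K puts
the formal lattice of every tuple among the Ω, and orbits are disjoint, so no tuple is repeated.
Adding over K and grouping by Ω produces the number of K containing Ω. -/
theorem hasSum_theta {p n k : ℕ} {L : Submodule ℤ V} {τ : Matrix (Fin n) (Fin n) ℂ}
    (hB : B.IsSymm)
    (hsum : Summable fun x : Fin n → invLattice p L =>
      expTr (gram B fun i => ((x i : invLattice p L) : V)) τ)
    {S : Set (Submodule ℤ V)} (hS : S.Finite)
    (hSL : ∀ K ∈ S, K ≤ invLattice p L) (hSe : ∀ K ∈ S, IsEvenIntegral B K) :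
    (∀ K ∈ S, Summable fun x : Fin n → K => expTr (gram B fun i => ((x i : K) : V)) τ) ∧
    (∀ Ω ∈ formalLattices p B L n k,
      Summable fun y : Ω => expTr (gram B (y : Fin n → V)) τ) ∧
    HasSum (fun Ω : formalLattices p B L n k =>
      (thetaCoeff S (Ω : Set (Fin n → V)) : ℂ) * expLattice B (Ω : Set (Fin n → V)) τ)
      (∑ᶠ K ∈ S, theta B K τ) := by
  classical
  have h₁ : ∀ K ∈ S, Summable fun x : Fin n → K =>
      expTr (gram B fun i => ((x i : K) : V)) τ := by
    intro K hK
    let ι : (Fin n → K) → Fin n → invLattice p L := fun x i => ⟨x i, hSL K hK (x i).2⟩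
    have hι : Function.Injective ι := by
      intro x y hxy
      funext i
      exact Subtype.ext (congrArg (fun z : Fin n → invLattice p L => (z i : V)) hxy)
    exact (hsum.comp_injective hι).congr fun x => rfl
  have hframe : ∀ Ω ∈ formalLattices p B L n k, ∀ y ∈ Ω, Ω = frames k y ∧
      ∀ i, y i ∈ invLattice p L := by
    rintro Ω ⟨x, hx, -, rfl⟩ y hy
    exact ⟨(frames_eq hy).symm, frames_mem hy (invLattice p L) hx⟩
  have h₂ : ∀ Ω ∈ formalLattices p B L n k,
      Summable fun y : Ω => expTr (gram B (y : Fin n → V)) τ := by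
    intro Ω hΩ
    let ι : Ω → Fin n → invLattice p L := fun y i => ⟨y.1 i, (hframe Ω hΩ y y.2).2 i⟩
    have hι : Function.Injective ι := by
      intro x y hxy
      refine Subtype.ext (funext fun i => ?_)
      exact congrArg (fun z : Fin n → invLattice p L => (z i : V)) hxy
    exact (hsum.comp_injective hι).congr fun x => rfl
  refine ⟨h₁, h₂, ?_⟩
  let f : Submodule ℤ V → (Σ Ω : formalLattices p B L n k, (Ω : Set (Fin n → V))) → ℂ :=
    fun K y => if ∀ i, (y.2 : Fin n → V) i ∈ K then expTr (gram B (y.2 : Fin n → V)) τ else 0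
  have hf : ∀ K ∈ S, HasSum (f K) (theta B K τ) := by
    intro K hK
    let g : (Fin n → K) → Σ Ω : formalLattices p B L n k, (Ω : Set (Fin n → V)) := fun x =>
      ⟨⟨frames k fun i => (x i : V), fun i => (x i : V), fun i => hSL K hK (x i).2,
        isEvenMatrix_gram hB (hSe K hK) fun i => (x i).2, rfl⟩,
        fun i => (x i : V), self_mem_frames k _⟩
    have hg2 : ∀ x, ((g x).2 : Fin n → V) = fun i => (x i : V) := fun x => rfl
    have hg : Function.Injective g := by
      intro x y hxy
      have h3 : ((g x).2 : Fin n → V) = (g y).2 := by rw [hxy]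
      rw [hg2, hg2] at h3
      funext i
      exact Subtype.ext (congrFun h3 i)
    rw [← hg.hasSum_iff]
    · have h4 : f K ∘ g = fun x : Fin n → K => expTr (gram B fun i => ((x i : K) : V)) τ := by
        funext x
        simp only [Function.comp_apply, f, hg2]
        rw [if_pos fun i => (x i).2]
      rw [h4]
      exact (h₁ K hK).hasSum
    · rintro ⟨⟨Ω, hΩ⟩, y, hy⟩ hne
      simp only [f]
      rw [if_neg]
      intro hyK
      refine hne ⟨fun i => ⟨y i, hyK i⟩, ?_⟩
      obtain ⟨rfl, -⟩ := hframe Ω hΩ y hy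
      rfl
  rw [finsum_mem_eq_finite_toFinset_sum _ hS]
  have hsumf := hasSum_sum fun K (hK : K ∈ hS.toFinset) => hf K (hS.mem_toFinset.1 hK)
  -- Within one Ω the number of K containing a basis y is constant, since all bases of Ω generate
  -- the same subgroup.
  refine hsumf.sigma fun Ω => ?_
  have h5 : ∀ y : (Ω : Set (Fin n → V)), ∑ K ∈ hS.toFinset, f K ⟨Ω, y⟩ =
      (thetaCoeff S (Ω : Set (Fin n → V)) : ℂ) * expTr (gram B (y : Fin n → V)) τ := by
    intro y
    simp only [f]
    rw [← Finset.sum_filter, Finset.sum_const, nsmul_eq_mul]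
    congr 2
    rw [thetaCoeff, ← Set.ncard_coe_finset]
    congr 1
    ext K
    obtain ⟨h6, -⟩ := hframe Ω Ω.2 y y.2
    simp only [Finset.coe_filter, Set.Finite.mem_toFinset]
    refine and_congr_right fun _ => ⟨fun h z hz => ?_, fun h => h y y.2⟩
    rw [h6] at hz
    exact frames_mem hz K h
  simp only [h5]
  exact (h₂ Ω Ω.2).hasSum.mul_left _

end

end SiegelTheta

/-- `L` is an even integral lattice of rank `2k` in the positive definite quadratic space `(V, B)`,
and `p` is a prime not dividing its level.  The set of the `K_j` is finite, all series converge
(absolutely), `∑_{K_j} θ(K_j;τ) = ∑_Ω b_j(Ω) e{Ωτ}`, and `b_j(Ω)` is given by the formula attached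
to any decomposition `Ω = (1/p) Ω₀ ⊕ Ω₁ ⊕ p Ω₂`; such a decomposition always exists. -/
theorem proposition2p2 {V : Type*} [AddCommGroup V] [Module ℚ V]
    (B : LinearMap.BilinForm ℚ V) (L : Submodule ℤ V) (k n j p : ℕ)
    (hsymm : B.IsSymm) (hpos : ∀ x : V, x ≠ 0 → 0 < B x x)
    (hrank : Module.finrank ℚ V = 2 * k) (hlat : Submodule.IsLattice ℚ L)
    (heven : SiegelTheta.IsEvenIntegral B L)
    (hp : p.Prime) (hlevel : ¬ p ∣ SiegelTheta.level B L)
    (hn : 1 ≤ n) (hnk : n ≤ 2 * k) (hj : 1 ≤ j)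
    (hjplus : SiegelTheta.chi p B L = 1 → j ≤ k)
    (hjminus : SiegelTheta.chi p B L = -1 → j < k) :
    (SiegelTheta.neighbours p B L j).Finite ∧
    (∀ τ ∈ SiegelTheta.siegelUpperHalfSpace n,
      (∀ K ∈ SiegelTheta.neighbours p B L j,
        Summable fun x : Fin n → K =>
          SiegelTheta.expTr (SiegelTheta.gram B fun i => ((x i : K) : V)) τ) ∧
      (∀ Ω ∈ SiegelTheta.formalLattices p B L n k,
        Summable fun y : Ω => SiegelTheta.expTr (SiegelTheta.gram B (y : Fin n → V)) τ) ∧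
      HasSum
        (fun Ω : SiegelTheta.formalLattices p B L n k =>
          (SiegelTheta.thetaCoeff (SiegelTheta.neighbours p B L j) (Ω : Set (Fin n → V)) : ℂ) *
            SiegelTheta.expLattice B (Ω : Set (Fin n → V)) τ)
        (∑ᶠ K ∈ SiegelTheta.neighbours p B L j, SiegelTheta.theta B K τ)) ∧
    (∀ Ω ∈ SiegelTheta.formalLattices p B L n k,
      (∃ x ∈ Ω, Nonempty (SiegelTheta.Decomposition p L x)) ∧
      ∀ x ∈ Ω, ∀ D : SiegelTheta.Decomposition p L x,
        (SiegelTheta.chi p B L = 1 →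
          (SiegelTheta.thetaCoeff (SiegelTheta.neighbours p B L j) Ω : ℚ) =
            SiegelTheta.formulaPlus p B k j D) ∧
        (SiegelTheta.chi p B L = -1 →
          (SiegelTheta.thetaCoeff (SiegelTheta.neighbours p B L j) Ω : ℚ) =
            SiegelTheta.formulaMinus p B k j D)) := by
  classical
  have := Fact.mk hp
  obtain ⟨hu, ⟨v⟩⟩ := SiegelTheta.pUnimodular_of_level hp hpos hsymm hlat hlevel
  obtain ⟨q, hq₁, hq₂⟩ := SiegelTheta.exists_modP_form (p := p) hsymm heven
  have hgood : SiegelTheta.GoodReduction p B L q :=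
    ⟨⟨hp⟩, SiegelTheta.finite_modP hp v, ⟨hq₁, hq₂⟩, hsymm, heven, hu, ⟨v⟩⟩
  have := hgood.finite
  have hfin := SiegelTheta.finite_neighbours hgood j
  -- `finrank` is 0 by default in infinite dimension; 1 ≤ n ≤ 2k excludes this.
  have hfd : FiniteDimensional ℚ V := FiniteDimensional.of_finrank_pos (by omega)
  refine ⟨hfin, fun τ hτ => ?_, ?_⟩
  · refine SiegelTheta.hasSum_theta hsymm
      (SiegelTheta.summable_expTr hsymm hpos hp.ne_zero v (fun x hx => hx) hτ) hfin
      (fun K hK x hx => hK.2.1 x hx) fun K hK => hK.2.2.2.isEvenIntegral hsymm heven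
  · rintro Ω ⟨x₀, hx₀, hx₀e, rfl⟩
    refine ⟨SiegelTheta.exists_decomposition hp L k x₀ hx₀, fun x hx D => ?_⟩
    have hxe := SiegelTheta.isEvenMatrix_gram_of_mem_frames hsymm hx₀e hx
    rw [← SiegelTheta.frames_eq hx, SiegelTheta.thetaCoeff_frames]
    exact SiegelTheta.count_neighbours_eq_formula D hgood hxe hrank j
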